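/- Let $K=\mathbb R$ or $\mathbb C$; all Lie algebras are finite-dimensional over $K$. Let $\varphi_1(t)=\frac{t}{e^t-1}$, $\psi(t)=-\frac12(\varphi_1(t)-1)$, $R(t)=\frac{e^t-e^{-t}-2t}{t^2}$, $$\beta_\alpha(t)=\varphi_1(-t)\Big(\frac{\varphi_1(t)-1}{t}+\alpha\Big),\qquad \gamma_\alpha(t)=\beta_\alpha(t)-\beta_\alpha(0)+\psi'(0)-\psi'(t)$$ (formal power series over $K$). *Kashiwara–Vergne solutions.* A solution of the Kashiwara–Vergne conjecture for a Lie algebra $\mathfrak g$ is a pair of $\mathfrak g$-valued analytic functions $A,B$ on an open neighbourhood $U$ of $(0,0)$ in $\mathfrak g\times\mathfrak g$, with $A(0,0)=B(0,0)=0$, such that for all $(X,Y)\in U$ $$\ln(\exp Y\exp X)-X-Y=(\mathrm{id}-e^{-\operatorname{ad}X})A(X,Y)+(e^{\operatorname{ad}Y}-\mathrm{id})B(X,Y),$$ $$\operatorname{tr}\big(\operatorname{ad}X\circ\delta_1A(X,Y)+\operatorname{ad}Y\circ\delta_2B(X,Y)\big)=\operatorname{tr}\big(\psi(\operatorname{ad}X)+\psi(\operatorname{ad}Y)-\psi(\operatorname{ad}\ln(\exp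 X\exp Y))\big),$$ where $\ln(\exp X\exp Y)$ is the sum of the Campbell–Hausdorff series and $\delta_1A$, $\delta_2B$ are the differentials of $A$ in the first and of $B$ in the second variable. A solution is symmetric if $(A(X,Y),B(X,Y))=(B(-Y,-X),A(-Y,-X))$ near $(0,0)$. A universal solution is a pair of series in Lie polynomials $$A=\rho X+\beta(\operatorname{ad}X)(Y)+o(Y),\qquad B=\alpha X+\gamma(\operatorname{ad}X)(Y)+o(Y),$$ with $\alpha,\rho\in K$ and $\beta,\gamma\in K[[t]]$, where $o(Y)$ stands for a series in the Lie words $\operatorname{ad}_{(\operatorname{ad}X)^{j_1}Y}\circ\cdots\circ\operatorname{ad}_{(\operatorname{ad}X)^{j_{k-1}}Y}\circ(\operatorname{ad}X)^{j_k}(Y)$ with $k\ge2$ and $j_{k-1}<j_k$, such that for every Lie algebra $\mathfrak g$ the two series (summed by total degree) converge near $(0,0)$ and their sums are a solution for $\mathfrak g$. It is symmetric if these sums are symmetric for every $\mathfrak g$. *Vergne's solution.* Let $\mathfrak g$ be a quadratic Lie algebra, that is, a Lie algebra with an invariant nondegenerate symmetric bilinear form $\langle\cdot,\cdot\rangle$.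 Let $\varpi$ be the 2-form $\varpi_X(u,v)=\frac12\langle R(\operatorname{ad}X)u,v\rangle$, defined near $0$ in $\mathfrak g$, let $Z(X,Y)=\ln(\exp Y\exp X)$, and let $\omega$ be the 2-form near $(0,0)$ in $\mathfrak g\times\mathfrak g$ given by $$\omega_{(X,Y)}\big((u_1,v_1),(u_2,v_2)\big)=\varpi_X(u_1,u_2)+\varpi_Y(v_1,v_2)-(Z^*\varpi)_{(X,Y)}\big((u_1,v_1),(u_2,v_2)\big)+\tfrac12\big(\langle\theta^R_Xu_1,\theta^L_Yv_2\rangle-\langle\theta^R_Xu_2,\theta^L_Yv_1\rangle\big),$$ with $\theta^R_X=\frac{e^{\operatorname{ad}X}-1}{\operatorname{ad}X}$ and $\theta^L_Y=\frac{1-e^{-\operatorname{ad}Y}}{\operatorname{ad}Y}$. Let $\alpha_p(b)=\int_0^1 s\,\omega_{sp}(p,b)\,ds$ be the 1-form obtained from $\omega$ by the radial homotopy. The component $B_V$ of Vergne's symmetric solution $(A_V,B_V)$ for $\mathfrak g$ is given near $(0,0)$ by $$\Big\langle\frac{e^{\operatorname{ad}Y}-1}{\operatorname{ad}Y}B_V(X,Y),\,v\Big\rangle=\alpha_{(X,Y)}(0,v)\qquad(v\in\mathfrak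 g).$$ **Statement.** 1. There is exactly one power series $\gamma_V\in K[[t]]$ such that for every quadratic Lie algebra and every $X$ sufficiently near $0$ $$B_V(X,Y)=\tfrac14X+\gamma_V(\operatorname{ad}X)(Y)+o(Y)\qquad(Y\to0).$$ It satisfies $$t\gamma_V'(t)+2\gamma_V(t)=\tfrac18t-\tfrac12\,t\,\varphi_1(-t)R(t)\varphi_1'(t)=\tfrac18t+\tfrac1{12}t^2+\tfrac1{72}t^3-\tfrac1{360}t^4+o(t^4),$$ and $\gamma_V$ and $\gamma_{1/4}$ have the same odd part. 2. Every universal symmetric solution has $B(X,Y)=\frac14X+\gamma_{1/4}(\operatorname{ad}X)(Y)+o(Y)$, and $$t\gamma_{1/4}'(t)+2\gamma_{1/4}(t)=\tfrac18t+\tfrac1{12}t^2+\tfrac1{72}t^3-\tfrac1{480}t^4+o(t^4).$$ 3. Vergne's solution is not universal: there is no universal solution $(A,B)$ (symmetric or not) such that for every quadratic Lie algebra the sum of the series $B$ coincides with $B_V$ near $(0,0)$. -/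

import Mathlib

open scoped PowerSeries Topology Nat

namespace KashiwaraVergne

noncomputable section

/-! ### Formal power series in one variable -/

section Series

variable (K : Type) [RCLike K]

/-- The power series `(f(t) - f(0)) / t`. -/
def divT {K : Type} [RCLike K] (f : K⟦X⟧) : K⟦X⟧ :=
  PowerSeries.mk fun n => PowerSeries.coeff (n + 1) f

theorem X_mul_divT {K : Type} [RCLike K] (f : K⟦X⟧) :
    PowerSeries.X * divT f = f - PowerSeries.C (PowerSeries.constantCoeff f) := by
  ext n
  cases n with
  | zero => simp
  | succ n => simp [divT, PowerSeries.coeff_succ_X_mul]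

/-- The power series `f(-t)`. -/
def neg {K : Type} [RCLike K] (f : K⟦X⟧) : K⟦X⟧ := PowerSeries.evalNegHom f

/-- The power series `(e^t - 1) / t`. -/
def expQuot : K⟦X⟧ := divT (PowerSeries.exp K)

/-- The generating series `φ₁(t) = t / (e^t - 1)` of the Bernoulli numbers. -/
def phi1 : K⟦X⟧ := (expQuot K)⁻¹

theorem phi1_mul_exp_sub_one : phi1 K * (PowerSeries.exp K - 1) = PowerSeries.X := by
  have h : PowerSeries.exp K - 1 = PowerSeries.X * expQuot K := by
    rw [expQuot, X_mul_divT]; simp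
  have h0 : PowerSeries.constantCoeff (expQuot K) ≠ 0 := by
    rw [← PowerSeries.coeff_zero_eq_constantCoeff_apply]
    simp [expQuot, divT, PowerSeries.coeff_exp]
  rw [h, phi1, mul_left_comm, PowerSeries.inv_mul_cancel _ h0, mul_one]

/-- `ψ(t) = -(φ₁(t) - 1) / 2`. -/
def psi : K⟦X⟧ := PowerSeries.C (-(1 / 2 : K)) * (phi1 K - 1)

/-- `R(t) = (e^t - e^{-t} - 2t) / t²`. -/
def R : K⟦X⟧ :=
  divT (divT (PowerSeries.exp K - neg (PowerSeries.exp K) - PowerSeries.C 2 * PowerSeries.X))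

theorem X_sq_mul_R : PowerSeries.X ^ 2 * R K =
    PowerSeries.exp K - neg (PowerSeries.exp K) - PowerSeries.C 2 * PowerSeries.X := by
  have h0 : PowerSeries.constantCoeff (neg (PowerSeries.exp K)) = 1 := by
    rw [← PowerSeries.coeff_zero_eq_constantCoeff_apply]
    simp [neg, PowerSeries.evalNegHom, PowerSeries.coeff_rescale, PowerSeries.coeff_exp,
      -PowerSeries.coeff_zero_eq_constantCoeff]
  have h1 : PowerSeries.coeff 1 (neg (PowerSeries.exp K)) = -1 := by
    simp [neg, PowerSeries.evalNegHom, PowerSeries.coeff_rescale, PowerSeries.coeff_exp]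
  have h2 : PowerSeries.constantCoeff (divT (PowerSeries.exp K - neg (PowerSeries.exp K) -
      PowerSeries.C 2 * PowerSeries.X)) = 0 := by
    rw [← PowerSeries.coeff_zero_eq_constantCoeff_apply]
    simp only [divT, PowerSeries.coeff_mk, map_sub, zero_add, h1, PowerSeries.coeff_C_mul,
      PowerSeries.coeff_one_X, PowerSeries.coeff_exp]
    norm_num
  rw [pow_two, mul_assoc, R, X_mul_divT, h2, map_zero, sub_zero, X_mul_divT]
  simp [h0]

variable {K}

/-- `β_α(t) = φ₁(-t) ((φ₁(t) - 1) / t + α)`. -/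
def betaAlpha (α : K) : K⟦X⟧ :=
  neg (phi1 K) * (divT (phi1 K - 1) + PowerSeries.C α)

/-- `γ_α(t) = β_α(t) - β_α(0) + ψ'(0) - ψ'(t)`. -/
def gammaAlpha (α : K) : K⟦X⟧ :=
  betaAlpha α - PowerSeries.C (PowerSeries.constantCoeff (betaAlpha α))
    + PowerSeries.C (PowerSeries.constantCoeff (PowerSeries.derivative K (psi K)))
    - PowerSeries.derivative K (psi K)

/-- `t f'(t) + 2 f(t)`. -/
def eulerPlusTwo (f : K⟦X⟧) : K⟦X⟧ :=
  PowerSeries.X * PowerSeries.derivative K f + PowerSeries.C 2 * f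

end Series

/-! ### The Campbell-Hausdorff series -/

section CampbellHausdorff

variable (K : Type) [RCLike K]

/-- The formal exponential `∑ sⁿ xⁿ / n!` of a generator of the free associative algebra on two
letters; the auxiliary variable `s` records the degree. -/
def expLetter (i : Bool) : (FreeAlgebra K Bool)⟦X⟧ :=
  PowerSeries.mk fun n => ((n ! : K)⁻¹) • FreeAlgebra.ι K i ^ n

/-- The homogeneous part of degree `n` of
`log (e^x e^y) = ∑_{k ≥ 1} (-1)^(k+1) / k * (e^x e^y - 1)^k`
in the completed free associative algebra (`x` is the letter `true`, `y` is `false`). -/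
def logExpExp (n : ℕ) : FreeAlgebra K Bool :=
  ∑ k ∈ Finset.Icc 1 n, ((-1 : K) ^ (k + 1) / (k : K)) •
    PowerSeries.coeff n ((expLetter K true * expLetter K false - 1) ^ k)

variable {K} {g : Type*} [LieRing g] [LieAlgebra K g]

/-- The operator `(c, v) ↦ (0, c u + [u, v])` on `K × g`. -/
def letterOp (u : g) : Module.End K (K × g) :=
  (LinearMap.inr K K g).comp
    ((LinearMap.toSpanSingleton K g u).coprod (LieAlgebra.ad K g u : g →ₗ[K] g))

/-- The linear map which sends a word `w₁ w₂ ⋯ wₙ` (`n ≥ 1`) in the letters `x, y` to the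
right-normed bracket `[w₁, [w₂, … [wₙ₋₁, wₙ] … ]]`, evaluated at `x = P`, `y = Q`. -/
def rightNormed (P Q : g) (w : FreeAlgebra K Bool) : g :=
  ((FreeAlgebra.lift K fun i : Bool => letterOp (K := K) (if i then P else Q)) w (1, 0)).2

theorem rightNormed_ι (P Q : g) (i : Bool) :
    rightNormed (K := K) P Q (FreeAlgebra.ι K i) = if i then P else Q := by
  simp [rightNormed, letterOp]

theorem rightNormed_ι_mul_ι_mul (P Q : g) (i j : Bool) (w : FreeAlgebra K Bool) :
    rightNormed (K := K) P Q (FreeAlgebra.ι K i * (FreeAlgebra.ι K j * w)) =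
      ⁅if i then P else Q, rightNormed (K := K) P Q (FreeAlgebra.ι K j * w)⁆ := by
  simp [rightNormed, letterOp]

variable (K)

/-- Dynkin's formula: the homogeneous part of degree `n` of the Campbell-Hausdorff series
`ln (exp P exp Q)`. -/
def bchTerm (P Q : g) (n : ℕ) : g :=
  ((n : K)⁻¹) • rightNormed (K := K) P Q (logExpExp K n)

/-- `ln (exp P exp Q)` for `P`, `Q` near `0`: the sum of the Campbell-Hausdorff series. -/
def bch [TopologicalSpace g] (P Q : g) : g := ∑' n, bchTerm K P Q n

end CampbellHausdorff

/-! ### The Kashiwara-Vergne equations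

A finite-dimensional Lie algebra carries its unique Hausdorff vector space topology. -/

section Equations

variable {K : Type} [RCLike K] {g : Type*} [LieRing g] [LieAlgebra K g]
  [TopologicalSpace g] [IsTopologicalAddGroup g] [ContinuousSMul K g] [T2Space g]
  [FiniteDimensional K g]

/-- The endomorphism `f(ad X)` of `g`, for a power series `f`. -/
def adSeries (f : K⟦X⟧) (X : g) : g →L[K] g :=
  ∑' n, PowerSeries.coeff n f •
    (LinearMap.toContinuousLinearMap (LieAlgebra.ad K g X : g →ₗ[K] g)) ^ n

variable (K)

/-- The map `F : g × g → g` is analytic (over `K`) on `U`, read in linear coordinates. -/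
def AnalyticOnPair (F : g → g → g) (U : Set (g × g)) : Prop :=
  let e := (Module.finBasis K g).equivFun
  AnalyticOnNhd K
    (fun p : (Fin (Module.finrank K g) → K) × (Fin (Module.finrank K g) → K) =>
      e (F (e.symm p.1) (e.symm p.2)))
    {p | (e.symm p.1, e.symm p.2) ∈ U}

/-- `(A, B)` is a solution of the Kashiwara-Vergne conjecture for the Lie algebra `g`:
the two Kashiwara-Vergne equations hold on some open neighbourhood of `(0, 0)`.  Here `δ₁A(X,Y)`
and `δ₂B(X,Y)` are the differentials in the first and in the second variable. -/
def IsSolution (A B : g → g → g) : Prop :=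
  ∃ U : Set (g × g), IsOpen U ∧ ((0 : g), (0 : g)) ∈ U ∧
    AnalyticOnPair K A U ∧ AnalyticOnPair K B U ∧ A 0 0 = 0 ∧ B 0 0 = 0 ∧
    ∀ X Y : g, (X, Y) ∈ U →
      (bch K Y X - X - Y =
        (A X Y - adSeries (neg (PowerSeries.exp K)) X (A X Y)) +
        (adSeries (PowerSeries.exp K) Y (B X Y) - B X Y)) ∧
      (LinearMap.trace K g
          ((LieAlgebra.ad K g X : g →ₗ[K] g) ∘ₗ
              (fderiv K (fun X' => A X' Y) X : g →ₗ[K] g) +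
            (LieAlgebra.ad K g Y : g →ₗ[K] g) ∘ₗ
              (fderiv K (fun Y' => B X Y') Y : g →ₗ[K] g)) =
        LinearMap.trace K g
          ((adSeries (psi K) X + adSeries (psi K) Y - adSeries (psi K) (bch K X Y) :
            g →L[K] g) : g →ₗ[K] g))

/-- `(A, B)` is symmetric: `(A(X, Y), B(X, Y)) = (B(-Y, -X), A(-Y, -X))` near `(0, 0)`. -/
def IsSymmetric (A B : g → g → g) : Prop :=
  ∀ᶠ p : g × g in 𝓝 (0, 0),
    A p.1 p.2 = B (-p.2) (-p.1) ∧ B p.1 p.2 = A (-p.2) (-p.1)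

end Equations

/-! ### Universal solutions -/

section Universal

/-- `word X Y [j₁, …, jₖ]` is
`ad_{(ad X)^{j₁} Y} ∘ ⋯ ∘ ad_{(ad X)^{jₖ₋₁} Y} ∘ (ad X)^{jₖ} (Y)`. -/
def word (K : Type) [RCLike K] {g : Type*} [LieRing g] [LieAlgebra K g] (X Y : g) :
    List ℕ → g
  | [] => 0
  | [j] => ((LieAlgebra.ad K g X) ^ j) Y
  | j :: i :: l => ⁅((LieAlgebra.ad K g X) ^ j) Y, word K X Y (i :: l)⁆

/-- The lists `[j₁, …, jₖ]` with `k ≥ 2` and `jₖ₋₁ < jₖ`. -/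
def Admissible : List ℕ → Prop
  | [] => False
  | [_] => False
  | [i, j] => i < j
  | _ :: i :: j :: l => Admissible (i :: j :: l)

/-- A series in Lie polynomials of two variables `X`, `Y`, written
`c X + f(ad X)(Y) + o(Y)` with
`o(Y) ∈ ∑_{k ≥ 2} ∑_{jₖ₋₁ < jₖ}
  K ad_{(ad X)^{j₁} Y} ∘ ⋯ ∘ ad_{(ad X)^{jₖ₋₁} Y} ∘ (ad X)^{jₖ} (Y)`. -/
structure LieSeries (K : Type) [RCLike K] where
  /-- the coefficient `c` of `X` -/
  lin : K
  /-- the power series `f` -/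
  fst : K⟦X⟧
  /-- the coefficients of the words in `o(Y)` -/
  rem : List ℕ → K
  rem_admissible : ∀ l, rem l ≠ 0 → Admissible l

variable {K : Type} [RCLike K]

/-- The homogeneous part of degree `n` of a Lie series, evaluated in a Lie algebra.  The words
`[j₁, …, jₖ]` of total degree `(j₁ + 1) + ⋯ + (jₖ + 1) = n` are indexed by the compositions
of `n`. -/
def LieSeries.term (S : LieSeries K) {g : Type*} [LieRing g] [LieAlgebra K g] (X Y : g)
    (n : ℕ) : g :=
  (if n = 1 then S.lin • X else 0) +
  (if 1 ≤ n then PowerSeries.coeff (n - 1) S.fst • ((LieAlgebra.ad K g X) ^ (n - 1)) Y else 0) +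
  ∑ c : Composition n, S.rem (c.blocks.map fun b => b - 1) •
    word K X Y (c.blocks.map fun b => b - 1)

/-- The sum of a Lie series in a Lie algebra. -/
def LieSeries.eval (S : LieSeries K) {g : Type*} [LieRing g] [LieAlgebra K g]
    [TopologicalSpace g] (X Y : g) : g :=
  ∑' n, S.term X Y n

/-- `(A, B)` is a universal solution: over every finite-dimensional Lie algebra, the two Lie
series converge near `(0, 0)` and their sums solve the Kashiwara-Vergne conjecture. -/
def IsUniversalSolution (A B : LieSeries K) : Prop :=
  ∀ (g : Type) [LieRing g] [LieAlgebra K g] [TopologicalSpace g] [IsTopologicalAddGroup g]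
    [ContinuousSMul K g] [T2Space g] [FiniteDimensional K g],
    (∀ᶠ p : g × g in 𝓝 (0, 0), Summable (A.term p.1 p.2) ∧ Summable (B.term p.1 p.2)) ∧
    IsSolution K (fun X Y : g => A.eval X Y) (fun X Y : g => B.eval X Y)

/-- `(A, B)` is a universal symmetric solution. -/
def IsUniversalSymmetricSolution (A B : LieSeries K) : Prop :=
  IsUniversalSolution A B ∧
  ∀ (g : Type) [LieRing g] [LieAlgebra K g] [TopologicalSpace g] [IsTopologicalAddGroup g]
    [ContinuousSMul K g] [T2Space g] [FiniteDimensional K g],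
    IsSymmetric (fun X Y : g => A.eval X Y) (fun X Y : g => B.eval X Y)

end Universal

/-! ### Vergne's solution for quadratic Lie algebras -/

section Vergne

/-- The structure of a quadratic Lie algebra: an invariant nondegenerate symmetric bilinear
form. -/
structure QuadraticStructure (K : Type) [RCLike K] (g : Type*) [LieRing g] [LieAlgebra K g] where
  form : LinearMap.BilinForm K g
  symm : form.IsSymm
  nondegenerate : form.Nondegenerate
  invariant : form.lieInvariant g

variable {K : Type} [RCLike K] {g : Type*} [LieRing g] [LieAlgebra K g]
  [TopologicalSpace g] [IsTopologicalAddGroup g] [ContinuousSMul K g] [T2Space g]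
  [FiniteDimensional K g]

namespace QuadraticStructure

variable (Q : QuadraticStructure K g)

/-- The 2-form `ϖ` on `g`: `ϖ_X(u, v) = ⟨R(ad X) u, v⟩ / 2`.  Its differential is the pull-back
under `exp` of the (suitably normalized) Cartan 3-form. -/
def varpi (X u v : g) : K := (1 / 2 : K) * Q.form (adSeries (R K) X u) v

/-- The right-invariant Maurer-Cartan form at `exp X`, in the chart `exp`:
`u ↦ ((e^{ad X} - 1) / ad X) u`. -/
def thetaRight (X u : g) : g := adSeries (expQuot K) X u

/-- The left-invariant Maurer-Cartan form at `exp Y`, in the chart `exp`: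
`v ↦ ((1 - e^{-ad Y}) / ad Y) v`. -/
def thetaLeft (Y v : g) : g := adSeries (neg (expQuot K)) Y v

/-- The closed 2-form `ω = ϖ_X + ϖ_Y - Z^* ϖ + ⟨θ^R(X) ∧ θ^L(Y)⟩ / 2` on `g × g` (near the
origin), where `Z(X, Y) = ln (exp Y exp X)`. -/
def omega (p a b : g × g) : K :=
  let Z : g × g → g := fun q => bch K q.2 q.1
  Q.varpi p.1 a.1 b.1 + Q.varpi p.2 a.2 b.2
    - Q.varpi (Z p) (fderiv K Z p a) (fderiv K Z p b)
    + (1 / 2 : K) *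
      (Q.form (thetaRight (K := K) p.1 a.1) (thetaLeft (K := K) p.2 b.2)
        - Q.form (thetaRight (K := K) p.1 b.1) (thetaLeft (K := K) p.2 a.2))

/-- The primitive of `ω` given by the radial homotopy:
`α_p(b) = ∫₀¹ s ω_{sp}(p, b) ds`. -/
def alpha (p b : g × g) : K := ∫ s in (0 : ℝ)..1, (s : K) * Q.omega ((s : K) • p) p b

/-- The gradient of `α` in the second variable: the `B'` with `⟨B', v⟩ = α_{(X,Y)}(0, v)` for
all `v`. -/
def gradY (X Y : g) : g :=
  let b := Module.finBasis K g
  ∑ i, Q.alpha (X, Y) (0, b i) • Q.form.dualBasis Q.nondegenerate b i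

/-- The component `B_V` of Vergne's solution: `((e^{ad Y} - 1) / ad Y) B_V(X, Y)` is the gradient
in `Y` of the 1-form `α`. -/
def vergneB (X Y : g) : g := adSeries (phi1 K) Y (Q.gradY X Y)

/-- `B_V(X, Y) = X / 4 + γ(ad X)(Y) + o(Y)` as `Y → 0`, for `X` near `0`. -/
def HasFirstOrderPart (γ : K⟦X⟧) : Prop :=
  ∀ᶠ X : g in 𝓝 0, Q.vergneB X 0 = (1 / 4 : K) • X ∧
    HasFDerivAt (fun Y : g => Q.vergneB X Y) (adSeries γ X) 0

end QuadraticStructure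

end Vergne

end

end KashiwaraVergne

/-!
# Vergne's solution of the Kashiwara-Vergne equations is not universal

Write `φ₁(t) = t / (e^t - 1)` and `Z = ln (exp Y exp X)`.

**Vergne's solution to first order in `Y`.**  A finite-dimensional Lie algebra can be normed so that
`‖[x, y]‖ ≤ ‖x‖ ‖y‖` (`exists_equiv_norm_lie_le`), and estimates word by word then give, uniformly
near the origin, `Z = X + φ₁(ad X) Y + O(Y²)` (`isBigO_bch`), `dZ(0, v) = φ₁(ad X) v + O(Y)`
(`isBigO_fderiv_bch_snd`), and `Z + (t φ₁')(ad X) Y + O(Y²)` for the derivative of `Z` in the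
direction of `(X, Y)` (`isBigO_fderiv_bch_self`).  The series `φ₁` arises here as follows.  The part
of degree one in `Y` of the right-normed bracket of a word is a multiple of `(ad X)ⁿ Y`, and the
factor can be computed in the affine Lie algebra of the line, `[D, E] = E`, with `X = D` and
`Y = E`; there the exponentials are explicit operators and their logarithm can be summed
(`kappa_logExpExp`).

Since `R(ad Z) Z = 0`, these expansions determine the integrand of the radial homotopy up to
`O(Y²)` (`isBigO_integrand`).  Its leading part has the form `f(ad X) Y`, and integrating
`s ↦ f(s ad X) (s Y)` over `[0, 1]` divides the coefficient of `tⁿ` in `f` by `n + 2`; this is the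
inverse of the operator `γ ↦ t γ' + 2 γ`, so that `γ_V` is the solution of the stated differential
equation (`QuadraticStructure.hasFirstOrderPart_gammaV`).  That `γ_V` and `γ_{1/4}` have the same
odd part follows from the differential equation `t φ₁' = φ₁ - φ₁² - t φ₁` (`gammaV_sub_neg`).

**Universal solutions.**  Let `X = a D + u E` and `Y = b D + v E` with `[D, E] = E`.  Every Lie word
counted in `o(Y)` is then a multiple of `(a v - u b) E`, so a Lie series is described by scalar
power series (`LieSeries.eval_affine`).  For `X = a D`, `Y = v E` the words in `o(Y)` vanish, and the
first equation gives `β = β_α` (`IsUniversalSolution.fst_left`).  For `X = t D`, `Y = t b D` the words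
vanish as well; their derivatives in the direction `E` enter the traces of the second equation
(`IsUniversalSolution.trace_identity`), but only through terms of order two in `b`, and comparing
the terms linear in `b` yields `γ = γ_α` (`IsUniversalSolution.fst_right`).  Symmetry at `X = 0` forces
`β(0) = -α`, hence `α = 1/4` (`IsUniversalSymmetricSolution.lin_right`).

**Comparison.**  The split oscillator algebra is quadratic and contains `D` and `E` with
`[D, E] = E`.  An operator `f(ad (a D))` acts on `E` by the scalar `f(a)`, so Vergne's solution on
this single algebra determines `γ_V` (`eq_gammaV_of_hasFirstOrderPart`).  If it were the sum of a
universal solution, that solution would have `α = 1/4`, and `γ_V` would be equal to `γ_{1/4}`; but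
their coefficients of `t⁴` differ (`IsUniversalSolution.not_eventually_eq_vergneB`,
`gammaV_ne_gammaAlpha`).
-/

set_option linter.unusedSectionVars false

namespace KashiwaraVergne

noncomputable section

/-! ### Identities between the power series -/
section SeriesIdentities
variable {K : Type} [RCLike K]
open PowerSeries

@[simp] theorem neg_add' (f g : K⟦X⟧) : neg (f + g) = neg f + neg g := map_add evalNegHom f g
@[simp] theorem neg_sub' (f g : K⟦X⟧) : neg (f - g) = neg f - neg g := map_sub evalNegHom f g
@[simp] theorem neg_mul' (f g : K⟦X⟧) : neg (f * g) = neg f * neg g := map_mul evalNegHom f g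
@[simp] theorem neg_one' : neg (1 : K⟦X⟧) = 1 := map_one evalNegHom
@[simp] theorem neg_X' : neg (X : K⟦X⟧) = -X := evalNegHom_X
theorem coeff_neg' (f : K⟦X⟧) (n : ℕ) : coeff n (neg f) = (-1) ^ n * coeff n f := by
  simp [neg, evalNegHom, coeff_rescale]
@[simp] theorem neg_C (a : K) : neg (C a) = C a := by
  ext n; rw [coeff_neg', coeff_C]; split_ifs with h <;> simp [h]
@[simp] theorem neg_neg' (f : K⟦X⟧) : neg (neg f) = f := by
  ext n; rw [coeff_neg', coeff_neg', ← mul_assoc, ← mul_pow]; simp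
theorem neg_neg_one_smul (f : K⟦X⟧) : neg (-f) = -neg f := map_neg evalNegHom f

/-- `d/dt (f(-t)) = -f'(-t)`. -/
theorem neg_derivative (f : K⟦X⟧) : neg (d⁄dX K f) = -(d⁄dX K (neg f)) := by
  ext n
  rw [coeff_neg', map_neg, coeff_derivative, coeff_derivative, coeff_neg', pow_succ]; ring

theorem coeff_phi1_zero : coeff 0 (phi1 K) = 1 := by
  rw [coeff_zero_eq_constantCoeff_apply, phi1, constantCoeff_inv,
    ← coeff_zero_eq_constantCoeff_apply]
  simp [expQuot, divT, coeff_exp]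

theorem phi1_mul_expQuot : phi1 K * expQuot K = 1 := by
  refine PowerSeries.inv_mul_cancel _ ?_
  rw [← coeff_zero_eq_constantCoeff_apply]
  simp [expQuot, divT, coeff_exp]

theorem exp_sub_one_ne_zero : (exp K - 1 : K⟦X⟧) ≠ 0 := by
  intro h
  have := congrArg (coeff 1) h
  simp [coeff_exp, coeff_one] at this

theorem exp_mul_neg_exp : exp K * neg (exp K) = 1 := exp_mul_exp_neg_eq_one

/-- `φ₁(-t) = φ₁(t) + t`. -/
theorem neg_phi1 : neg (phi1 K) = phi1 K + X := by
  have h := phi1_mul_exp_sub_one K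
  have h1 := congrArg neg h
  simp only [neg_mul', neg_sub', neg_one', neg_X'] at h1
  have h2 := exp_mul_neg_exp (K := K)
  refine mul_right_cancel₀ (exp_sub_one_ne_zero (K := K)) ?_
  linear_combination (-exp K) * h1 + (neg (phi1 K)) * h2 - h

/-- The differential equation `t φ₁' = φ₁ - φ₁² - t φ₁`. -/
theorem X_mul_derivative_phi1 :
    X * d⁄dX K (phi1 K) = phi1 K - phi1 K ^ 2 - X * phi1 K := by
  have h := phi1_mul_exp_sub_one K
  have h1 := congrArg (d⁄dX K) h
  simp only [Derivation.leibniz, map_sub, derivative_exp, Derivation.map_one_eq_zero,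
    derivative_X, smul_eq_mul, sub_zero] at h1
  linear_combination (-d⁄dX K (phi1 K) - phi1 K) * h + phi1 K * h1

theorem X_mul_derivative_derivative_phi1 :
    X * d⁄dX K (d⁄dX K (phi1 K)) =
      -(2 * phi1 K + X) * d⁄dX K (phi1 K) - phi1 K := by
  have h1 := congrArg (d⁄dX K) (X_mul_derivative_phi1 (K := K))
  simp only [Derivation.leibniz, map_sub, derivative_X, smul_eq_mul, pow_two] at h1
  linear_combination h1

theorem two_mul_C_half : (2 : K⟦X⟧) * C (1 / 2 : K) = 1 := by
  have : (2 : K⟦X⟧) = C (2 : K) := (map_ofNat C 2).symm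
  rw [this, ← map_mul]; norm_num

/-- The identity `(e^t - e^{-t}) φ₁'' = t - 2 - 4 φ₁'`, the form in which `R` enters the comparison
of the odd parts of `γ_V` and `γ_{1/4}`. -/
theorem exp_sub_neg_exp_mul :
    (exp K - neg (exp K)) * d⁄dX K (d⁄dX K (phi1 K)) =
      X - 2 - 4 * d⁄dX K (phi1 K) := by
  have h := phi1_mul_exp_sub_one K
  have hp := X_mul_derivative_phi1 (K := K)
  have hq := X_mul_derivative_derivative_phi1 (K := K)
  have he := exp_mul_neg_exp (K := K)
  have hne : exp K * X ^ 2 ≠ 0 := by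
    refine mul_ne_zero (fun h0 => ?_) (pow_ne_zero _ X_ne_zero)
    rw [h0, zero_mul] at he; exact zero_ne_one he
  refine mul_left_cancel₀ hne ?_
  generalize d⁄dX K (d⁄dX K (phi1 K)) = q at *
  generalize d⁄dX K (phi1 K) = p at *
  generalize neg (exp K) = e' at *
  generalize exp K = e at *
  generalize phi1 K = f at *
  linear_combination (-X ^ 2 * q) * he + (e ^ 2 - 1) * X * hq
    + (-(e ^ 2 - 1) * (2 * f + X) + 4 * X * e) * hp
    + (-(e + 1) * (2 * f - 2 * f ^ 2 - 3 * f * X + 2 * X - X ^ 2)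
      - X * (2 - 2 * f - 3 * X) + 2 * (2 * X - 2 * X * f - 2 * X ^ 2)) * h

variable (K) in
/-- The right-hand side of the differential equation for `γ_V`. -/
def gammaVRhs : K⟦X⟧ :=
  C (1 / 8 : K) * X - C (1 / 2 : K) * X * neg (phi1 K) * R K * d⁄dX K (phi1 K)

variable (K) in
/-- The first-order coefficient `γ_V` of Vergne's solution: the power series solution of
`t γ' + 2 γ = t / 8 - t φ₁(-t) R φ₁' / 2`. -/
def gammaV : K⟦X⟧ := PowerSeries.mk fun n => coeff n (gammaVRhs K) / ((n : K) + 2)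

theorem coeff_eulerPlusTwo (f : K⟦X⟧) (n : ℕ) :
    coeff n (eulerPlusTwo f) = ((n : K) + 2) * coeff n f := by
  rw [eulerPlusTwo, map_add, coeff_C_mul]
  cases n with
  | zero => simp
  | succ n => rw [coeff_succ_X_mul, coeff_derivative]; push_cast; ring

theorem natCast_add_two_ne_zero (n : ℕ) : (n : K) + 2 ≠ 0 := by
  have : ((n + 2 : ℕ) : K) ≠ 0 := Nat.cast_ne_zero.2 (by omega)
  exact_mod_cast this

theorem eulerPlusTwo_injective {f g : K⟦X⟧} (h : eulerPlusTwo f = eulerPlusTwo g) : f = g := by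
  ext n
  have := congrArg (coeff n) h
  rw [coeff_eulerPlusTwo, coeff_eulerPlusTwo] at this
  exact mul_left_cancel₀ (natCast_add_two_ne_zero n) this

theorem eulerPlusTwo_gammaV : eulerPlusTwo (gammaV K) = gammaVRhs K := by
  ext n
  rw [coeff_eulerPlusTwo, gammaV, coeff_mk, mul_div_cancel₀ _ (natCast_add_two_ne_zero n)]

theorem neg_eulerPlusTwo (f : K⟦X⟧) : neg (eulerPlusTwo f) = eulerPlusTwo (neg f) := by
  simp only [eulerPlusTwo, neg_add', neg_mul', neg_X', neg_C, neg_derivative]; ring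

theorem eulerPlusTwo_sub (f g : K⟦X⟧) :
    eulerPlusTwo (f - g) = eulerPlusTwo f - eulerPlusTwo g := by
  simp only [eulerPlusTwo, map_sub]; ring

theorem neg_R : neg (R K) = -R K := by
  have h := X_sq_mul_R K
  have h1 := congrArg neg h
  simp only [neg_mul', neg_sub', neg_X', neg_C, neg_neg', pow_two] at h1
  refine mul_left_cancel₀ (pow_ne_zero 2 (X_ne_zero (R := K))) ?_
  linear_combination h1 + h

theorem derivative_psi : d⁄dX K (psi K) = -(C (1 / 2 : K)) * d⁄dX K (phi1 K) := by
  rw [psi, Derivation.leibniz, derivative_C, map_sub, Derivation.map_one_eq_zero]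
  simp

theorem X_mul_betaAlpha (α : K) :
    X * betaAlpha α = neg (phi1 K) * (phi1 K - 1 + X * C α) := by
  have h : X * divT (phi1 K - 1) = phi1 K - 1 := by
    rw [X_mul_divT]; simp [← coeff_zero_eq_constantCoeff_apply, coeff_phi1_zero,
      -coeff_zero_eq_constantCoeff]
  rw [betaAlpha]; linear_combination neg (phi1 K) * h

theorem C_ofNat_half (n : ℕ) [n.AtLeastTwo] : (OfNat.ofNat n : K⟦X⟧) = C (OfNat.ofNat n : K) :=
  (map_ofNat C n).symm

/-- Twice the odd part of `γ_{1/4}`. -/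
theorem gammaAlpha_sub_neg : gammaAlpha (1 / 4 : K) - neg (gammaAlpha (1 / 4 : K)) =
    -d⁄dX K (phi1 K) - C (1 / 2 : K) + C (1 / 4 : K) * X := by
  have hp := X_mul_derivative_phi1 (K := K)
  have hb := X_mul_betaAlpha (1 / 4 : K)
  have hb' := congrArg neg hb
  simp only [neg_mul', neg_add', neg_sub', neg_X', neg_C, neg_one', neg_phi1] at hb hb'
  have h2 := two_mul_C_half (K := K)
  simp only [gammaAlpha, neg_sub', neg_add', neg_C, derivative_psi, neg_mul', neg_neg_one_smul,
    neg_derivative, neg_phi1, map_add, derivative_X]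
  refine mul_left_cancel₀ (X_ne_zero (R := K)) ?_
  generalize neg (betaAlpha (1 / 4 : K)) = b' at *
  generalize (C (1 / 2 : K) : K⟦X⟧) = c at *
  generalize (C (1 / 4 : K) : K⟦X⟧) = c' at *
  linear_combination hb + hb' + 2 * hp + (X * d⁄dX K (phi1 K) + X) * h2

/-- `γ_V` and `γ_{1/4}` have the same odd part. -/
theorem gammaV_sub_neg : gammaV K - neg (gammaV K) =
    gammaAlpha (1 / 4 : K) - neg (gammaAlpha (1 / 4 : K)) := by
  apply eulerPlusTwo_injective
  rw [gammaAlpha_sub_neg, eulerPlusTwo_sub, ← neg_eulerPlusTwo, eulerPlusTwo_gammaV, gammaVRhs]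
  have hq := X_mul_derivative_derivative_phi1 (K := K)
  have hR := X_sq_mul_R K
  have hE := exp_sub_neg_exp_mul (K := K)
  simp only [eulerPlusTwo, neg_sub', neg_add', neg_C, neg_mul', neg_X', neg_derivative, neg_phi1,
    neg_R, map_add, map_sub, map_neg, derivative_X, Derivation.leibniz, derivative_C, smul_eq_mul]
  have h2 := two_mul_C_half (K := K)
  have h4 : (2 : K⟦X⟧) * C (1 / 4 : K) = C (1 / 2 : K) := by
    rw [C_ofNat_half, ← map_mul]; norm_num
  have h8 : (2 : K⟦X⟧) * C (1 / 8 : K) = C (1 / 4 : K) := by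
    rw [C_ofNat_half, ← map_mul]; norm_num
  have hC2 : (C (2 : K) : K⟦X⟧) = 2 := (C_ofNat_half 2).symm
  rw [hC2] at hR ⊢
  generalize (C (1 / 2 : K) : K⟦X⟧) = c at *
  generalize (C (1 / 4 : K) : K⟦X⟧) = c' at *
  generalize (C (1 / 8 : K) : K⟦X⟧) = c'' at *
  generalize d⁄dX K (d⁄dX K (phi1 K)) = q at *
  generalize d⁄dX K (phi1 K) = p at *
  linear_combination X * h8 - c * X * R K * hq + c * q * hR + c * hE
    - (X * q + 2 * p) * h2 - X * h4

theorem coeff_gammaV_of_odd {n : ℕ} (hn : Odd n) :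
    coeff n (gammaV K) = coeff n (gammaAlpha (1 / 4 : K)) := by
  have h := congrArg (coeff n) (gammaV_sub_neg (K := K))
  rw [map_sub, map_sub, coeff_neg', coeff_neg', hn.neg_one_pow] at h
  linear_combination h / 2

theorem coeff_expQuot (n : ℕ) : coeff n (expQuot K) = 1 / ((n + 1)! : K) := by
  simp [expQuot, divT, coeff_exp]

theorem coeff_R (n : ℕ) : coeff n (R K) = (1 - (-1) ^ n) / ((n + 2)! : K) := by
  have : n + 1 + 1 ≠ 1 := by omega
  simp only [R, divT, coeff_mk, map_sub, coeff_neg', coeff_exp, coeff_C_mul, coeff_X, this,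
    if_false, map_div₀, map_one, map_natCast]
  ring

/-- The recursion for the coefficients of `φ₁`, i.e. for the Bernoulli numbers. -/
theorem coeff_phi1_succ (n : ℕ) : coeff (n + 1) (phi1 K) =
    -∑ i ∈ Finset.range (n + 1), coeff i (phi1 K) / ((n + 2 - i)! : K) := by
  have h := congrArg (coeff (n + 1)) (phi1_mul_expQuot (K := K))
  rw [coeff_mul, Finset.Nat.sum_antidiagonal_eq_sum_range_succ
    (fun i j => coeff i (phi1 K) * coeff j (expQuot K)), Finset.sum_range_succ, coeff_one,
    if_neg n.succ_ne_zero] at h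
  simp only [coeff_expQuot, Nat.sub_self, zero_add, Nat.factorial_one, Nat.cast_one, div_one,
    mul_one] at h
  rw [eq_neg_iff_add_eq_zero, add_comm, ← h]
  congr 1
  refine Finset.sum_congr rfl fun i hi => ?_
  have : n + 1 - i + 1 = n + 2 - i := by have := Finset.mem_range.1 hi; omega
  rw [this, mul_one_div]

theorem coeff_phi1_one : coeff 1 (phi1 K) = -1 / 2 := by
  rw [coeff_phi1_succ]; simp [coeff_phi1_zero, -coeff_zero_eq_constantCoeff]; norm_num

theorem coeff_phi1_two : coeff 2 (phi1 K) = 1 / 12 := by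
  rw [coeff_phi1_succ]; simp [Finset.sum_range_succ, coeff_phi1_zero, coeff_phi1_one,
    Nat.factorial, -coeff_zero_eq_constantCoeff]; norm_num

theorem coeff_phi1_three : coeff 3 (phi1 K) = 0 := by
  rw [coeff_phi1_succ]; simp [Finset.sum_range_succ, coeff_phi1_zero, coeff_phi1_one,
    coeff_phi1_two, Nat.factorial, -coeff_zero_eq_constantCoeff]; norm_num

theorem coeff_phi1_four : coeff 4 (phi1 K) = -1 / 720 := by
  rw [coeff_phi1_succ]; simp [Finset.sum_range_succ, coeff_phi1_zero, coeff_phi1_one,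
    coeff_phi1_two, coeff_phi1_three, Nat.factorial, -coeff_zero_eq_constantCoeff]; norm_num

theorem coeff_phi1_five : coeff 5 (phi1 K) = 0 := by
  rw [coeff_phi1_succ]; simp [Finset.sum_range_succ, coeff_phi1_zero, coeff_phi1_one,
    coeff_phi1_two, coeff_phi1_three, coeff_phi1_four, Nat.factorial,
    -coeff_zero_eq_constantCoeff]; norm_num

theorem X_pow_five_dvd_gammaVRhs : X ^ 5 ∣ gammaVRhs K -
    (C (1 / 8 : K) * X + C (1 / 12 : K) * X ^ 2 + C (1 / 72 : K) * X ^ 3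
      - C (1 / 360 : K) * X ^ 4) := by
  rw [X_pow_dvd_iff]
  intro m hm
  rw [gammaVRhs, mul_assoc, mul_assoc, mul_assoc]
  interval_cases m <;>
  simp [coeff_X_pow, coeff_X, coeff_mul, Finset.Nat.antidiagonal_succ,
    coeff_neg', coeff_R, coeff_derivative, coeff_phi1_zero, coeff_phi1_one, coeff_phi1_two,
    coeff_phi1_three, coeff_phi1_four, Nat.factorial, -coeff_zero_eq_constantCoeff] <;> norm_num

theorem X_pow_five_dvd_gammaAlpha : X ^ 5 ∣ eulerPlusTwo (gammaAlpha (1 / 4 : K)) -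
    (C (1 / 8 : K) * X + C (1 / 12 : K) * X ^ 2 + C (1 / 72 : K) * X ^ 3
      - C (1 / 480 : K) * X ^ 4) := by
  rw [X_pow_dvd_iff]
  intro m hm
  rw [map_sub, coeff_eulerPlusTwo, gammaAlpha, betaAlpha, derivative_psi]
  interval_cases m <;>
  simp [coeff_X_pow, coeff_X, coeff_mul, Finset.Nat.antidiagonal_succ, divT, coeff_C, coeff_one,
    coeff_neg', coeff_derivative, coeff_phi1_zero, coeff_phi1_one, coeff_phi1_two,
    coeff_phi1_three, coeff_phi1_four, coeff_phi1_five, ← coeff_zero_eq_constantCoeff_apply,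
    -coeff_zero_eq_constantCoeff] <;> norm_num

/-- `γ_V ≠ γ_{1/4}`: the coefficients of `t⁴` differ. -/
theorem gammaV_ne_gammaAlpha : gammaV K ≠ gammaAlpha (1 / 4 : K) := by
  intro h
  have h1 := X_pow_dvd_iff.1 (X_pow_five_dvd_gammaVRhs (K := K)) 4 (by norm_num)
  have h2 := X_pow_dvd_iff.1 (X_pow_five_dvd_gammaAlpha (K := K)) 4 (by norm_num)
  rw [← h, eulerPlusTwo_gammaV] at h2
  have h3 := h1.trans h2.symm
  simp only [map_sub, map_add, coeff_C_mul, coeff_X_pow, coeff_X] at h3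
  norm_num at h3

theorem coeff_gammaV_one : coeff 1 (gammaV K) = 1 / 24 := by
  have h1 := X_pow_dvd_iff.1 (X_pow_five_dvd_gammaVRhs (K := K)) 1 (by norm_num)
  simp only [map_sub, map_add, coeff_C_mul, coeff_X_pow, coeff_X] at h1
  norm_num at h1
  rw [gammaV, coeff_mk, sub_eq_zero.1 h1]; norm_num

end SeriesIdentities

/-! ### The two-dimensional non-abelian Lie algebra -/
section Aff
variable (K : Type) [RCLike K]

/-- The Lie algebra of the affine group of the line: pairs `(d, e)`, standing for `d D + e E`, with
`[D, E] = E`. -/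
def Aff : Type := K × K

namespace Aff

instance : AddCommGroup (Aff K) := inferInstanceAs (AddCommGroup (K × K))
instance : Module K (Aff K) := inferInstanceAs (Module K (K × K))
instance : TopologicalSpace (Aff K) := inferInstanceAs (TopologicalSpace (K × K))
instance : IsTopologicalAddGroup (Aff K) := inferInstanceAs (IsTopologicalAddGroup (K × K))
instance : ContinuousSMul K (Aff K) := inferInstanceAs (ContinuousSMul K (K × K))
instance : T2Space (Aff K) := inferInstanceAs (T2Space (K × K))
instance : FiniteDimensional K (Aff K) := inferInstanceAs (FiniteDimensional K (K × K))

variable {K}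

omit [RCLike K] in
@[ext] theorem ext {x y : Aff K} (h1 : x.1 = y.1) (h2 : x.2 = y.2) : x = y := Prod.ext h1 h2

@[simp] theorem add_fst (x y : Aff K) : (x + y).1 = x.1 + y.1 := rfl
@[simp] theorem add_snd (x y : Aff K) : (x + y).2 = x.2 + y.2 := rfl
@[simp] theorem smul_fst (c : K) (x : Aff K) : (c • x).1 = c * x.1 := rfl
@[simp] theorem smul_snd (c : K) (x : Aff K) : (c • x).2 = c * x.2 := rfl
@[simp] theorem zero_fst : (0 : Aff K).1 = 0 := rfl
@[simp] theorem zero_snd : (0 : Aff K).2 = 0 := rfl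

instance : Bracket (Aff K) (Aff K) := ⟨fun x y => (0, x.1 * y.2 - x.2 * y.1)⟩

@[simp] theorem lie_fst (x y : Aff K) : ⁅x, y⁆.1 = 0 := rfl
@[simp] theorem lie_snd (x y : Aff K) : ⁅x, y⁆.2 = x.1 * y.2 - x.2 * y.1 := rfl

instance : LieRing (Aff K) where
  add_lie x y z := by ext <;> simp; ring
  lie_add x y z := by ext <;> simp; ring
  lie_self x := by ext <;> simp; ring
  leibniz_lie x y z := by ext <;> simp; ring

instance : LieAlgebra K (Aff K) where
  lie_smul c x y := by ext <;> simp; ring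

/-- The element `d D + e E`. -/
def mk (d e : K) : Aff K := (d, e)

omit [RCLike K] in
@[simp] theorem mk_fst (d e : K) : (mk d e).1 = d := rfl
omit [RCLike K] in
@[simp] theorem mk_snd (d e : K) : (mk d e).2 = e := rfl

variable (K) in
/-- The generator `D`. -/
def D : Aff K := mk 1 0
variable (K) in
/-- The generator `E`. -/
def E : Aff K := mk 0 1

@[simp] theorem D_fst : (D K).1 = 1 := rfl
@[simp] theorem D_snd : (D K).2 = 0 := rfl
@[simp] theorem E_fst : (E K).1 = 0 := rfl
@[simp] theorem E_snd : (E K).2 = 1 := rfl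

theorem lie_D_E : ⁅D K, E K⁆ = E K := by ext <;> simp

end Aff
end Aff

/-! ### Words and the Campbell-Hausdorff series -/
section Words
variable {K : Type} [RCLike K]

/-- The product of the letters of a word in the free algebra. -/
def wordProd (K : Type) [RCLike K] (w : List Bool) : FreeAlgebra K Bool :=
  (w.map (FreeAlgebra.ι K)).prod

@[simp] theorem wordProd_nil : wordProd K [] = 1 := rfl
@[simp] theorem wordProd_cons (i : Bool) (w : List Bool) :
    wordProd K (i :: w) = FreeAlgebra.ι K i * wordProd K w := by simp [wordProd]
theorem wordProd_append (v w : List Bool) :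
    wordProd K (v ++ w) = wordProd K v * wordProd K w := by simp [wordProd]
theorem wordProd_replicate (n : ℕ) (i : Bool) :
    wordProd K (List.replicate n i) = FreeAlgebra.ι K i ^ n := by simp [wordProd]

theorem span_range_wordProd : Submodule.span K (Set.range (wordProd K)) = ⊤ := by
  rw [eq_top_iff]
  intro a _
  induction a using FreeAlgebra.induction with
  | grade0 r =>
    rw [Algebra.algebraMap_eq_smul_one]
    exact Submodule.smul_mem _ _ (Submodule.subset_span ⟨[], rfl⟩)
  | grade1 i => exact Submodule.subset_span ⟨[i], by simp⟩
  | mul a b ha hb =>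
    have := Submodule.mul_mem_mul (ha trivial) (hb trivial)
    rw [Submodule.span_mul_span] at this
    refine Submodule.span_mono ?_ this
    rintro _ ⟨_, ⟨v, rfl⟩, _, ⟨w, rfl⟩, rfl⟩
    exact ⟨v ++ w, wordProd_append v w⟩
  | add a b ha hb => exact Submodule.add_mem _ (ha trivial) (hb trivial)

/-- `a` is a linear combination of words of length `n` with coefficients of total absolute value at
most `B`, in the dual formulation: a seminorm which is at most `M` on these words is at most `B M`
at `a`. -/
def WordBound (n : ℕ) (B : ℝ) (a : FreeAlgebra K Bool) : Prop :=
  ∀ (p : Seminorm K (FreeAlgebra K Bool)) (M : ℝ), 0 ≤ M →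
    (∀ w : List Bool, w.length = n → p (wordProd K w) ≤ M) → p a ≤ B * M

namespace WordBound

theorem zero (n : ℕ) : WordBound n 0 (0 : FreeAlgebra K Bool) := fun p M _ _ => by simp

theorem mono {n : ℕ} {B B' : ℝ} {a : FreeAlgebra K Bool} (h : WordBound n B a) (hB : B ≤ B') :
    WordBound n B' a := fun p M hM hp => (h p M hM hp).trans (by gcongr)

theorem add {n : ℕ} {B B' : ℝ} {a b : FreeAlgebra K Bool} (ha : WordBound n B a)
    (hb : WordBound n B' b) : WordBound n (B + B') (a + b) := fun p M hM hp =>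
  (map_add_le_add p a b).trans (by rw [add_mul]; exact add_le_add (ha p M hM hp) (hb p M hM hp))

theorem sum {ι : Type*} {n : ℕ} (s : Finset ι) {B : ι → ℝ} {a : ι → FreeAlgebra K Bool}
    (h : ∀ i ∈ s, WordBound n (B i) (a i)) : WordBound n (∑ i ∈ s, B i) (∑ i ∈ s, a i) := by
  classical
  induction s using Finset.induction_on with
  | empty => simpa using zero n
  | insert i s hi ih =>
    rw [Finset.sum_insert hi, Finset.sum_insert hi]
    exact (h i (Finset.mem_insert_self i s)).add
      (ih fun j hj => h j (Finset.mem_insert_of_mem hj))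

theorem smul {n : ℕ} {B : ℝ} {a : FreeAlgebra K Bool} (c : K) (ha : WordBound n B a) :
    WordBound n (‖c‖ * B) (c • a) := fun p M hM hp => by
  rw [map_smul_eq_mul, mul_assoc]
  exact mul_le_mul_of_nonneg_left (ha p M hM hp) (norm_nonneg c)

theorem wordProd (w : List Bool) : WordBound w.length 1 (wordProd K w) := fun p M _ hp => by
  rw [one_mul]; exact hp w rfl

theorem mul {m n : ℕ} {B B' : ℝ} {a b : FreeAlgebra K Bool} (hB' : 0 ≤ B')
    (ha : WordBound m B a) (hb : WordBound n B' b) : WordBound (m + n) (B * B') (a * b) :=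
  fun p M hM hp => by
  have h := ha (p.comp (LinearMap.mulRight K b)) (B' * M) (by positivity) fun v hv => by
    have := hb (p.comp (LinearMap.mulLeft K (KashiwaraVergne.wordProd K v))) M hM fun w hw => by
      simp only [Seminorm.comp_apply, LinearMap.mulLeft_apply, ← wordProd_append]
      exact hp _ (by simp [hv, hw])
    simpa using this
  simpa [mul_assoc] using h

/-- The estimate which `WordBound` encodes, for linear maps into a normed space. -/
theorem norm_le {F : Type*} [SeminormedAddCommGroup F] [NormedSpace K F] {n : ℕ} {B : ℝ}
    {a : FreeAlgebra K Bool} (ha : WordBound n B a) (T : FreeAlgebra K Bool →ₗ[K] F) {M : ℝ}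
    (hM : 0 ≤ M) (hT : ∀ w : List Bool, w.length = n → ‖T (KashiwaraVergne.wordProd K w)‖ ≤ M) :
    ‖T a‖ ≤ B * M :=
  ha ((normSeminorm K F).comp T) M hM hT

end WordBound

theorem coeff_expLetter_mul (n : ℕ) :
    PowerSeries.coeff n (expLetter K true * expLetter K false) =
      ∑ p ∈ Finset.HasAntidiagonal.antidiagonal n, ((p.1 ! : K)⁻¹ * (p.2 ! : K)⁻¹) •
        (FreeAlgebra.ι K true ^ p.1 * FreeAlgebra.ι K false ^ p.2) := by
  simp [PowerSeries.coeff_mul, expLetter, smul_smul, mul_comm]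

theorem norm_inv_factorial_le_one (n : ℕ) : ‖((n ! : K)⁻¹)‖ ≤ 1 := by
  rw [norm_inv, RCLike.norm_natCast]
  exact inv_le_one_of_one_le₀ (by exact_mod_cast Nat.one_le_iff_ne_zero.2 n.factorial_ne_zero)

theorem wordBound_coeff_expLetter_mul_sub_one (n : ℕ) : WordBound n (if n = 0 then 0 else 2 ^ n)
    (PowerSeries.coeff n (expLetter K true * expLetter K false - 1)) := by
  rw [map_sub, coeff_expLetter_mul]
  rcases eq_or_ne n 0 with rfl | hn
  · simpa using WordBound.zero 0
  · rw [PowerSeries.coeff_one, if_neg hn, if_neg hn, sub_zero]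
    refine (WordBound.sum (B := fun _ => 1) _ fun p hp => ?_).mono ?_
    · have hp' := Finset.HasAntidiagonal.mem_antidiagonal.1 hp
      have h := WordBound.wordProd (K := K) (List.replicate p.1 true ++ List.replicate p.2 false)
      rw [wordProd_append, wordProd_replicate, wordProd_replicate, List.length_append,
        List.length_replicate, List.length_replicate, hp'] at h
      refine (h.smul _).mono ?_
      rw [mul_one, norm_mul]
      exact mul_le_one₀ (norm_inv_factorial_le_one _) (norm_nonneg _) (norm_inv_factorial_le_one _)
    · simp only [Finset.sum_const, Finset.Nat.card_antidiagonal, nsmul_eq_mul, mul_one]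
      exact_mod_cast Nat.lt_two_pow_self

theorem wordBound_coeff_pow (k n : ℕ) : WordBound n (8 ^ n)
    (PowerSeries.coeff n ((expLetter K true * expLetter K false - 1) ^ k)) := by
  induction k generalizing n with
  | zero =>
    rw [pow_zero, PowerSeries.coeff_one]
    split_ifs with h
    · subst h; simpa using WordBound.wordProd (K := K) []
    · exact (WordBound.zero n).mono (by positivity)
  | succ k ih =>
    rw [pow_succ', PowerSeries.coeff_mul]
    refine (WordBound.sum (B := fun p : ℕ × ℕ => (if p.1 = 0 then 0 else 2 ^ p.1) * 8 ^ p.2) _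
      fun p hp => ?_).mono ?_
    · rw [← Finset.HasAntidiagonal.mem_antidiagonal.1 hp]
      exact (wordBound_coeff_expLetter_mul_sub_one p.1).mul (by positivity) (ih p.2)
    · clear ih
      -- `∑_{i ≥ 1} 2^i 8^(n-i) ≤ (8^n - 2^n) / 3`
      have : ∀ n : ℕ, ∑ p ∈ Finset.HasAntidiagonal.antidiagonal n,
          (if p.1 = 0 then (0 : ℝ) else 2 ^ p.1) * 8 ^ p.2 = (8 ^ n - 2 ^ n) / 3 := by
        intro n
        induction n with
        | zero => simp
        | succ n ih =>
          rw [Finset.Nat.sum_antidiagonal_succ', Finset.sum_congr rfl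
            (g := fun p : ℕ × ℕ => 8 * ((if p.1 = 0 then (0 : ℝ) else 2 ^ p.1) * 8 ^ p.2))
            (fun p _ => by ring), ← Finset.mul_sum, ih]
          simp; ring
      rw [this]
      have h8 : (0 : ℝ) ≤ 8 ^ n := by positivity
      have h2 : (0 : ℝ) ≤ 2 ^ n := by positivity
      linarith

theorem wordBound_logExpExp (n : ℕ) : WordBound n (n * 8 ^ n) (logExpExp K n) := by
  refine (WordBound.sum (B := fun _ => 8 ^ n) _ fun k hk => ?_).mono (by simp)
  refine ((wordBound_coeff_pow k n).smul _).mono ?_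
  have hk1 : (1 : ℝ) ≤ k := by exact_mod_cast (Finset.mem_Icc.1 hk).1
  have : ‖(-1 : K) ^ (k + 1) / k‖ ≤ 1 := by
    rw [norm_div, norm_pow, norm_neg, norm_one, one_pow, RCLike.norm_natCast]
    exact div_le_one_of_le₀ hk1 (by positivity)
  exact mul_le_of_le_one_left (by positivity) this

variable {g : Type*} [LieRing g] [LieAlgebra K g]

/-- `rightNormed` as a linear map. -/
def rightNormedₗ (P Q : g) : FreeAlgebra K Bool →ₗ[K] g :=
  (LinearMap.snd K K g).comp ((LinearMap.applyₗ ((1 : K), (0 : g))).comp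
    (FreeAlgebra.lift K fun i : Bool => letterOp (K := K) (if i then P else Q)).toLinearMap)

theorem rightNormedₗ_apply (P Q : g) (w : FreeAlgebra K Bool) :
    rightNormedₗ P Q w = rightNormed P Q w := rfl

/-- The right-normed bracket of a word, with `P` for the letter `true` and `Q` for `false`. -/
def brWord (P Q : g) : List Bool → g
  | [] => 0
  | [i] => if i then P else Q
  | i :: j :: l => ⁅if i then P else Q, brWord P Q (j :: l)⁆

theorem rightNormed_wordProd (P Q : g) : ∀ w : List Bool,
    rightNormed (K := K) P Q (wordProd K w) = brWord P Q w
  | [] => by simp [rightNormed, brWord]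
  | [i] => by simp [rightNormed_ι, brWord]
  | i :: j :: l => by
    rw [wordProd_cons, wordProd_cons, rightNormed_ι_mul_ι_mul, ← wordProd_cons,
      rightNormed_wordProd P Q (j :: l), brWord]

theorem brWord_cons (P Q : g) (i : Bool) {w : List Bool} (hw : w ≠ []) :
    brWord P Q (i :: w) = ⁅if i then P else Q, brWord P Q w⁆ := by
  cases w with
  | nil => exact absurd rfl hw
  | cons j l => rfl

theorem logExpExp_one : logExpExp K 1 = FreeAlgebra.ι K true + FreeAlgebra.ι K false := by
  simp [logExpExp, PowerSeries.coeff_one, coeff_expLetter_mul, Finset.Nat.antidiagonal_succ,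
    add_comm]

theorem bchTerm_zero (P Q : g) : bchTerm K P Q 0 = 0 := by simp [bchTerm]

theorem bchTerm_one (P Q : g) : bchTerm K P Q 1 = P + Q := by
  rw [bchTerm, logExpExp_one, ← rightNormedₗ_apply, map_add]
  simp [rightNormedₗ_apply, rightNormed_ι]

/-- Two linear maps agree on the homogeneous part of degree `n` of the Campbell-Hausdorff series if
they agree on the words of length `n`. -/
theorem eq_on_logExpExp {F : Type*} [AddCommGroup F] [Module K F]
    (S T : FreeAlgebra K Bool →ₗ[K] F) (n : ℕ)
    (h : ∀ w : List Bool, w.length = n → S (wordProd K w) = T (wordProd K w)) :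
    S (logExpExp K n) = T (logExpExp K n) := by
  have key : ∀ (a : FreeAlgebra K Bool), WordBound n (n * 8 ^ n) a → S a = T a := by
    intro a ha
    rw [← sub_eq_zero, ← Module.forall_dual_apply_eq_zero_iff K]
    intro f
    have := ha.norm_le (f ∘ₗ (S - T)) le_rfl fun w hw => by simp [h w hw]
    simpa using this
  exact key _ (wordBound_logExpExp n)

/-! ### The part of degree one of the Campbell-Hausdorff series -/

/-- The coefficient of `E` as a linear functional. -/
def Aff.sndₗ : Aff K →ₗ[K] K where
  toFun x := x.2
  map_add' _ _ := rfl
  map_smul' _ _ := rfl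

variable (K) in
/-- The linear functional which sends a word to the coefficient of `E` in its right-normed bracket,
the letters `true`, `false` being evaluated at `E`, `D`.  On words of length `n ≥ 2` it is
the coefficient of `(ad Q)^{n-1} P` in the part of the right-normed bracket of degree one in `P`. -/
def kappa : FreeAlgebra K Bool →ₗ[K] K :=
  Aff.sndₗ ∘ₗ rightNormedₗ (Aff.E K) (Aff.D K)

variable (K) in
/-- The representation of the free algebra on `K × Aff` whose value at `(1, 0)` gives `kappa`. -/
def affRep : FreeAlgebra K Bool →ₐ[K] Module.End K (K × Aff K) :=
  FreeAlgebra.lift K fun i : Bool => letterOp (K := K) (if i then Aff.E K else Aff.D K)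

theorem kappa_apply (a : FreeAlgebra K Bool) : kappa K a = (affRep K a (1, 0)).2.2 := rfl

theorem affRep_true (u : K × Aff K) :
    affRep K (FreeAlgebra.ι K true) u = (0, Aff.mk 0 (u.1 - u.2.1)) := by
  refine Prod.ext ?_ (Aff.ext ?_ ?_) <;> simp [affRep, letterOp, sub_eq_add_neg]

theorem affRep_false (u : K × Aff K) :
    affRep K (FreeAlgebra.ι K false) u = (0, Aff.mk u.1 u.2.2) := by
  refine Prod.ext ?_ (Aff.ext ?_ ?_) <;> simp [affRep, letterOp]

theorem affRep_false_pow (n : ℕ) (u : K × Aff K) :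
    affRep K (FreeAlgebra.ι K false ^ (n + 1)) u =
      (0, Aff.mk (if n = 0 then u.1 else 0) u.2.2) := by
  induction n with
  | zero => simp [affRep_false]
  | succ n ih => rw [pow_succ', map_mul, Module.End.mul_apply, ih, affRep_false]; simp

theorem affRep_true_pow (n : ℕ) (u : K × Aff K) :
    affRep K (FreeAlgebra.ι K true ^ (n + 2)) u = 0 := by
  induction n with
  | zero =>
    rw [pow_two, map_mul, Module.End.mul_apply, affRep_true, affRep_true]
    refine Prod.ext ?_ (Aff.ext ?_ ?_) <;> simp
  | succ n ih => rw [pow_succ', map_mul, Module.End.mul_apply, ih, map_zero]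

/-- The operator `e^x e^y - 1` in the representation `affRep`, degree by degree. -/
theorem affRep_coeff (i : ℕ) (u : K × Aff K) :
    affRep K (PowerSeries.coeff i (expLetter K true * expLetter K false - 1)) u =
      (0, Aff.mk (PowerSeries.coeff i (PowerSeries.X : K⟦X⟧) * u.1)
        (PowerSeries.coeff i (PowerSeries.X - PowerSeries.X ^ 2 : K⟦X⟧) * u.1
          - PowerSeries.coeff i (PowerSeries.X : K⟦X⟧) * u.2.1
          + PowerSeries.coeff i (PowerSeries.exp K - 1) * u.2.2)) := by
  rw [map_sub, coeff_expLetter_mul]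
  match i with
  | 0 => refine Prod.ext ?_ (Aff.ext ?_ ?_) <;> simp
  | 1 =>
    rw [Finset.Nat.sum_antidiagonal_succ]
    refine Prod.ext ?_ (Aff.ext ?_ ?_) <;>
      simp [PowerSeries.coeff_one, affRep_true, affRep_false, PowerSeries.coeff_exp,
        PowerSeries.coeff_X_pow]
    ring
  | k + 2 =>
    rw [Finset.Nat.sum_antidiagonal_succ, Finset.Nat.sum_antidiagonal_succ]
    have h0 : ∀ p : ℕ × ℕ, affRep K (FreeAlgebra.ι K true ^ (p.1 + 1 + 1) *
        FreeAlgebra.ι K false ^ p.2) u = 0 := fun p => by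
      rw [map_mul, Module.End.mul_apply, affRep_true_pow]
    have hX : PowerSeries.coeff (k + 2) (PowerSeries.X : K⟦X⟧) = 0 := by
      rw [PowerSeries.coeff_X, if_neg (by omega)]
    have h1 : affRep K (∑ p ∈ Finset.HasAntidiagonal.antidiagonal k,
        (((p.1 + 1 + 1)! : K)⁻¹ * (p.2 ! : K)⁻¹) •
          (FreeAlgebra.ι K true ^ (p.1 + 1 + 1) * FreeAlgebra.ι K false ^ p.2)) u = 0 := by
      rw [map_sum, LinearMap.sum_apply]
      exact Finset.sum_eq_zero fun p _ => by rw [map_smul, LinearMap.smul_apply, h0, smul_zero]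
    rw [map_sub, LinearMap.sub_apply, map_add, map_add, LinearMap.add_apply, LinearMap.add_apply,
      h1, PowerSeries.coeff_one, if_neg (by omega)]
    simp only [map_smul, LinearMap.smul_apply, zero_add, pow_zero, one_mul, pow_one, map_mul,
      Module.End.mul_apply, affRep_true]
    have h3 : affRep K (FreeAlgebra.ι K false ^ (k + 1)) u =
        (0, Aff.mk (if k = 0 then u.1 else 0) u.2.2) := affRep_false_pow k u
    rw [h3, affRep_false_pow (k + 1) u, hX, map_sub, hX, PowerSeries.coeff_X_pow]
    rcases Nat.eq_zero_or_pos k with rfl | hk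
    · refine Prod.ext ?_ (Aff.ext ?_ ?_) <;> simp [PowerSeries.coeff_exp]
      ring
    · have hk' : k ≠ 0 := hk.ne'
      refine Prod.ext ?_ (Aff.ext ?_ ?_) <;> simp [PowerSeries.coeff_exp, hk']

/-- The generating series of the coefficient of `D` in `(e^x e^y - 1)^k (1, 0)`. -/
def affRepD (k : ℕ) : K⟦X⟧ := PowerSeries.mk fun n =>
  (affRep K (PowerSeries.coeff n ((expLetter K true * expLetter K false - 1) ^ k)) (1, 0)).2.1

/-- The generating series of the coefficient of `E` in `(e^x e^y - 1)^k (1, 0)`. -/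
def affRepE (k : ℕ) : K⟦X⟧ := PowerSeries.mk fun n =>
  (affRep K (PowerSeries.coeff n ((expLetter K true * expLetter K false - 1) ^ k)) (1, 0)).2.2

theorem affRep_coeff_pow_succ (n k : ℕ) (v : K × Aff K) :
    affRep K (PowerSeries.coeff n ((expLetter K true * expLetter K false - 1) ^ (k + 1))) v =
      ∑ p ∈ Finset.HasAntidiagonal.antidiagonal n,
        affRep K (PowerSeries.coeff p.1 (expLetter K true * expLetter K false - 1))
          (affRep K
            (PowerSeries.coeff p.2 ((expLetter K true * expLetter K false - 1) ^ k)) v) := by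
  rw [pow_succ', PowerSeries.coeff_mul, map_sum, LinearMap.sum_apply]
  simp [map_mul]

theorem Aff.sum_fst {ι : Type*} (s : Finset ι) (f : ι → Aff K) :
    (∑ i ∈ s, f i).1 = ∑ i ∈ s, (f i).1 :=
  map_sum (⟨⟨fun x => x.1, rfl⟩, fun _ _ => rfl⟩ : Aff K →+ K) f s

theorem Aff.sum_snd {ι : Type*} (s : Finset ι) (f : ι → Aff K) :
    (∑ i ∈ s, f i).2 = ∑ i ∈ s, (f i).2 :=
  map_sum (⟨⟨fun x => x.2, rfl⟩, fun _ _ => rfl⟩ : Aff K →+ K) f s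

theorem affRep_coeff_pow_fst (n k : ℕ) :
    (affRep K (PowerSeries.coeff n ((expLetter K true * expLetter K false - 1) ^ (k + 1)))
      (1, 0)).1 = 0 := by
  rw [affRep_coeff_pow_succ, Prod.fst_sum]
  exact Finset.sum_eq_zero fun p _ => by rw [affRep_coeff]

theorem affRepE_one : affRepE (K := K) 1 = PowerSeries.X - PowerSeries.X ^ 2 := by
  ext n
  rw [affRepE, PowerSeries.coeff_mk, pow_one, affRep_coeff]
  simp

theorem affRepD_one : affRepD (K := K) 1 = PowerSeries.X := by
  ext n
  rw [affRepD, PowerSeries.coeff_mk, pow_one, affRep_coeff]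
  simp

theorem affRepD_add_two (k : ℕ) : affRepD (K := K) (k + 2) = 0 := by
  ext n
  rw [affRepD, PowerSeries.coeff_mk, affRep_coeff_pow_succ, Prod.snd_sum, Aff.sum_fst]
  exact Finset.sum_eq_zero fun p _ => by rw [affRep_coeff, affRep_coeff_pow_fst]; simp

theorem affRepE_add_two (k : ℕ) : affRepE (K := K) (k + 2) =
    (PowerSeries.exp K - 1) * affRepE (k + 1) - PowerSeries.X * affRepD (k + 1) := by
  ext n
  rw [affRepE, PowerSeries.coeff_mk, affRep_coeff_pow_succ, Prod.snd_sum, Aff.sum_snd, map_sub,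
    PowerSeries.coeff_mul, PowerSeries.coeff_mul, ← Finset.sum_sub_distrib]
  refine Finset.sum_congr rfl fun p _ => ?_
  rw [affRep_coeff, affRep_coeff_pow_fst]
  simp only [affRepE, affRepD, PowerSeries.coeff_mk, Aff.mk_snd]
  ring

/-- The recursion for `affRepE` solved: `(e^t - 1)^(k+1)` times a fixed series, with a correction
for `k = 0`. -/
theorem affRepE_succ (k : ℕ) : affRepE (K := K) (k + 1) =
    (phi1 K * (1 - PowerSeries.X) - phi1 K ^ 2) * (PowerSeries.exp K - 1) ^ (k + 1)
      + if k = 0 then PowerSeries.X * phi1 K else 0 := by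
  have h := phi1_mul_exp_sub_one K
  induction k with
  | zero =>
    rw [affRepE_one]; simp only [if_true, zero_add, pow_one]
    linear_combination (-1 + PowerSeries.X + phi1 K) * h
  | succ k ih =>
    rw [affRepE_add_two, ih, if_neg k.succ_ne_zero]
    rcases Nat.eq_zero_or_pos k with rfl | hk
    · simp only [if_true, zero_add, affRepD_one]
      linear_combination PowerSeries.X * h
    · obtain ⟨j, rfl⟩ := Nat.exists_eq_succ_of_ne_zero hk.ne'
      rw [if_neg j.succ_ne_zero, affRepD_add_two]; ring

/-- The partial sums of `log (1 + h) = ∑_{k ≥ 1} (-1)^(k+1) h^k / k` at `h = e^t - 1`. -/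
def logExpPartial (N : ℕ) : K⟦X⟧ := ∑ k ∈ Finset.range N,
  PowerSeries.C ((-1 : K) ^ (k + 2) / (k + 1 : ℕ)) * (PowerSeries.exp K - 1) ^ (k + 1)

theorem derivative_logExpPartial (N : ℕ) :
    PowerSeries.derivative K (logExpPartial N) = 1 - (1 - PowerSeries.exp K) ^ N := by
  induction N with
  | zero => simp [logExpPartial]
  | succ N ih =>
    rw [logExpPartial, Finset.sum_range_succ, ← logExpPartial, map_add, ih, Derivation.leibniz,
      PowerSeries.derivative_C, PowerSeries.derivative_pow, map_sub, PowerSeries.derivative_exp,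
      Derivation.map_one_eq_zero]
    have hC : (PowerSeries.C ((-1 : K) ^ (N + 2) / (N + 1 : ℕ)) : K⟦X⟧) * ((N + 1 : ℕ) : K⟦X⟧) =
        (-1) ^ N := by
      rw [← map_natCast (PowerSeries.C (R := K)), ← map_mul,
        div_mul_cancel₀ _ (Nat.cast_ne_zero.2 N.succ_ne_zero)]
      simp [pow_add]
    have h1 : (1 - PowerSeries.exp K) ^ N = (-1) ^ N * (PowerSeries.exp K - 1) ^ N := by
      rw [← mul_pow]; congr 1; ring
    generalize (PowerSeries.C ((-1 : K) ^ (N + 2) / (N + 1 : ℕ)) : K⟦X⟧) = c at *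
    simp only [smul_eq_mul, sub_zero, mul_zero, add_zero, Nat.add_sub_cancel]
    rw [pow_succ, h1]
    linear_combination ((PowerSeries.exp K - 1) ^ N * PowerSeries.exp K) * hC

/-- The partial sums of the logarithm at `e^t - 1` converge to `t` in the adic topology. -/
theorem X_pow_dvd_logExpPartial_sub (N : ℕ) :
    (PowerSeries.X : K⟦X⟧) ^ (N + 1) ∣ logExpPartial N - PowerSeries.X := by
  rw [PowerSeries.X_pow_dvd_iff]
  intro m hm
  cases m with
  | zero =>
    simp [logExpPartial]
  | succ m =>
    have hd : (PowerSeries.X : K⟦X⟧) ^ N ∣ (1 - PowerSeries.exp K) ^ N := by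
      refine pow_dvd_pow_of_dvd ?_ N
      rw [PowerSeries.X_dvd_iff]; simp
    have h := congrArg (PowerSeries.coeff m) (derivative_logExpPartial (K := K) N)
    have h0 := PowerSeries.X_pow_dvd_iff.1 hd m (by omega)
    rw [PowerSeries.coeff_derivative, map_sub, h0, sub_zero, PowerSeries.coeff_one] at h
    have hm1 : ((m : K) + 1) ≠ 0 := by exact_mod_cast m.succ_ne_zero
    rw [map_sub, PowerSeries.coeff_X, sub_eq_zero]
    refine mul_right_cancel₀ hm1 (h.trans ?_)
    rcases eq_or_ne m 0 with rfl | hm0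
    · simp
    · simp [hm0]

/-- The part of degree one in `P` of the Campbell-Hausdorff series of `(P, Q)` is `φ₁(ad Q) P`. -/
theorem kappa_logExpExp (n : ℕ) :
    kappa K (logExpExp K (n + 1)) = (n + 1 : ℕ) * PowerSeries.coeff n (phi1 K) := by
  have h1 : kappa K (logExpExp K (n + 1)) = PowerSeries.coeff (n + 1)
      (∑ k ∈ Finset.range (n + 1),
        PowerSeries.C ((-1 : K) ^ (k + 2) / (k + 1 : ℕ)) * affRepE (k + 1)) := by
    rw [logExpExp, map_sum, map_sum, Finset.range_eq_Ico, Finset.sum_Ico_add'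
      (fun k : ℕ => PowerSeries.coeff (n + 1)
        (PowerSeries.C ((-1 : K) ^ (k + 1) / (k : ℕ)) * affRepE k)) 0 (n + 1) 1, zero_add,
      Finset.Ico_add_one_right_eq_Icc]
    refine Finset.sum_congr rfl fun k _ => ?_
    rw [map_smul, PowerSeries.coeff_C_mul, affRepE, PowerSeries.coeff_mk, kappa_apply, smul_eq_mul]
  have h2 : (∑ k ∈ Finset.range (n + 1),
        PowerSeries.C ((-1 : K) ^ (k + 2) / (k + 1 : ℕ)) * affRepE (k + 1)) =
      (phi1 K * (1 - PowerSeries.X) - phi1 K ^ 2) * logExpPartial (n + 1)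
        + PowerSeries.X * phi1 K := by
    simp only [affRepE_succ, mul_add, Finset.sum_add_distrib, logExpPartial, Finset.mul_sum]
    congr 1
    · exact Finset.sum_congr rfl fun k _ => by ring
    · rw [Finset.sum_eq_single 0 (fun k _ hk => by rw [if_neg hk, mul_zero]) (by simp)]
      simp
  -- up to terms of order `n + 2`, the partial sum of the logarithm may be replaced by `t`, and the
  -- differential equation of `φ₁` identifies the result
  obtain ⟨r, hr⟩ := X_pow_dvd_logExpPartial_sub (K := K) (n + 1)
  have h3 : (phi1 K * (1 - PowerSeries.X) - phi1 K ^ 2) * logExpPartial (n + 1)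
        + PowerSeries.X * phi1 K =
      PowerSeries.X * (PowerSeries.X * PowerSeries.derivative K (phi1 K) + phi1 K) +
        PowerSeries.X ^ (n + 2) * (r * (phi1 K * (1 - PowerSeries.X) - phi1 K ^ 2)) := by
    linear_combination (phi1 K * (1 - PowerSeries.X) - phi1 K ^ 2) * hr
      - PowerSeries.X * X_mul_derivative_phi1 (K := K)
  rw [h1, h2, h3, map_add, PowerSeries.coeff_succ_X_mul, map_add, PowerSeries.coeff_X_pow_mul',
    if_neg (by omega), add_zero]
  cases n with
  | zero => simp
  | succ n => rw [PowerSeries.coeff_succ_X_mul, PowerSeries.coeff_derivative]; push_cast; ring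

end Words

/-! ### Power series with geometrically bounded coefficients -/
section GeomBound
variable {K : Type} [RCLike K]
open PowerSeries

/-- The coefficients of `f` grow at most geometrically, i.e. `f` has a positive radius of
convergence. -/
def HasGeomBound (f : K⟦X⟧) : Prop := ∃ r : ℝ, ∀ n, ‖coeff n f‖ ≤ r ^ (n + 1)

namespace HasGeomBound

theorem exists_one_le {f : K⟦X⟧} (hf : HasGeomBound f) (s : ℝ) :
    ∃ r : ℝ, 1 ≤ r ∧ s ≤ r ∧ ∀ n, ‖coeff n f‖ ≤ r ^ (n + 1) := by
  obtain ⟨r, hr⟩ := hf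
  have h0 : 0 ≤ r := by simpa using (norm_nonneg _).trans (hr 0)
  exact ⟨max r (max 1 s), by simp, by simp, fun n => (hr n).trans (by gcongr; simp)⟩

theorem of_norm_le_one {f : K⟦X⟧} (h : ∀ n, ‖coeff n f‖ ≤ 1) : HasGeomBound f :=
  ⟨1, fun n => by simpa using h n⟩

theorem of_norm_le {f h : K⟦X⟧} (hf : HasGeomBound f) (hh : ∀ n, ‖coeff n h‖ ≤ ‖coeff n f‖) :
    HasGeomBound h := let ⟨r, hr⟩ := hf; ⟨r, fun n => (hh n).trans (hr n)⟩

theorem add {f h : K⟦X⟧} (hf : HasGeomBound f) (hh : HasGeomBound h) : HasGeomBound (f + h) := by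
  obtain ⟨r, hr1, -, hr⟩ := hf.exists_one_le 0
  obtain ⟨s, hs1, hrs, hs⟩ := hh.exists_one_le r
  refine ⟨2 * s, fun n => ?_⟩
  have h1 : r ^ (n + 1) ≤ s ^ (n + 1) := by gcongr
  have h2 : (1 : ℝ) ≤ 2 ^ n := one_le_pow₀ (by norm_num)
  calc ‖coeff n (f + h)‖ ≤ s ^ (n + 1) + s ^ (n + 1) := by
        rw [map_add]; exact norm_add_le_of_le ((hr n).trans h1) (hs n)
    _ = 2 * 1 * s ^ (n + 1) := by ring
    _ ≤ 2 * 2 ^ n * s ^ (n + 1) := by gcongr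
    _ = (2 * s) ^ (n + 1) := by rw [mul_pow, pow_succ' 2]

theorem neg' {f : K⟦X⟧} (hf : HasGeomBound f) : HasGeomBound (neg f) :=
  hf.of_norm_le fun n => by simp [coeff_neg']

theorem sub {f h : K⟦X⟧} (hf : HasGeomBound f) (hh : HasGeomBound h) : HasGeomBound (f - h) := by
  rw [sub_eq_add_neg]
  exact hf.add (hh.of_norm_le fun n => by simp)

theorem mul {f h : K⟦X⟧} (hf : HasGeomBound f) (hh : HasGeomBound h) : HasGeomBound (f * h) := by
  obtain ⟨r, hr1, -, hr⟩ := hf.exists_one_le 0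
  obtain ⟨s, hs1, hrs, hs⟩ := hh.exists_one_le r
  refine ⟨2 * s ^ 2, fun n => ?_⟩
  have h2 : ((n + 1 : ℕ) : ℝ) ≤ 2 ^ (n + 1) := by exact_mod_cast Nat.lt_two_pow_self.le
  rw [coeff_mul]
  calc ‖∑ p ∈ Finset.HasAntidiagonal.antidiagonal n, coeff p.1 f * coeff p.2 h‖
      ≤ ∑ p ∈ Finset.HasAntidiagonal.antidiagonal n, s ^ (n + 2) := by
        refine norm_sum_le_of_le _ fun p hp => ?_
        have hp' := Finset.HasAntidiagonal.mem_antidiagonal.1 hp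
        have h1 : r ^ (p.1 + 1) ≤ s ^ (p.1 + 1) := by gcongr
        rw [norm_mul, show n + 2 = (p.1 + 1) + (p.2 + 1) by omega, pow_add]
        exact mul_le_mul ((hr _).trans h1) (hs _) (norm_nonneg _) (by positivity)
    _ = (n + 1 : ℕ) * s ^ (n + 2) := by simp
    _ ≤ 2 ^ (n + 1) * s ^ (2 * (n + 1)) := by
        exact mul_le_mul h2 (pow_le_pow_right₀ hs1 (by omega)) (by positivity) (by positivity)
    _ = (2 * s ^ 2) ^ (n + 1) := by rw [mul_pow, pow_mul]

theorem derivative {f : K⟦X⟧} (hf : HasGeomBound f) : HasGeomBound (d⁄dX K f) := by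
  obtain ⟨r, hr1, -, hr⟩ := hf.exists_one_le 0
  refine ⟨2 * r ^ 2, fun n => ?_⟩
  have h2 : ((n + 1 : ℕ) : ℝ) ≤ 2 ^ (n + 1) := by exact_mod_cast Nat.lt_two_pow_self.le
  have h3 : ‖((n : K) + 1)‖ = ((n + 1 : ℕ) : ℝ) := by
    rw [← Nat.cast_succ, RCLike.norm_natCast]
  rw [coeff_derivative, norm_mul, h3, mul_comm, mul_pow, ← pow_mul]
  refine mul_le_mul h2 ((hr _).trans ?_) (norm_nonneg _) (by positivity)
  exact pow_le_pow_right₀ hr1 (by omega)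

theorem divT {f : K⟦X⟧} (hf : HasGeomBound f) : HasGeomBound (divT f) := by
  obtain ⟨r, hr1, -, hr⟩ := hf.exists_one_le 0
  refine ⟨r ^ 2, fun n => ?_⟩
  rw [KashiwaraVergne.divT, coeff_mk, ← pow_mul]
  exact (hr _).trans (pow_le_pow_right₀ hr1 (by omega))

theorem C (a : K) : HasGeomBound (C a) := by
  refine ⟨max 1 ‖a‖, fun n => ?_⟩
  rw [coeff_C]
  split_ifs with h
  · simp [h]
  · rw [norm_zero]; positivity

theorem X : HasGeomBound (X : K⟦X⟧) := of_norm_le_one fun n => by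
  rw [coeff_X]; split_ifs <;> simp

theorem exp : HasGeomBound (exp K) := of_norm_le_one fun n => by
  have := norm_inv_factorial_le_one (K := K) n
  simpa [coeff_exp] using this

end HasGeomBound

theorem two_pow_le_factorial_succ (m : ℕ) : 2 ^ m ≤ (m + 1)! := by
  induction m with
  | zero => simp
  | succ m ih =>
    rw [pow_succ', Nat.factorial_succ]
    exact Nat.mul_le_mul (by omega) ih

theorem norm_coeff_phi1_le_one (n : ℕ) : ‖coeff n (phi1 K)‖ ≤ 1 := by
  induction n using Nat.strong_induction_on with
  | _ n ih =>
    cases n with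
    | zero => rw [coeff_phi1_zero, norm_one]
    | succ n =>
      rw [coeff_phi1_succ, norm_neg]
      refine (norm_sum_le_of_le (n := fun i => (1 / 2 : ℝ) ^ (n + 1 - i)) _ fun i hi => ?_).trans ?_
      · have hi' := Finset.mem_range.1 hi
        rw [norm_div, RCLike.norm_natCast, div_pow, one_pow]
        have h1 : (2 : ℝ) ^ (n + 1 - i) ≤ ((n + 2 - i)! : ℕ) := by
          have := two_pow_le_factorial_succ (n + 1 - i)
          rw [show n + 1 - i + 1 = n + 2 - i by omega] at this
          exact_mod_cast this
        exact div_le_div₀ zero_le_one (ih i (by omega)) (by positivity) h1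
      · rw [← Finset.sum_range_reflect]
        have : ∀ m : ℕ, ∑ j ∈ Finset.range m, (1 / 2 : ℝ) ^ (j + 1) = 1 - (1 / 2) ^ m := by
          intro m
          induction m with
          | zero => simp
          | succ m ih => rw [Finset.sum_range_succ, ih]; ring
        rw [Finset.sum_congr rfl (g := fun j => (1 / 2 : ℝ) ^ (j + 1)), this]
        · have : (0 : ℝ) ≤ (1 / 2) ^ (n + 1) := by positivity
          linarith
        · intro j hj
          have := Finset.mem_range.1 hj
          congr 1; omega

theorem HasGeomBound.phi1 : HasGeomBound (phi1 K) := .of_norm_le_one norm_coeff_phi1_le_one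
theorem HasGeomBound.expQuot : HasGeomBound (expQuot K) := HasGeomBound.exp.divT
theorem HasGeomBound.R : HasGeomBound (R K) :=
  (((HasGeomBound.exp.sub HasGeomBound.exp.neg').sub ((HasGeomBound.C _).mul .X)).divT).divT
theorem HasGeomBound.one : HasGeomBound (1 : K⟦X⟧) := by
  rw [← map_one (PowerSeries.C (R := K))]; exact .C 1
theorem HasGeomBound.psi : HasGeomBound (psi K) :=
  (HasGeomBound.C _).mul (HasGeomBound.phi1.sub .one)
theorem HasGeomBound.gammaVRhs : HasGeomBound (gammaVRhs K) :=
  ((HasGeomBound.C _).mul .X).sub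
    (((((HasGeomBound.C _).mul .X).mul HasGeomBound.phi1.neg').mul .R).mul
      HasGeomBound.phi1.derivative)
theorem norm_natCast_add_two (n : ℕ) : ‖(n : K) + 2‖ = n + 2 := by
  have : ((n : K) + 2) = ((n + 2 : ℕ) : K) := by push_cast; ring
  rw [this, RCLike.norm_natCast]; push_cast; ring

/-- Dividing the coefficient of `tⁿ` by `n + 2` preserves convergence. -/
theorem HasGeomBound.div_add_two {f : K⟦X⟧} (hf : HasGeomBound f) :
    HasGeomBound (PowerSeries.mk fun n => coeff n f / ((n : K) + 2)) :=
  hf.of_norm_le fun n => by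
    rw [coeff_mk, norm_div, norm_natCast_add_two]
    exact div_le_self (norm_nonneg _) (by linarith [n.cast_nonneg (α := ℝ)])

theorem HasGeomBound.gammaV : HasGeomBound (gammaV K) := HasGeomBound.gammaVRhs.div_add_two

end GeomBound

/-! ### Normed Lie algebras and power series of `ad` -/
section NormedLie

/-- A Lie ring with a norm such that `‖[x, y]‖ ≤ ‖x‖ ‖y‖`. -/
class NormedLieRing (g : Type*) extends NormedAddCommGroup g, LieRing g where
  norm_lie_le' : ∀ x y : g, ‖⁅x, y⁆‖ ≤ ‖x‖ * ‖y‖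

/-- A Lie algebra over `K` with a norm such that `‖[x, y]‖ ≤ ‖x‖ ‖y‖`. -/
class NormedLieAlgebra (K : Type) (g : Type*) [RCLike K] [NormedLieRing g] extends
  NormedSpace K g, LieAlgebra K g

variable {K : Type} [RCLike K] {g : Type*} [NormedLieRing g] [NormedLieAlgebra K g]

theorem norm_lie_le (x y : g) : ‖⁅x, y⁆‖ ≤ ‖x‖ * ‖y‖ := NormedLieRing.norm_lie_le' x y

variable [FiniteDimensional K g]

variable (K) in
/-- `ad X` as a continuous linear map. -/
def adC (X : g) : g →L[K] g :=
  LinearMap.toContinuousLinearMap (LieAlgebra.ad K g X : g →ₗ[K] g)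

@[simp] theorem adC_apply (X Y : g) : adC K X Y = ⁅X, Y⁆ := rfl

theorem norm_adC_le (X : g) : ‖adC K X‖ ≤ ‖X‖ :=
  ContinuousLinearMap.opNorm_le_bound _ (norm_nonneg _) fun Y => norm_lie_le X Y

variable (K g) in
/-- The map `X ↦ ad X` as a continuous linear map. -/
def adL : g →L[K] (g →L[K] g) := LinearMap.toContinuousLinearMap
  { toFun := adC K
    map_add' := fun X Y => by ext; simp
    map_smul' := fun c X => by ext; simp }

@[simp] theorem adL_apply (X : g) : adL K g X = adC K X := rfl

theorem adSeries_eq_tsum (f : K⟦X⟧) (X : g) :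
    adSeries f X = ∑' n, PowerSeries.coeff n f • adC K X ^ n := rfl

/-- The power series `f` as a power series in the Banach algebra of operators. -/
theorem hasFPowerSeriesAt_opSeries {f : K⟦X⟧} (hf : HasGeomBound f) :
    HasFPowerSeriesAt (fun T : g →L[K] g => ∑' n, PowerSeries.coeff n f • T ^ n)
      (FormalMultilinearSeries.ofScalars (g →L[K] g) fun n => PowerSeries.coeff n f) 0 := by
  have : CompleteSpace g := FiniteDimensional.complete K g
  obtain ⟨r, hr1, -, hr⟩ := hf.exists_one_le 0
  set p := FormalMultilinearSeries.ofScalars (g →L[K] g) fun n => PowerSeries.coeff n f with hp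
  have hr0 : 0 < r := by linarith
  have hrad : ((NNReal.mk r⁻¹ (by positivity) : NNReal) : ENNReal) ≤ p.radius := by
    refine p.le_radius_of_bound (‖p 0‖ + r) fun n => ?_
    rcases Nat.eq_zero_or_pos n with rfl | hn
    · simp; linarith
    · have h1 : ‖p n‖ ≤ r ^ (n + 1) :=
        (FormalMultilinearSeries.ofScalars_norm_le (𝕜 := K) _ _ n hn).trans (hr n)
      calc ‖p n‖ * (r⁻¹) ^ n ≤ r ^ (n + 1) * r⁻¹ ^ n := by gcongr
        _ = r := by rw [pow_succ', mul_assoc, ← mul_pow, mul_inv_cancel₀ hr0.ne', one_pow, mul_one]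
        _ ≤ ‖p 0‖ + r := by linarith [norm_nonneg (p 0)]
  have hpos : 0 < p.radius := lt_of_lt_of_le
    (ENNReal.coe_pos.2 (show NNReal.mk 0 le_rfl < NNReal.mk r⁻¹ _ from inv_pos.2 hr0)) hrad
  have := (p.hasFPowerSeriesOnBall hpos).hasFPowerSeriesAt
  refine this.congr (Filter.Eventually.of_forall fun T => ?_)
  exact FormalMultilinearSeries.ofScalars_sum_eq (𝕜 := K) _ T

theorem analyticAt_adSeries {f : K⟦X⟧} (hf : HasGeomBound f) :
    AnalyticAt K (fun X : g => adSeries f X) 0 := by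
  have h : AnalyticAt K (fun T : g →L[K] g => ∑' n, PowerSeries.coeff n f • T ^ n) (adL K g 0) := by
    rw [map_zero]; exact (hasFPowerSeriesAt_opSeries hf).analyticAt
  exact h.comp ((adL K g).analyticAt 0)

theorem eventually_summable_norm_adSeries {f : K⟦X⟧} (hf : HasGeomBound f) :
    ∀ᶠ X in 𝓝 (0 : g), Summable fun n => ‖PowerSeries.coeff n f • adC K X ^ n‖ := by
  obtain ⟨r, hr1, -, hr⟩ := hf.exists_one_le 0
  have hr0 : 0 < r := by linarith
  filter_upwards [Metric.ball_mem_nhds (0 : g) (inv_pos.2 hr0)] with X hX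
  rw [mem_ball_zero_iff] at hX
  have hlt : r * ‖X‖ < 1 := by
    calc r * ‖X‖ < r * r⁻¹ := by gcongr
      _ = 1 := mul_inv_cancel₀ hr0.ne'
  rw [← summable_nat_add_iff 1]
  refine .of_nonneg_of_le (fun _ => norm_nonneg _) (fun n => ?_)
    (((summable_geometric_of_lt_one (by positivity) hlt).comp_injective
      (add_left_injective 1)).mul_left r)
  rw [norm_smul]
  calc _ ≤ r ^ (n + 1 + 1) * ‖X‖ ^ (n + 1) := by
        gcongr
        · exact hr _
        · exact (norm_pow_le' _ n.succ_pos).trans (by gcongr; exact norm_adC_le X)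
    _ = r * (r * ‖X‖) ^ (n + 1) := by rw [mul_pow, pow_succ']; ring

theorem hasSum_adSeries_apply {f : K⟦X⟧} {X : g}
    (h : Summable fun n => PowerSeries.coeff n f • adC K X ^ n) (v : g) :
    HasSum (fun n => PowerSeries.coeff n f • (adC K X ^ n) v) (adSeries f X v) :=
  h.hasSum.mapL (ContinuousLinearMap.apply K g v)

theorem eventually_adSeries_mul {f h : K⟦X⟧} (hf : HasGeomBound f) (hh : HasGeomBound h) :
    ∀ᶠ X in 𝓝 (0 : g), adSeries (f * h) X = adSeries f X * adSeries h X := by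
  have : CompleteSpace g := FiniteDimensional.complete K g
  filter_upwards [eventually_summable_norm_adSeries hf, eventually_summable_norm_adSeries hh]
    with X h1 h2
  rw [adSeries_eq_tsum, adSeries_eq_tsum, adSeries_eq_tsum,
    tsum_mul_tsum_eq_tsum_sum_antidiagonal_of_summable_norm h1 h2]
  refine tsum_congr fun n => ?_
  rw [PowerSeries.coeff_mul, Finset.sum_smul]
  refine Finset.sum_congr rfl fun p hp => ?_
  rw [smul_mul_smul_comm, ← pow_add, Finset.HasAntidiagonal.mem_antidiagonal.1 hp]

theorem eventually_adSeries_self {f : K⟦X⟧} (hf : HasGeomBound f) :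
    ∀ᶠ X in 𝓝 (0 : g), adSeries f X X = PowerSeries.coeff 0 f • X := by
  have : CompleteSpace g := FiniteDimensional.complete K g
  filter_upwards [eventually_summable_norm_adSeries hf] with X h
  refine (hasSum_adSeries_apply h.of_norm X).unique ?_
  have h0 := hasSum_single (f := fun n => PowerSeries.coeff n f • (adC K X ^ n) X) 0 fun n hn => by
    obtain ⟨m, rfl⟩ := Nat.exists_eq_succ_of_ne_zero hn
    rw [pow_succ, mul_apply_eq_comp, adC_apply, lie_self, map_zero, smul_zero]
  exact h0

theorem hasStrictFDerivAt_adSeries {f : K⟦X⟧} (hf : HasGeomBound f) :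
    HasStrictFDerivAt (fun X : g => adSeries f X) (fderiv K (fun X : g => adSeries f X) 0) 0 :=
  (analyticAt_adSeries (g := g) hf).hasStrictFDerivAt

theorem isBigO_nhds_adSeries_sub {f : K⟦X⟧} (hf : HasGeomBound f) :
    (fun p : g × g => adSeries f p.1 - adSeries f p.2) =O[𝓝 ((0 : g), (0 : g))]
      fun p => p.1 - p.2 := by
  have h := (hasStrictFDerivAt_adSeries (g := g) hf).isBigO_sub
  exact h

/-- `f(ad X)` depends on `X` in a Lipschitz way, near `0`. -/
theorem isBigO_adSeries_sub {f : K⟦X⟧} (hf : HasGeomBound f) {α : Type*} {l : Filter α}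
    {u v : α → g} (hu : Filter.Tendsto u l (𝓝 0)) (hv : Filter.Tendsto v l (𝓝 0)) :
    (fun a => adSeries f (u a) - adSeries f (v a)) =O[l] fun a => u a - v a := by
  have hk : Filter.Tendsto (fun a => (u a, v a)) l (𝓝 ((0 : g), (0 : g))) := hu.prodMk_nhds hv
  have h := (isBigO_nhds_adSeries_sub hf).comp_tendsto hk
  simpa only [Function.comp_def] using h

theorem isBigO_adSeries_one {f : K⟦X⟧} (hf : HasGeomBound f) {α : Type*} {l : Filter α}
    {u : α → g} (hu : Filter.Tendsto u l (𝓝 0)) :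
    (fun a => adSeries f (u a)) =O[l] fun _ => (1 : ℝ) :=
  ((analyticAt_adSeries (g := g) hf).continuousAt.tendsto.comp hu).isBigO_one ℝ

/-- The Taylor expansion of `f(ad X)` to first order. -/
theorem isBigO_adSeries_sub_linear {f : K⟦X⟧} (hf : HasGeomBound f) {α : Type*} {l : Filter α}
    {u : α → g} (hu : Filter.Tendsto u l (𝓝 0)) :
    (fun a => adSeries f (u a) -
      (PowerSeries.coeff 0 f • (1 : g →L[K] g) + PowerSeries.coeff 1 f • adC K (u a)))
      =O[l] fun a => ‖u a‖ ^ 2 := by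
  have h := (hasFPowerSeriesAt_opSeries (g := g) hf).isBigO_sub_partialSum_pow 2
  have h2 : Filter.Tendsto (fun a => adC K (u a)) l (𝓝 0) := by
    have := ((adL K g).continuous.tendsto 0).comp hu
    rwa [map_zero] at this
  refine ((h.comp_tendsto h2).trans ?_).congr_left fun a => ?_
  · refine Asymptotics.IsBigO.of_bound 1 (Filter.Eventually.of_forall fun a => ?_)
    simp only [Function.comp, norm_pow, norm_norm, one_mul]
    gcongr
    exact norm_adC_le _
  · simp [Function.comp, FormalMultilinearSeries.partialSum, Finset.sum_range_succ,
      FormalMultilinearSeries.ofScalars_apply_eq, adSeries_eq_tsum]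

/-- The invariant form makes `ad X` antisymmetric, so the adjoint of `f(ad X)` is `f(-ad X)`. -/
theorem eventually_form_adSeries (Q : QuadraticStructure K g) {f : K⟦X⟧} (hf : HasGeomBound f) :
    ∀ᶠ X in 𝓝 (0 : g), ∀ u v : g,
      Q.form (adSeries f X u) v = Q.form u (adSeries (neg f) X v) := by
  have : CompleteSpace g := FiniteDimensional.complete K g
  filter_upwards [eventually_summable_norm_adSeries hf, eventually_summable_norm_adSeries hf.neg']
    with X h1 h2 u v
  have hs1 := (hasSum_adSeries_apply h1.of_norm u).mapL
      (LinearMap.toContinuousLinearMap (Q.form.flip v))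
  have hs2 := (hasSum_adSeries_apply h2.of_norm v).mapL (LinearMap.toContinuousLinearMap (Q.form u))
  refine hs1.unique (hs2.congr_fun fun n => ?_)
  simp only [LinearMap.coe_toContinuousLinearMap', LinearMap.BilinForm.flip_apply, map_smul,
    coeff_neg', smul_eq_mul]
  have key : ∀ (n : ℕ) (u v : g),
      Q.form ((adC K X ^ n) u) v = (-1) ^ n * Q.form u ((adC K X ^ n) v) := by
    intro n
    induction n with
    | zero => simp
    | succ n ih =>
      intro u v
      have e : (adC K X ^ (n + 1)) v = ⁅X, (adC K X ^ n) v⁆ := by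
        rw [pow_succ', mul_apply_eq_comp, adC_apply]
      rw [e, pow_succ, mul_apply_eq_comp, ih, adC_apply, Q.invariant]
      ring
  rw [key]; ring

end NormedLie

/-! ### Analytic estimates for the Campbell-Hausdorff series -/
section BCH
variable {K : Type} [RCLike K] {g : Type*} [NormedLieRing g] [NormedLieAlgebra K g]
  [FiniteDimensional K g]


variable (K g) in
/-- The projection of `g × g` which a letter stands for: `Y` for `true`, `X` for `false`. -/
def letterL (i : Bool) : g × g →L[K] g :=
  if i then ContinuousLinearMap.snd K g g else ContinuousLinearMap.fst K g g

theorem letterL_apply (i : Bool) (q : g × g) : letterL K g i q = if i then q.2 else q.1 := by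
  cases i <;> rfl

theorem norm_letterL_apply_le (i : Bool) (q : g × g) : ‖letterL K g i q‖ ≤ ‖q‖ := by
  cases i
  · exact norm_fst_le q
  · exact norm_snd_le q

theorem norm_letterL_le (i : Bool) : ‖letterL K g i‖ ≤ 1 :=
  ContinuousLinearMap.opNorm_le_bound _ zero_le_one fun q => by
    rw [one_mul]; exact norm_letterL_apply_le i q

variable (K) in
/-- The differential of `(X, Y) ↦ brWord Y X w`. -/
def wordD : List Bool → g × g → (g × g →L[K] g)
  | [], _ => 0
  | [i], _ => letterL K g i
  | i :: j :: l, q => (adC K (letterL K g i q)).comp (wordD (j :: l) q)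
      - (adC K (brWord q.2 q.1 (j :: l))).comp (letterL K g i)

theorem wordD_cons (i : Bool) {w : List Bool} (hw : w ≠ []) (q : g × g) :
    wordD K (i :: w) q = (adC K (letterL K g i q)).comp (wordD K w q)
      - (adC K (brWord q.2 q.1 w)).comp (letterL K g i) := by
  cases w with
  | nil => exact absurd rfl hw
  | cons j l => rfl

theorem brWord_cons' (i : Bool) {w : List Bool} (hw : w ≠ []) (q : g × g) :
    brWord q.2 q.1 (i :: w) = ⁅letterL K g i q, brWord q.2 q.1 w⁆ := by
  rw [brWord_cons _ _ _ hw, letterL_apply]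

theorem hasFDerivAt_lie {F : Type*} [NormedAddCommGroup F] [NormedSpace K F] {u v : F → g}
    {u' v' : F →L[K] g} {x : F} (hu : HasFDerivAt u u' x) (hv : HasFDerivAt v v' x) :
    HasFDerivAt (fun y => ⁅u y, v y⁆) ((adC K (u x)).comp v' - (adC K (v x)).comp u') x := by
  have h := ((adL K g).hasFDerivAt.comp x hu).clm_apply hv
  refine h.congr_fderiv ?_
  ext y
  have := lie_skew (v x) (u' y)
  simp only [add_apply, sub_apply, ContinuousLinearMap.comp_apply, Function.comp_apply,
    ContinuousLinearMap.flip_apply, adL_apply, adC_apply]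
  rw [← this]; abel

theorem hasFDerivAt_brWord : ∀ (w : List Bool) (q : g × g),
    HasFDerivAt (fun q : g × g => brWord q.2 q.1 w) (wordD K w q) q
  | [], q => hasFDerivAt_const _ _
  | [i], q => by
    have h := (letterL K g i).hasFDerivAt (x := q)
    refine h.congr_of_eventuallyEq (Filter.Eventually.of_forall fun q => ?_)
    rw [letterL_apply]; rfl
  | i :: j :: l, q => by
    have h := hasFDerivAt_lie (letterL K g i).hasFDerivAt (hasFDerivAt_brWord (j :: l) q)
    refine h.congr_of_eventuallyEq (Filter.Eventually.of_forall fun q => ?_)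
    exact brWord_cons' i (by simp) q

theorem continuous_wordD : ∀ w : List Bool, Continuous (wordD K (g := g) w)
  | [] => continuous_const
  | [i] => continuous_const
  | i :: j :: l => by
    have h1 : Continuous fun q : g × g => adC K (letterL K g i q) :=
      (adL K g).continuous.comp (letterL K g i).continuous
    have h2 : Continuous fun q : g × g => brWord q.2 q.1 (j :: l) :=
      continuous_iff_continuousAt.2 fun q => (hasFDerivAt_brWord (K := K) _ q).continuousAt
    have h3 : Continuous fun q : g × g => adC K (brWord q.2 q.1 (j :: l)) :=
      (adL K g).continuous.comp h2
    exact (h1.clm_comp (continuous_wordD (j :: l))).sub (h3.clm_comp continuous_const)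

theorem norm_letter_le {g : Type*} [NormedLieRing g] (i : Bool) (q : g × g) :
    ‖if i then q.2 else q.1‖ ≤ ‖q‖ := by
  cases i
  · exact norm_fst_le q
  · exact norm_snd_le q

theorem norm_brWord_le {g : Type*} [NormedLieRing g] (q : g × g) : ∀ w : List Bool,
    ‖brWord q.2 q.1 w‖ ≤ ‖q‖ ^ w.length
  | [] => by simp [brWord]
  | [i] => by
    have := norm_letter_le i q
    simpa [brWord] using this
  | i :: j :: l => by
    rw [brWord_cons _ _ i (by simp), List.length_cons, pow_succ']
    exact (norm_lie_le _ _).trans (mul_le_mul (norm_letter_le i q)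
      (norm_brWord_le q (j :: l)) (norm_nonneg _) (norm_nonneg _))

/-- A word of length at least two contains the letter `Y`, or its bracket vanishes. -/
theorem norm_brWord_le_snd {g : Type*} [NormedLieRing g] (q : g × g) :
    ∀ (w : List Bool) (n : ℕ), w.length = n + 2 → ‖brWord q.2 q.1 w‖ ≤ ‖q.2‖ * ‖q‖ ^ (n + 1)
  | [i, j], n, hn => by
    obtain rfl : n = 0 := by simpa using hn
    have h1 := norm_lie_le q.1 q.2
    have h2 := norm_lie_le q.2 q.1
    have h3 := norm_fst_le q
    have h4 : ‖q.1‖ * ‖q.2‖ ≤ ‖q.2‖ * ‖q‖ := by rw [mul_comm]; gcongr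
    have h5 : 0 ≤ ‖q.2‖ * ‖q‖ := by positivity
    cases i <;> cases j <;> simp [brWord] <;> linarith
  | i :: j :: k :: l, n, hn => by
    obtain ⟨m, rfl⟩ : ∃ m, n = m + 1 := ⟨l.length, by simp at hn; omega⟩
    rw [brWord_cons _ _ i (by simp)]
    have ih := norm_brWord_le_snd q (j :: k :: l) m (by simpa using hn)
    calc _ ≤ ‖q‖ * (‖q.2‖ * ‖q‖ ^ (m + 1)) := (norm_lie_le _ _).trans
          (mul_le_mul (norm_letter_le i q) ih (norm_nonneg _) (norm_nonneg _))
      _ = ‖q.2‖ * ‖q‖ ^ (m + 1 + 1) := by ring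

theorem kappa_wordProd (w : List Bool) :
    kappa K (wordProd K w) = (brWord (Aff.E K) (Aff.D K) w).2 := by
  rw [← rightNormed_wordProd (K := K)]; rfl

theorem brWord_aff_fst (i j : Bool) (l : List Bool) :
    (brWord (Aff.E K) (Aff.D K) (i :: j :: l)).1 = 0 := rfl

theorem kappa_cons (i j k : Bool) (l : List Bool) : kappa K (wordProd K (i :: j :: k :: l)) =
    if i then 0 else kappa K (wordProd K (j :: k :: l)) := by
  rw [kappa_wordProd, kappa_wordProd, brWord_cons _ _ _ (by simp), Aff.lie_snd, brWord_aff_fst]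
  cases i <;> simp

theorem kappa_two (i j : Bool) : kappa K (wordProd K [i, j]) =
    (if i then 0 else 1) * (if j then 1 else 0) - (if i then 1 else 0) * (if j then 0 else 1) := by
  rw [kappa_wordProd]
  cases i <;> cases j <;> simp [brWord]

/-- The part of degree one in `Y` of the bracket of a word of length `n + 2` is `kappa • (ad
X)^{n+1} Y`; the remaining part is quadratic in `Y`. -/
theorem norm_brWord_sub_le (q : g × g) : ∀ (w : List Bool) (n : ℕ), w.length = n + 2 →
    ‖brWord q.2 q.1 w - kappa K (wordProd K w) • (adC K q.1 ^ (n + 1)) q.2‖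
      ≤ ‖q.2‖ ^ 2 * ‖q‖ ^ n
  | [i, j], n, hn => by
    obtain rfl : n = 0 := by simpa using hn
    rw [kappa_two]
    have h : ‖(0 : g)‖ ≤ ‖q.2‖ ^ 2 * ‖q‖ ^ 0 := by rw [norm_zero]; positivity
    refine le_of_eq_of_le (congrArg _ ?_) h
    cases i <;> cases j <;> simp [brWord]
  | i :: j :: k :: l, n, hn => by
    obtain ⟨m, rfl⟩ : ∃ m, n = m + 1 := ⟨l.length, by simp at hn; omega⟩
    rw [brWord_cons' (K := K) i (by simp), kappa_cons]
    have ih := norm_brWord_sub_le q (j :: k :: l) m (by simpa using hn)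
    have ih2 := norm_brWord_le_snd q (j :: k :: l) m (by simpa using hn)
    cases i
    · have e : ⁅letterL K g false q, brWord q.2 q.1 (j :: k :: l)⁆ -
          (if false = true then (0 : K) else kappa K (wordProd K (j :: k :: l))) •
            (adC K q.1 ^ (m + 1 + 1)) q.2 =
          ⁅q.1, brWord q.2 q.1 (j :: k :: l) - kappa K (wordProd K (j :: k :: l)) •
            (adC K q.1 ^ (m + 1)) q.2⁆ := by
        rw [pow_succ' (adC K q.1) (m + 1), mul_apply_eq_comp, adC_apply, letterL_apply]
        simp
      rw [e]
      calc _ ≤ ‖q‖ * (‖q.2‖ ^ 2 * ‖q‖ ^ m) := (norm_lie_le _ _).trans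
            (mul_le_mul (norm_fst_le q) ih (norm_nonneg _) (norm_nonneg _))
        _ = _ := by ring
    · simp only [if_true, zero_smul, sub_zero, letterL_apply]
      calc _ ≤ ‖q.2‖ * (‖q.2‖ * ‖q‖ ^ (m + 1)) := (norm_lie_le _ _).trans (by gcongr)
        _ = _ := by ring

theorem norm_wordD_le (q : g × g) : ∀ w : List Bool,
    ‖wordD K w q‖ ≤ w.length * ‖q‖ ^ (w.length - 1)
  | [] => by simp [wordD]
  | [i] => by simpa [wordD] using norm_letterL_le (K := K) (g := g) i
  | i :: j :: l => by
    rw [wordD_cons i (by simp)]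
    have ih := norm_wordD_le q (j :: l)
    have h2 := norm_brWord_le q (j :: l)
    have h1 : ‖adC K (letterL K g i q)‖ ≤ ‖q‖ := (norm_adC_le _).trans (norm_letterL_apply_le i q)
    have h3 : ‖adC K (brWord q.2 q.1 (j :: l))‖ ≤ ‖q‖ ^ (j :: l).length :=
      (norm_adC_le _).trans h2
    refine (norm_sub_le _ _).trans ((add_le_add
      ((ContinuousLinearMap.opNorm_comp_le _ _).trans
        (mul_le_mul h1 ih (norm_nonneg _) (norm_nonneg _)))
      ((ContinuousLinearMap.opNorm_comp_le _ _).trans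
        (mul_le_mul h3 (norm_letterL_le i) (norm_nonneg _) (by positivity)))).trans_eq ?_)
    simp only [List.length_cons, Nat.add_sub_cancel]
    push_cast; ring

/-- Euler's relation for a homogeneous map. -/
theorem wordD_self (q : g × g) : ∀ w : List Bool,
    wordD K w q q = (w.length : K) • brWord q.2 q.1 w
  | [] => by simp [wordD, brWord]
  | [i] => by simp [wordD, brWord, letterL_apply]
  | i :: j :: l => by
    rw [wordD_cons i (by simp), brWord_cons' (K := K) i (by simp)]
    have ih := wordD_self q (j :: l)
    simp only [sub_apply, ContinuousLinearMap.comp_apply, ih, adC_apply,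
      lie_smul, List.length_cons (a := i)]
    rw [← lie_skew (letterL K g i q)]
    push_cast
    module

/-- The partial differential in `Y` of the bracket of a word of length `n + 2` is `kappa • (ad
X)^{n+1}`, up to a term linear in `Y`. -/
theorem norm_wordD_sub_le (q : g × g) (v : g) : ∀ (w : List Bool) (n : ℕ), w.length = n + 2 →
    ‖wordD K w q (0, v) - kappa K (wordProd K w) • (adC K q.1 ^ (n + 1)) v‖
      ≤ (n + 2 : ℕ) * (‖q.2‖ * ‖q‖ ^ n * ‖v‖)
  | [i, j], n, hn => by
    obtain rfl : n = 0 := by simpa using hn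
    rw [kappa_two]
    have h : ‖(0 : g)‖ ≤ (0 + 2 : ℕ) * (‖q.2‖ * ‖q‖ ^ 0 * ‖v‖) := by rw [norm_zero]; positivity
    refine le_of_eq_of_le (congrArg _ ?_) h
    cases i <;> cases j <;> simp [brWord, wordD, letterL_apply]
  | i :: j :: k :: l, n, hn => by
    obtain ⟨m, rfl⟩ : ∃ m, n = m + 1 := ⟨l.length, by simp at hn; omega⟩
    rw [wordD_cons (K := K) i (by simp), kappa_cons]
    have ih := norm_wordD_sub_le q v (j :: k :: l) m (by simpa using hn)
    have ih2 := norm_brWord_le_snd q (j :: k :: l) m (by simpa using hn)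
    have ih3 := norm_wordD_le (K := K) q (j :: k :: l)
    have hlen : (j :: k :: l).length = m + 2 := by simpa using hn
    rw [hlen] at ih3
    cases i
    · have e : ((adC K (letterL K g false q)).comp (wordD K (j :: k :: l) q)
          - (adC K (brWord q.2 q.1 (j :: k :: l))).comp (letterL K g false)) (0, v) -
          (if false = true then (0 : K) else kappa K (wordProd K (j :: k :: l))) •
            (adC K q.1 ^ (m + 1 + 1)) v =
          ⁅q.1, wordD K (j :: k :: l) q (0, v) - kappa K (wordProd K (j :: k :: l)) •
            (adC K q.1 ^ (m + 1)) v⁆ := by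
        rw [pow_succ' (adC K q.1) (m + 1), mul_apply_eq_comp, adC_apply]
        simp [letterL_apply]
      rw [e]
      calc _ ≤ ‖q‖ * ((m + 2 : ℕ) * (‖q.2‖ * ‖q‖ ^ m * ‖v‖)) := (norm_lie_le _ _).trans
            (mul_le_mul (norm_fst_le q) ih (norm_nonneg _) (norm_nonneg _))
        _ = (m + 2 : ℕ) * (‖q.2‖ * ‖q‖ ^ (m + 1) * ‖v‖) := by ring
        _ ≤ _ := by gcongr; omega
    · have hv : ‖((0 : g), v)‖ = ‖v‖ := by simp
      have h1 : ‖wordD K (j :: k :: l) q (0, v)‖ ≤ (m + 2 : ℕ) * ‖q‖ ^ (m + 1) * ‖v‖ :=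
        (ContinuousLinearMap.le_of_opNorm_le _ ih3 _).trans_eq (by rw [hv]; rfl)
      simp only [if_true, zero_smul, sub_zero, letterL_apply, sub_apply,
        ContinuousLinearMap.comp_apply, adC_apply]
      calc _ ≤ ‖q.2‖ * ((m + 2 : ℕ) * ‖q‖ ^ (m + 1) * ‖v‖) + ‖q.2‖ * ‖q‖ ^ (m + 1) * ‖v‖ :=
            norm_sub_le_of_le ((norm_lie_le _ _).trans (by gcongr))
              ((norm_lie_le _ _).trans (by gcongr))
        _ = _ := by push_cast; ring

theorem differentiable_rightNormed (a : FreeAlgebra K Bool) :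
    Differentiable K fun q : g × g => rightNormed q.2 q.1 a := by
  have ha : a ∈ Submodule.span K (Set.range (wordProd K)) := by
    rw [span_range_wordProd]; trivial
  induction ha using Submodule.span_induction with
  | mem a h =>
    obtain ⟨w, rfl⟩ := h
    simp only [rightNormed_wordProd]
    exact fun q => (hasFDerivAt_brWord w q).differentiableAt
  | zero =>
    simp only [← rightNormedₗ_apply, map_zero]
    exact differentiable_const _
  | add a b _ _ ha hb =>
    simp only [← rightNormedₗ_apply, map_add] at ha hb ⊢
    exact ha.add hb
  | smul c a _ ha =>
    simp only [← rightNormedₗ_apply, map_smul] at ha ⊢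
    exact ha.const_smul c

/-- The differential of `(X, Y) ↦ rightNormed Y X a` at a point, as a linear function of `a`. -/
def rightNormedD (q : g × g) : FreeAlgebra K Bool →ₗ[K] (g × g →L[K] g) where
  toFun a := fderiv K (fun q : g × g => rightNormed q.2 q.1 a) q
  map_add' a b := by
    simp only [← rightNormedₗ_apply, map_add]
    exact fderiv_add (differentiable_rightNormed a q) (differentiable_rightNormed b q)
  map_smul' c a := by
    simp only [← rightNormedₗ_apply, map_smul]
    exact fderiv_const_smul (differentiable_rightNormed a q) c

theorem hasFDerivAt_rightNormed (a : FreeAlgebra K Bool) (q : g × g) :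
    HasFDerivAt (fun q : g × g => rightNormed q.2 q.1 a) (rightNormedD q a) q :=
  (differentiable_rightNormed a q).hasFDerivAt

theorem rightNormedD_wordProd (q : g × g) (w : List Bool) :
    rightNormedD q (wordProd K w) = wordD K w q := by
  refine (hasFDerivAt_rightNormed _ q).unique ?_
  simp only [rightNormed_wordProd]
  exact hasFDerivAt_brWord w q

theorem continuous_rightNormedD (a : FreeAlgebra K Bool) :
    Continuous fun q : g × g => rightNormedD q a := by
  have ha : a ∈ Submodule.span K (Set.range (wordProd K)) := by
    rw [span_range_wordProd]; trivial
  induction ha using Submodule.span_induction with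
  | mem a h =>
    obtain ⟨w, rfl⟩ := h
    simp only [rightNormedD_wordProd]
    exact continuous_wordD w
  | zero => simp only [map_zero]; exact continuous_const
  | add a b _ _ ha hb => simp only [map_add]; exact ha.add hb
  | smul c a _ ha => simp only [map_smul]; exact ha.const_smul c

/-- The part of degree one in `Y` of the homogeneous part of degree `n + 2` of
`ln (exp Y exp X)`. -/
theorem inv_mul_kappa_logExpExp (n : ℕ) :
    ((n + 2 : ℕ) : K)⁻¹ * kappa K (logExpExp K (n + 2)) = PowerSeries.coeff (n + 1) (phi1 K) := by
  rw [kappa_logExpExp (n + 1), inv_mul_cancel_left₀ (Nat.cast_ne_zero.2 (by omega))]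

/-- Averaging a bound over the words with the coefficients of the Campbell-Hausdorff series. -/
theorem norm_inv_smul_logExpExp_le {F : Type*} [SeminormedAddCommGroup F] [NormedSpace K F]
    (n : ℕ) (T : FreeAlgebra K Bool →ₗ[K] F) {M : ℝ} (hM : 0 ≤ M)
    (hT : ∀ w : List Bool, w.length = n → ‖T (wordProd K w)‖ ≤ M) :
    ‖(n : K)⁻¹ • T (logExpExp K n)‖ ≤ 8 ^ n * M := by
  have h := (wordBound_logExpExp (K := K) n).norm_le T hM hT
  rcases Nat.eq_zero_or_pos n with rfl | hn
  · simp; positivity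
  · have hn' : (0 : ℝ) < n := by exact_mod_cast hn
    rw [norm_smul, norm_inv, RCLike.norm_natCast, inv_mul_le_iff₀ hn']
    linarith

theorem norm_bchTerm_le (q : g × g) (n : ℕ) : ‖bchTerm K q.2 q.1 n‖ ≤ 8 ^ n * ‖q‖ ^ n :=
  norm_inv_smul_logExpExp_le n (rightNormedₗ (K := K) q.2 q.1)
    (M := ‖q‖ ^ n) (by positivity) fun w hw => by
    rw [rightNormedₗ_apply, rightNormed_wordProd, ← hw]
    exact norm_brWord_le q w

variable (K) in
/-- The differential of the homogeneous part of degree `n` of `ln (exp Y exp X)`. -/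
def bchD (q : g × g) (n : ℕ) : g × g →L[K] g := (n : K)⁻¹ • rightNormedD q (logExpExp K n)

theorem hasFDerivAt_bchTerm (q : g × g) (n : ℕ) :
    HasFDerivAt (fun q : g × g => bchTerm K q.2 q.1 n) (bchD K q n) q :=
  (hasFDerivAt_rightNormed _ q).const_smul _

theorem continuous_bchD (n : ℕ) : Continuous fun q : g × g => bchD K q n :=
  (continuous_rightNormedD (logExpExp K n)).const_smul (n : K)⁻¹

theorem norm_bchD_le (q : g × g) (n : ℕ) :
    ‖bchD K q n‖ ≤ 8 ^ n * (n * ‖q‖ ^ (n - 1)) :=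
  norm_inv_smul_logExpExp_le n (rightNormedD (K := K) q)
    (M := n * ‖q‖ ^ (n - 1)) (by positivity) fun w hw => by
    rw [rightNormedD_wordProd, ← hw]
    exact norm_wordD_le q w

theorem bchD_self (q : g × g) (n : ℕ) : bchD K q n q = (n : K) • bchTerm K q.2 q.1 n := by
  have h := eq_on_logExpExp ((LinearMap.applyₗ q).comp
      ((ContinuousLinearMap.coeLM K).comp (rightNormedD (K := K) q)))
    ((n : K) • rightNormedₗ q.2 q.1) n fun w hw => by
      simp [rightNormedD_wordProd, wordD_self, rightNormedₗ_apply, rightNormed_wordProd, hw]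
  have h' : rightNormedD q (logExpExp K n) q = (n : K) • rightNormed q.2 q.1 (logExpExp K n) := h
  rw [bchD, smul_apply, h', bchTerm, smul_comm]

theorem norm_bchTerm_sub_le (q : g × g) (n : ℕ) :
    ‖bchTerm K q.2 q.1 (n + 2) -
      PowerSeries.coeff (n + 1) (phi1 K) • (adC K q.1 ^ (n + 1)) q.2‖
      ≤ 8 ^ (n + 2) * (‖q.2‖ ^ 2 * ‖q‖ ^ n) := by
  have h := norm_inv_smul_logExpExp_le (n + 2) (rightNormedₗ q.2 q.1 -
    (kappa K).smulRight ((adC K q.1 ^ (n + 1)) q.2))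
    (M := ‖q.2‖ ^ 2 * ‖q‖ ^ n) (by positivity) fun w hw => by
      simpa [rightNormedₗ_apply, rightNormed_wordProd] using norm_brWord_sub_le (K := K) q w n hw
  rw [LinearMap.sub_apply, LinearMap.smulRight_apply, smul_sub, smul_smul,
    inv_mul_kappa_logExpExp] at h
  exact h

theorem norm_bchD_sub_le (q : g × g) (v : g) (n : ℕ) :
    ‖bchD K q (n + 2) (0, v) -
      PowerSeries.coeff (n + 1) (phi1 K) • (adC K q.1 ^ (n + 1)) v‖
      ≤ 8 ^ (n + 2) * ((n + 2 : ℕ) * (‖q.2‖ * ‖q‖ ^ n * ‖v‖)) := by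
  have h := norm_inv_smul_logExpExp_le (n + 2) ((LinearMap.applyₗ ((0 : g), v)).comp
      ((ContinuousLinearMap.coeLM K).comp (rightNormedD (K := K) q)) -
    (kappa K).smulRight ((adC K q.1 ^ (n + 1)) v))
    (M := (n + 2 : ℕ) * (‖q.2‖ * ‖q‖ ^ n * ‖v‖)) (by positivity) fun w hw => by
      simpa [rightNormedD_wordProd] using norm_wordD_sub_le (K := K) q v w n hw
  rw [LinearMap.sub_apply, LinearMap.smulRight_apply, smul_sub, smul_smul,
    inv_mul_kappa_logExpExp] at h
  exact h

theorem bchD_zero (q : g × g) : bchD K q 0 = 0 := by simp [bchD]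

theorem bchD_one (q w : g × g) : bchD K q 1 w = w.2 + w.1 := by
  have h := hasFDerivAt_bchTerm (K := K) q 1
  simp only [bchTerm_one] at h
  rw [h.unique (((ContinuousLinearMap.snd K g g).hasFDerivAt).add
    ((ContinuousLinearMap.fst K g g).hasFDerivAt))]
  rfl

/-- The majorant of the differentials of the Campbell-Hausdorff series on the ball of radius `1/16`
is summable. -/
theorem summable_bound : Summable fun n : ℕ => (8 : ℝ) ^ n * (n * (1 / 16) ^ (n - 1)) := by
  have h := summable_pow_mul_geometric_of_norm_lt_one (R := ℝ) 1 (r := 1 / 2) (by norm_num)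
  refine (h.mul_left 16).congr fun n => ?_
  cases n with
  | zero => simp
  | succ n =>
    rw [Nat.add_sub_cancel, pow_one]
    have : (8 : ℝ) ^ n * (1 / 16) ^ n = (1 / 2) ^ n := by rw [← mul_pow]; norm_num
    rw [pow_succ (8 : ℝ), pow_succ (1 / 2 : ℝ), ← this]; ring

theorem norm_bchD_le_of_lt {q : g × g} (hq : ‖q‖ < 1 / 16) (n : ℕ) :
    ‖bchD K q n‖ ≤ 8 ^ n * (n * (1 / 16) ^ (n - 1)) :=
  (norm_bchD_le q n).trans (by gcongr)

theorem summable_bchD {q : g × g} (hq : ‖q‖ < 1 / 16) : Summable fun n => bchD K q n :=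
  have : CompleteSpace g := FiniteDimensional.complete K g
  Summable.of_norm_bounded summable_bound (norm_bchD_le_of_lt hq)

theorem summable_bchTerm {q : g × g} (hq : ‖q‖ < 1 / 16) :
    Summable fun n => bchTerm K q.2 q.1 n := by
  have : CompleteSpace g := FiniteDimensional.complete K g
  refine Summable.of_norm_bounded (g := fun n : ℕ => (1 / 2 : ℝ) ^ n)
    (summable_geometric_of_lt_one (by norm_num) (by norm_num)) fun n => ?_
  refine (norm_bchTerm_le q n).trans ?_
  rw [← mul_pow]
  gcongr
  linarith

theorem hasFDerivAt_bch {q : g × g} (hq : ‖q‖ < 1 / 16) :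
    HasFDerivAt (fun q : g × g => bch K q.2 q.1) (∑' n, bchD K q n) q := by
  have : CompleteSpace g := FiniteDimensional.complete K g
  let _ : NormedSpace ℝ (g × g) := NormedSpace.restrictScalars ℝ K (g × g)
  have hs : IsPreconnected (Metric.ball (0 : g × g) (1 / 16)) :=
    (convex_ball (0 : g × g) (1 / 16)).isPreconnected
  have h := hasFDerivAt_tsum_of_isPreconnected (𝕜 := K)
    (f := fun n (q : g × g) => bchTerm K q.2 q.1 n) (f' := fun n q => bchD K q n)
    summable_bound Metric.isOpen_ball hs (fun n q _ => hasFDerivAt_bchTerm q n)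
    (fun n q hq => norm_bchD_le_of_lt (mem_ball_zero_iff.1 hq) n)
    (Metric.mem_ball_self (by norm_num))
    (summable_bchTerm (q := (0 : g × g)) (by rw [norm_zero]; norm_num)) (mem_ball_zero_iff.2 hq)
  exact h

theorem fderiv_bch_apply {q : g × g} (hq : ‖q‖ < 1 / 16) (w : g × g) :
    HasSum (fun n => bchD K q n w) (fderiv K (fun q : g × g => bch K q.2 q.1) q w) := by
  rw [(hasFDerivAt_bch hq).fderiv]
  exact (summable_bchD hq).hasSum.mapL (ContinuousLinearMap.apply K g w)

theorem continuousOn_fderiv_bch :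
    ContinuousOn (fderiv K (fun q : g × g => bch K q.2 q.1)) (Metric.ball 0 (1 / 16)) := by
  have : CompleteSpace g := FiniteDimensional.complete K g
  have h := continuousOn_tsum (s := Metric.ball (0 : g × g) (1 / 16))
    (fun n => (continuous_bchD (K := K) (g := g) n).continuousOn) summable_bound
    (fun n q hq => norm_bchD_le_of_lt (by simpa using hq) n)
  exact h.congr fun q hq => (hasFDerivAt_bch (by simpa using hq)).fderiv

theorem hasSum_bch {q : g × g} (hq : ‖q‖ < 1 / 16) :
    HasSum (fun n => bchTerm K q.2 q.1 n) (bch K q.2 q.1) := (summable_bchTerm hq).hasSum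

end BCH

/-! ### The Campbell-Hausdorff series to first order in `Y` -/
section FirstOrder
variable {K : Type} [RCLike K] {g : Type*} [NormedLieRing g] [NormedLieAlgebra K g]
  [FiniteDimensional K g]
open Asymptotics Filter

theorem summable_bound_two :
    Summable fun n : ℕ => (8 : ℝ) ^ (n + 2) * ((n + 2 : ℕ) * (1 / 16) ^ n) := by
  refine (((summable_nat_add_iff 2).2 summable_bound).mul_left 16).congr fun n => ?_
  rw [show n + 2 - 1 = n + 1 from rfl, pow_succ (1 / 16 : ℝ)]
  ring

/-- A series whose `n`-th term is `O(8^(n+2) (n+2) |q|^n D)` has a sum `O(D)`. -/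
theorem norm_le_of_hasSum_of_norm_le {F : Type*} [NormedAddCommGroup F] {u : ℕ → F} {s : F}
    (hu : HasSum u s) {q : g × g} (hq : ‖q‖ < 1 / 16) {D : ℝ} (hD : 0 ≤ D)
    (h : ∀ n : ℕ, ‖u n‖ ≤ 8 ^ (n + 2) * ((n + 2 : ℕ) * (D * ‖q‖ ^ n))) :
    ‖s‖ ≤ (∑' n : ℕ, (8 : ℝ) ^ (n + 2) * ((n + 2 : ℕ) * (1 / 16) ^ n)) * D := by
  refine hu.norm_le_of_bounded (summable_bound_two.hasSum.mul_right D) fun n => (h n).trans ?_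
  calc _ ≤ (8 : ℝ) ^ (n + 2) * ((n + 2 : ℕ) * (D * (1 / 16) ^ n)) := by gcongr
    _ = _ := by ring

theorem eventually_norm_lt : ∀ᶠ q : g × g in 𝓝 0, ‖q‖ < 1 / 16 := by
  filter_upwards [Metric.ball_mem_nhds (0 : g × g) (by norm_num : (0 : ℝ) < 1 / 16)] with q hq
  exact mem_ball_zero_iff.1 hq

theorem tendsto_fst_nhds_zero : Tendsto (fun q : g × g => q.1) (𝓝 0) (𝓝 0) :=
  continuous_fst.tendsto' 0 0 rfl

theorem tendsto_snd_nhds_zero : Tendsto (fun q : g × g => q.2) (𝓝 0) (𝓝 0) :=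
  continuous_snd.tendsto' 0 0 rfl

theorem hasSum_adSeries_apply_succ {f : K⟦X⟧} {X : g}
    (h : Summable fun n => ‖PowerSeries.coeff n f • adC K X ^ n‖) (v : g) :
    HasSum (fun n => PowerSeries.coeff (n + 1) f • (adC K X ^ (n + 1)) v)
      (adSeries f X v - PowerSeries.coeff 0 f • v) := by
  have : CompleteSpace g := FiniteDimensional.complete K g
  have h1 := (hasSum_nat_add_iff' 1).2 (hasSum_adSeries_apply h.of_norm v)
  simpa using h1

theorem one_le_natCast_add_two (n : ℕ) : (1 : ℝ) ≤ (n + 2 : ℕ) := by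
  exact_mod_cast Nat.le_add_left 1 (n + 1)

/-- `ln (exp Y exp X) = X + φ₁(ad X) Y + O(Y²)`. -/
theorem isBigO_bch : (fun q : g × g => bch K q.2 q.1 - q.1 - adSeries (phi1 K) q.1 q.2)
    =O[𝓝 0] fun q => ‖q.2‖ ^ 2 := by
  refine IsBigO.of_bound (∑' n : ℕ, (8 : ℝ) ^ (n + 2) * ((n + 2 : ℕ) * (1 / 16) ^ n)) ?_
  filter_upwards [eventually_norm_lt, tendsto_fst_nhds_zero.eventually
    (eventually_summable_norm_adSeries (g := g) (HasGeomBound.phi1 (K := K)))] with q hq hs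
  have h1 := (hasSum_nat_add_iff' 2).2 (hasSum_bch (K := K) hq)
  have h2 := h1.sub (hasSum_adSeries_apply_succ hs q.2)
  rw [norm_pow, norm_norm]
  refine norm_le_of_hasSum_of_norm_le (q := q) (u := fun n => bchTerm K q.2 q.1 (n + 2) -
    PowerSeries.coeff (n + 1) (phi1 K) • (adC K q.1 ^ (n + 1)) q.2) ?_ hq (by positivity)
    fun n => (norm_bchTerm_sub_le q n).trans ?_
  · convert! h2 using 1
    simp only [Finset.sum_range_succ, Finset.sum_range_zero, bchTerm_zero, bchTerm_one,
      coeff_phi1_zero, one_smul]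
    abel
  · have := one_le_natCast_add_two n
    have h0 : 0 ≤ ‖q.2‖ ^ 2 * ‖q‖ ^ n := by positivity
    exact mul_le_mul_of_nonneg_left (le_mul_of_one_le_left h0 this) (by positivity)

theorem coeff_succ_X_mul_derivative (f : K⟦X⟧) (n : ℕ) :
    PowerSeries.coeff (n + 1) (PowerSeries.X * PowerSeries.derivative K f) =
      (n + 1 : ℕ) * PowerSeries.coeff (n + 1) f := by
  rw [PowerSeries.coeff_succ_X_mul, PowerSeries.coeff_derivative]; push_cast; ring

/-- The radial derivative of `Z = ln (exp Y exp X)` is `Z + (t φ₁')(ad X) Y + O(Y²)`. -/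
theorem isBigO_fderiv_bch_self :
    (fun q : g × g => fderiv K (fun q : g × g => bch K q.2 q.1) q q - bch K q.2 q.1 -
      adSeries (PowerSeries.X * PowerSeries.derivative K (phi1 K)) q.1 q.2)
    =O[𝓝 0] fun q => ‖q.2‖ ^ 2 := by
  refine IsBigO.of_bound (∑' n : ℕ, (8 : ℝ) ^ (n + 2) * ((n + 2 : ℕ) * (1 / 16) ^ n)) ?_
  filter_upwards [eventually_norm_lt, tendsto_fst_nhds_zero.eventually
    (eventually_summable_norm_adSeries (g := g)
      (HasGeomBound.X.mul (HasGeomBound.phi1 (K := K)).derivative))] with q hq hs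
  have h0 := fderiv_bch_apply (K := K) hq q
  simp only [bchD_self] at h0
  have h1 := (hasSum_nat_add_iff' 2).2 (h0.sub (hasSum_bch (K := K) hq))
  have h2 := h1.sub (hasSum_adSeries_apply_succ hs q.2)
  rw [norm_pow, norm_norm]
  refine norm_le_of_hasSum_of_norm_le (q := q) (u := fun n => ((n + 1 : ℕ) : K) •
    (bchTerm K q.2 q.1 (n + 2) -
      PowerSeries.coeff (n + 1) (phi1 K) • (adC K q.1 ^ (n + 1)) q.2)) ?_ hq (by positivity)
    fun n => ?_
  · convert! h2 using 1
    · funext n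
      rw [coeff_succ_X_mul_derivative]
      push_cast
      module
    · simp [Finset.sum_range_succ, bchTerm_zero, bchTerm_one]
  · have h0 : (0 : ℝ) ≤ 8 ^ (n + 2) * (‖q.2‖ ^ 2 * ‖q‖ ^ n) := by positivity
    have h3 : ((n + 1 : ℕ) : ℝ) ≤ (n + 2 : ℕ) := by exact_mod_cast Nat.le_succ _
    rw [norm_smul, RCLike.norm_natCast]
    calc _ ≤ ((n + 2 : ℕ) : ℝ) * (8 ^ (n + 2) * (‖q.2‖ ^ 2 * ‖q‖ ^ n)) := by
          gcongr
          exact norm_bchTerm_sub_le q n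
      _ = _ := by ring

/-- The partial differential of `ln (exp Y exp X)` in `Y` is `φ₁(ad X) + O(Y)`. -/
theorem isBigO_fderiv_bch_snd (v : g) :
    (fun q : g × g => fderiv K (fun q : g × g => bch K q.2 q.1) q (0, v) -
      adSeries (phi1 K) q.1 v) =O[𝓝 0] fun q => ‖q.2‖ := by
  refine IsBigO.of_bound ((∑' n : ℕ, (8 : ℝ) ^ (n + 2) * ((n + 2 : ℕ) * (1 / 16) ^ n)) * ‖v‖) ?_
  filter_upwards [eventually_norm_lt, tendsto_fst_nhds_zero.eventually
    (eventually_summable_norm_adSeries (g := g) (HasGeomBound.phi1 (K := K)))] with q hq hs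
  have h1 := (hasSum_nat_add_iff' 2).2 (fderiv_bch_apply (K := K) hq (0, v))
  have h2 := h1.sub (hasSum_adSeries_apply_succ hs v)
  rw [norm_norm, mul_assoc]
  refine norm_le_of_hasSum_of_norm_le (q := q) (u := fun n => bchD K q (n + 2) (0, v) -
    PowerSeries.coeff (n + 1) (phi1 K) • (adC K q.1 ^ (n + 1)) v) ?_ hq (by positivity)
    fun n => (norm_bchD_sub_le q v n).trans_eq (by ring)
  convert! h2 using 1
  simp [Finset.sum_range_succ, bchD_zero, bchD_one, coeff_phi1_zero,
      -PowerSeries.coeff_zero_eq_constantCoeff]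

/-! ### Asymptotic calculus -/

theorem isBigO_clm_apply {α F G : Type*} [NormedAddCommGroup F] [NormedSpace K F]
    [NormedAddCommGroup G] [NormedSpace K G] {l : Filter α} {T : α → F →L[K] G} {w : α → F}
    {a b : α → ℝ} (hT : T =O[l] a) (hw : w =O[l] b) :
    (fun x => T x (w x)) =O[l] fun x => a x * b x := by
  have h : (fun x => T x (w x)) =O[l] fun x => ‖T x‖ * ‖w x‖ :=
    IsBigO.of_bound 1 (Eventually.of_forall fun x => by
      simpa using (T x).le_opNorm (w x))
  exact h.trans (hT.norm_left.mul hw.norm_left)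

/-- The invariant form as a continuous bilinear map. -/
def QuadraticStructure.formL (Q : QuadraticStructure K g) : g →L[K] g →L[K] K :=
  LinearMap.toContinuousLinearMap (LinearMap.toContinuousLinearMap.toLinearMap ∘ₗ Q.form)

theorem QuadraticStructure.formL_apply (Q : QuadraticStructure K g) (u v : g) :
    Q.formL u v = Q.form u v := rfl

theorem isBigO_form (Q : QuadraticStructure K g) {α : Type*} {l : Filter α} {u w : α → g}
    {a b : α → ℝ} (hu : u =O[l] a) (hw : w =O[l] b) :
    (fun x => Q.form (u x) (w x)) =O[l] fun x => a x * b x :=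
  isBigO_clm_apply (T := fun x => Q.formL (u x))
    ((Q.formL.isBigO_comp u l).trans hu) hw

theorem tendsto_bch : Tendsto (fun q : g × g => bch K q.2 q.1) (𝓝 0) (𝓝 0) := by
  have h := (hasFDerivAt_bch (K := K) (q := (0 : g × g)) (by simp)).continuousAt.tendsto
  have h0 : bch K (0 : g × g).2 (0 : g × g).1 = 0 := by
    refine (hasSum_bch (K := K) (q := (0 : g × g)) (by simp)).unique ?_
    refine hasSum_zero.congr_fun fun n => ?_
    rcases Nat.eq_zero_or_pos n with rfl | hn
    · exact bchTerm_zero _ _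
    · have := norm_bchTerm_le (K := K) (0 : g × g) n
      rw [norm_zero, zero_pow hn.ne', mul_zero] at this
      exact norm_le_zero_iff.1 this
  rwa [h0] at h

theorem isBigO_snd : (fun q : g × g => q.2) =O[𝓝 0] fun q => ‖q.2‖ :=
  (isBigO_refl _ _).norm_right

theorem isBigO_fst : (fun q : g × g => q.1) =O[𝓝 0] fun _ => (1 : ℝ) :=
  tendsto_fst_nhds_zero.isBigO_one ℝ

theorem isBigO_snd_sq : (fun q : g × g => ‖q.2‖ ^ 2) =O[𝓝 0] fun q => ‖q.2‖ := by
  have h : (fun q : g × g => ‖q.2‖) =O[𝓝 0] fun _ => (1 : ℝ) :=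
    (tendsto_snd_nhds_zero (g := g)).norm.isBigO_one ℝ
  refine ((isBigO_refl (fun q : g × g => ‖q.2‖) (𝓝 0)).mul h).congr (fun q => ?_) fun q => ?_
  · ring
  · ring

theorem isBigO_adSeries_apply_snd {f : K⟦X⟧} (hf : HasGeomBound f) :
    (fun q : g × g => adSeries f q.1 q.2) =O[𝓝 0] fun q => ‖q.2‖ := by
  simpa using isBigO_clm_apply (isBigO_adSeries_one hf (tendsto_fst_nhds_zero (g := g)))
    (isBigO_snd (g := g))

/-- `R(ad Z)` applied to the radial derivative of `Z`, to first order in `Y`. -/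
theorem isBigO_R_bch :
    (fun q : g × g => adSeries (R K) (bch K q.2 q.1)
        (fderiv K (fun q : g × g => bch K q.2 q.1) q q) -
      adSeries (R K * (PowerSeries.X * PowerSeries.derivative K (phi1 K))) q.1 q.2)
    =O[𝓝 0] fun q => ‖q.2‖ ^ 2 := by
  set Z : g × g → g := fun q => bch K q.2 q.1 with hZ
  set M : K⟦X⟧ := PowerSeries.X * PowerSeries.derivative K (phi1 K) with hM
  have hMb : HasGeomBound M := HasGeomBound.X.mul HasGeomBound.phi1.derivative
  have hZX : (fun q => Z q - q.1) =O[𝓝 0] fun q => ‖q.2‖ := by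
    refine (((isBigO_bch (K := K) (g := g)).trans isBigO_snd_sq).add
      (isBigO_adSeries_apply_snd (g := g) (HasGeomBound.phi1 (K := K)))).congr_left fun q => ?_
    simp [hZ]
  have h1 := (isBigO_adSeries_sub (HasGeomBound.R (K := K)) (tendsto_bch (K := K) (g := g))
    tendsto_fst_nhds_zero).trans hZX
  have h2 := isBigO_clm_apply h1 (isBigO_adSeries_apply_snd hMb)
  have h3 := isBigO_clm_apply
    (isBigO_adSeries_one (HasGeomBound.R (K := K)) (tendsto_bch (K := K) (g := g)))
    (isBigO_fderiv_bch_self (K := K) (g := g))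
  have h4 := (h2.congr_right (fun q => (pow_two ‖q.2‖).symm)).add
    (h3.congr_right fun q => one_mul (‖q.2‖ ^ 2))
  refine h4.congr' ?_ EventuallyEq.rfl
  filter_upwards [(tendsto_bch (K := K) (g := g)).eventually
    (eventually_adSeries_self (HasGeomBound.R (K := K))),
    tendsto_fst_nhds_zero.eventually (eventually_adSeries_mul (HasGeomBound.R (K := K)) hMb)]
    with q e1 e2
  have h0 : PowerSeries.coeff 0 (R K) = 0 := by rw [coeff_R]; simp
  rw [h0, zero_smul] at e1
  simp only [map_sub, e1, e2, sub_apply, mul_apply_eq_comp]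
  simp only [hZ]
  abel

end FirstOrder

/-! ### Vergne's solution to first order in `Y` -/
section VergneFirstOrder
variable {K : Type} [RCLike K] {g : Type*} [NormedLieRing g] [NormedLieAlgebra K g]
  [FiniteDimensional K g]
open Asymptotics Filter

theorem adSeries_C (a : K) (X : g) : adSeries (PowerSeries.C a) X = a • 1 := by
  rw [adSeries_eq_tsum, tsum_eq_single 0 fun n hn => by
    rw [PowerSeries.coeff_C, if_neg hn, zero_smul]]
  simp

theorem adSeries_X (X : g) : adSeries (PowerSeries.X : K⟦X⟧) X = adC K X := by
  rw [adSeries_eq_tsum, tsum_eq_single 1 fun n hn => by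
    rw [PowerSeries.coeff_X, if_neg hn, zero_smul]]
  simp

theorem eventually_adSeries_add {f h : K⟦X⟧} (hf : HasGeomBound f) (hh : HasGeomBound h) :
    ∀ᶠ X in 𝓝 (0 : g), adSeries (f + h) X = adSeries f X + adSeries h X := by
  have : CompleteSpace g := FiniteDimensional.complete K g
  filter_upwards [eventually_summable_norm_adSeries hf, eventually_summable_norm_adSeries hh]
    with X h1 h2
  refine HasSum.tsum_eq ((h1.of_norm.hasSum.add h2.of_norm.hasSum).congr_fun fun n => ?_)
  rw [map_add, add_smul]
  rfl

theorem eventually_continuousAt_adSeries {f : K⟦X⟧} (hf : HasGeomBound f) :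
    ∀ᶠ X in 𝓝 (0 : g), ContinuousAt (fun X : g => adSeries f X) X := by
  have : CompleteSpace g := FiniteDimensional.complete K g
  exact (analyticAt_adSeries hf).eventually_analyticAt.mono fun X h => h.continuousAt

namespace QuadraticStructure
variable (Q : QuadraticStructure K g)

/-- The integrand of the radial homotopy as a function of `q = s p`: near `0`, its value at `q` is
`s ω_q(p, (0, v))`. -/
def integrand (v : g) (q : g × g) : K :=
  (-(1 / 2 : K)) * Q.form (adSeries (R K) (bch K q.2 q.1)
      (fderiv K (fun q : g × g => bch K q.2 q.1) q q))
    (fderiv K (fun q : g × g => bch K q.2 q.1) q (0, v))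
  + (1 / 2 : K) * Q.form q.1 (adSeries (neg (expQuot K)) q.2 v)

variable (K) in
/-- The power series `-t / 4 - φ₁(-t) R t φ₁' / 2`. -/
def integrandSeries : K⟦X⟧ := PowerSeries.C (-(1 / 4 : K)) * PowerSeries.X +
  PowerSeries.C (-(1 / 2 : K)) * (neg (phi1 K) *
    (R K * (PowerSeries.X * PowerSeries.derivative K (phi1 K))))

theorem hasGeomBound_R_mul_X_mul_derivative : HasGeomBound
    (R K * (PowerSeries.X * PowerSeries.derivative K (phi1 K))) :=
  HasGeomBound.R.mul (HasGeomBound.X.mul HasGeomBound.phi1.derivative)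

theorem hasGeomBound_integrandSeries : HasGeomBound (integrandSeries K) :=
  ((HasGeomBound.C _).mul .X).add ((HasGeomBound.C _).mul
    (HasGeomBound.phi1.neg'.mul hasGeomBound_R_mul_X_mul_derivative))

theorem eventually_adSeries_integrandSeries : ∀ᶠ X in 𝓝 (0 : g), ∀ Y : g,
    adSeries (integrandSeries K) X Y = (-(1 / 4 : K)) • ⁅X, Y⁆ + (-(1 / 2 : K)) •
      adSeries (neg (phi1 K)) X (adSeries
        (R K * (PowerSeries.X * PowerSeries.derivative K (phi1 K))) X Y) := by
  have hb : HasGeomBound (phi1 K) := HasGeomBound.phi1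
  have ha := hasGeomBound_R_mul_X_mul_derivative (K := K)
  have hC := HasGeomBound.C (K := K)
  filter_upwards [eventually_adSeries_mul hb.neg' ha,
    eventually_adSeries_mul (hC (-(1 / 4 : K))) HasGeomBound.X,
    eventually_adSeries_mul (hC (-(1 / 2 : K))) (hb.neg'.mul ha),
    eventually_adSeries_add ((hC (-(1 / 4 : K))).mul HasGeomBound.X)
      ((hC (-(1 / 2 : K))).mul (hb.neg'.mul ha))] with X e1 e2 e3 e4 Y
  rw [integrandSeries, e4, e2, e3, e1, adSeries_C, adSeries_C, adSeries_X]
  simp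

/-- The expansion of the integrand of the radial homotopy to first order in `Y`. -/
theorem isBigO_integrand (v : g) :
    (fun q : g × g => Q.integrand v q -
      ((1 / 2 : K) * Q.form q.1 v + Q.form (adSeries (integrandSeries K) q.1 q.2) v))
    =O[𝓝 0] fun q => ‖q.2‖ ^ 2 := by
  set D : g × g → g := fun q => fderiv K (fun q : g × g => bch K q.2 q.1) q (0, v) with hD
  set G : g × g → g := fun q => adSeries (R K) (bch K q.2 q.1)
      (fderiv K (fun q : g × g => bch K q.2 q.1) q q) with hG
  set P : K⟦X⟧ := R K * (PowerSeries.X * PowerSeries.derivative K (phi1 K)) with hP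
  have hPb : HasGeomBound P := hasGeomBound_R_mul_X_mul_derivative
  have hb : HasGeomBound (phi1 K) := HasGeomBound.phi1
  have hG1 : (fun q => G q - adSeries P q.1 q.2) =O[𝓝 0] fun q => ‖q.2‖ ^ 2 := isBigO_R_bch
  have hD1 : (fun q => D q - adSeries (phi1 K) q.1 v) =O[𝓝 0] fun q => ‖q.2‖ :=
    isBigO_fderiv_bch_snd v
  have hφ : (fun q : g × g => adSeries (phi1 K) q.1 v) =O[𝓝 0] fun _ => (1 : ℝ) := by
    simpa using isBigO_clm_apply (isBigO_adSeries_one hb (tendsto_fst_nhds_zero (g := g)))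
      (isBigO_const_const v (one_ne_zero (α := ℝ)) (𝓝 (0 : g × g)))
  have hY : (fun q : g × g => ‖q.2‖) =O[𝓝 0] fun _ => (1 : ℝ) :=
    (tendsto_snd_nhds_zero (g := g)).norm.isBigO_one ℝ
  have hD2 : D =O[𝓝 0] fun _ => (1 : ℝ) := by
    refine ((hD1.trans hY).add hφ).congr_left fun q => ?_
    abel
  have h1 := (isBigO_form Q hG1 hD2).congr_right fun q => mul_one (‖q.2‖ ^ 2)
  have h2 := (isBigO_form Q (isBigO_adSeries_apply_snd (g := g) hPb) hD1).congr_right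
    fun q => (pow_two ‖q.2‖).symm
  have h3 := isBigO_clm_apply (isBigO_adSeries_sub_linear (HasGeomBound.expQuot (K := K)).neg'
    (tendsto_snd_nhds_zero (g := g))) (isBigO_const_const v (one_ne_zero (α := ℝ)) (𝓝 (0 : g × g)))
  have h4 := isBigO_form Q (isBigO_fst (g := g)) h3
  have h5 := ((h1.add h2).const_mul_left (-(1 / 2 : K))).add
    ((h4.congr_right (g₂ := fun q => ‖q.2‖ ^ 2) fun q => by ring).const_mul_left (1 / 2 : K))
  refine h5.congr' ?_ EventuallyEq.rfl
  filter_upwards [tendsto_fst_nhds_zero.eventually (eventually_form_adSeries Q hb.neg'),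
    tendsto_fst_nhds_zero.eventually (eventually_adSeries_integrandSeries (K := K) (g := g))]
    with q e1 e2
  have c0 : PowerSeries.coeff 0 (neg (expQuot K)) = 1 := by
    rw [coeff_neg', coeff_expQuot]; simp
  have c1 : PowerSeries.coeff 1 (neg (expQuot K)) = -(1 / 2) := by
    rw [coeff_neg', coeff_expQuot]; norm_num [Nat.factorial]
  have e3 : Q.form q.1 ⁅q.2, v⁆ = Q.form ⁅q.1, q.2⁆ v := by
    have := Q.invariant q.2 q.1 v
    rw [← lie_skew q.1 q.2, map_neg, LinearMap.neg_apply, this, neg_neg]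
  rw [e2, integrand]
  simp only [map_add, map_smul, LinearMap.add_apply, LinearMap.smul_apply, e1, neg_neg']
  simp only [sub_apply, add_apply, smul_apply, one_apply_eq_self, adC_apply, map_sub,
    map_add, map_smul, LinearMap.sub_apply, smul_eq_mul, c0, c1, e3, hG, hD]
  ring

theorem eventually_continuousAt_integrand (v : g) :
    ∀ᶠ q in 𝓝 (0 : g × g), ContinuousAt (Q.integrand v) q := by
  have hR := (tendsto_bch (K := K) (g := g)).eventually
    (eventually_continuousAt_adSeries (HasGeomBound.R (K := K)))
  have hE := (tendsto_snd_nhds_zero (g := g)).eventually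
    (eventually_continuousAt_adSeries (HasGeomBound.expQuot (K := K)).neg')
  filter_upwards [hR, hE, eventually_norm_lt] with q h1 h2 hq
  have hd : ContinuousAt (fderiv K (fun q : g × g => bch K q.2 q.1)) q :=
    continuousOn_fderiv_bch.continuousAt (Metric.isOpen_ball.mem_nhds (mem_ball_zero_iff.2 hq))
  have hb : ContinuousAt (fun q : g × g => bch K q.2 q.1) q := (hasFDerivAt_bch hq).continuousAt
  have h3 : ContinuousAt (fun q : g × g => adSeries (R K) (bch K q.2 q.1)) q :=
    ContinuousAt.comp (g := fun X : g => adSeries (R K) X) h1 hb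
  have h4 : ContinuousAt (fun q : g × g => adSeries (neg (expQuot K)) q.2) q :=
    ContinuousAt.comp (g := fun X : g => adSeries (neg (expQuot K)) X) h2 continuousAt_snd
  have h5 : ContinuousAt (fun q : g × g => Q.formL (adSeries (R K) (bch K q.2 q.1)
      (fderiv K (fun q : g × g => bch K q.2 q.1) q q))
    (fderiv K (fun q : g × g => bch K q.2 q.1) q (0, v))) q :=
    ((Q.formL.continuous.continuousAt.comp (h3.clm_apply (hd.clm_apply continuousAt_id))).clm_apply
      (hd.clm_apply continuousAt_const))
  have h6 : ContinuousAt (fun q : g × g => Q.formL q.1 (adSeries (neg (expQuot K)) q.2 v)) q :=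
    ((Q.formL.continuous.continuousAt.comp continuousAt_fst).clm_apply
      (h4.clm_apply continuousAt_const))
  exact (h5.const_mul _).add (h6.const_mul _)

theorem eventually_continuousAt_integrandSeries (v : g) :
    ∀ᶠ q in 𝓝 (0 : g × g), ContinuousAt (fun q : g × g =>
      (1 / 2 : K) * Q.form q.1 v + Q.form (adSeries (integrandSeries K) q.1 q.2) v) q := by
  filter_upwards [(tendsto_fst_nhds_zero (g := g)).eventually
    (eventually_continuousAt_adSeries (hasGeomBound_integrandSeries (K := K)))] with q h1
  have h4 : ContinuousAt (fun q : g × g => adSeries (integrandSeries K) q.1) q :=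
    ContinuousAt.comp (g := fun X : g => adSeries (integrandSeries K) X) h1 continuousAt_fst
  have h5 : ContinuousAt (fun q : g × g => Q.formL (adSeries (integrandSeries K) q.1 q.2) v) q :=
    (Q.formL.continuous.continuousAt.comp (h4.clm_apply continuousAt_snd)).clm_apply
      continuousAt_const
  have h6 : ContinuousAt (fun q : g × g => Q.formL q.1 v) q :=
    (Q.formL.continuous.continuousAt.comp continuousAt_fst).clm_apply continuousAt_const
  exact (h6.const_mul _).add h5

/-- The integrand of `α_p(0, v)` depends only on `s p`.  The term `ϖ_X` of `ω` does not contribute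
because the second argument is `(0, v)`, and `ϖ_Y` does not because `R(ad Y) Y = 0`. -/
theorem eventually_mul_omega (v : g) : ∀ᶠ q in 𝓝 (0 : g × g), ∀ (s : K) (p : g × g), s • p = q →
    s * Q.omega q p (0, v) = Q.integrand v q := by
  filter_upwards [(tendsto_fst_nhds_zero (g := g)).eventually
    (eventually_adSeries_self (HasGeomBound.expQuot (K := K))),
    (tendsto_snd_nhds_zero (g := g)).eventually
      (eventually_adSeries_self (HasGeomBound.R (K := K)))]
    with q e1 e2 s p hp
  have c0 : PowerSeries.coeff 0 (R K) = 0 := by rw [coeff_R]; simp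
  have c1 : PowerSeries.coeff 0 (expQuot K) = 1 := by rw [coeff_expQuot]; simp
  rw [c0, zero_smul] at e2
  rw [c1, one_smul] at e1
  have hp1 : s • p.1 = q.1 := by rw [← hp]; rfl
  have hp2 : s • p.2 = q.2 := by rw [← hp]; rfl
  have e1' : s • adSeries (expQuot K) q.1 p.1 = q.1 := by rw [← map_smul, hp1, e1]
  have e2' : s • adSeries (R K) q.2 p.2 = 0 := by rw [← map_smul, hp2, e2]
  have e3 : fderiv K (fun q : g × g => bch K q.2 q.1) q q =
      s • fderiv K (fun q : g × g => bch K q.2 q.1) q p := by rw [← map_smul, hp]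
  have e4 : s * Q.form (adSeries (R K) q.2 p.2) v = 0 := by
    have := congrArg (fun w => Q.form w v) e2'
    simpa using this
  have e5 : s * Q.form (adSeries (expQuot K) q.1 p.1) (adSeries (neg (expQuot K)) q.2 v) =
      Q.form q.1 (adSeries (neg (expQuot K)) q.2 v) := by
    have := congrArg (fun w => Q.form w (adSeries (neg (expQuot K)) q.2 v)) e1'
    simpa using this
  simp only [omega, varpi, thetaRight, thetaLeft, integrand, e3, map_smul, LinearMap.smul_apply,
    smul_eq_mul, map_zero, LinearMap.zero_apply, mul_zero, sub_zero]
  linear_combination (1 / 2 : K) * e4 + (1 / 2 : K) * e5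

end QuadraticStructure
end VergneFirstOrder

/-! ### The first order part of Vergne's solution -/
section VergneSolution
variable {K : Type} [RCLike K] {g : Type*} [NormedLieRing g] [NormedLieAlgebra K g]
  [FiniteDimensional K g]
open Asymptotics Filter

theorem adC_smul_pow (s : K) (X : g) (n : ℕ) : adC K (s • X) ^ n = s ^ n • adC K X ^ n := by
  have : adC K (s • X) = s • adC K X := (adL K g).map_smul s X
  rw [this, smul_pow]

/-- Radial integration of `f(ad X) Y` divides the coefficient of `tⁿ` by `n + 2`. -/
theorem integral_adSeries {f : K⟦X⟧} {X : g}
    (hs : Summable fun n => ‖PowerSeries.coeff n f • adC K X ^ n‖)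
    (hs' : Summable fun n => ‖PowerSeries.coeff n
      (PowerSeries.mk fun n => PowerSeries.coeff n f / ((n : K) + 2)) • adC K X ^ n‖)
    (Y : g) (ℓ : g →L[K] K) :
    ∫ s in (0 : ℝ)..1, ℓ (adSeries f ((s : K) • X) ((s : K) • Y)) =
      ℓ (adSeries (PowerSeries.mk fun n => PowerSeries.coeff n f / ((n : K) + 2)) X Y) := by
  have : CompleteSpace g := FiniteDimensional.complete K g
  have key := intervalIntegral.hasSum_integral_of_dominated_convergence (a := 0) (b := 1)
    (μ := MeasureTheory.volume)
    (F := fun n (s : ℝ) => ((s ^ (n + 1) : ℝ) : K) * ℓ (PowerSeries.coeff n f • (adC K X ^ n) Y))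
    (f := fun s : ℝ => ℓ (adSeries f ((s : K) • X) ((s : K) • Y)))
    (fun n _ => ‖ℓ‖ * (‖PowerSeries.coeff n f • adC K X ^ n‖ * ‖Y‖))
    (fun n => by
      refine Continuous.aestronglyMeasurable ?_
      exact (RCLike.continuous_ofReal.comp (continuous_pow _)).mul continuous_const)
    (fun n => Eventually.of_forall fun s hs => by
      rw [Set.uIoc_of_le zero_le_one] at hs
      rw [norm_mul, RCLike.norm_ofReal, abs_of_nonneg (pow_nonneg hs.1.le _)]
      have h1 : s ^ (n + 1) ≤ 1 := pow_le_one₀ hs.1.le hs.2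
      have h2 : ‖ℓ (PowerSeries.coeff n f • (adC K X ^ n) Y)‖ ≤
          ‖ℓ‖ * (‖PowerSeries.coeff n f • adC K X ^ n‖ * ‖Y‖) :=
        (ℓ.le_opNorm _).trans (by
          gcongr
          exact (PowerSeries.coeff n f • adC K X ^ n).le_opNorm Y)
      calc _ ≤ 1 * ‖ℓ (PowerSeries.coeff n f • (adC K X ^ n) Y)‖ := by gcongr
        _ ≤ _ := by rwa [one_mul])
    (Eventually.of_forall fun s _ => (hs.mul_right _).mul_left _)
    intervalIntegrable_const
    (Eventually.of_forall fun s hs1 => by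
      rw [Set.uIoc_of_le zero_le_one] at hs1
      have h1 : Summable fun n => PowerSeries.coeff n f • adC K ((s : K) • X) ^ n := by
        refine .of_norm_bounded hs fun n => ?_
        rw [adC_smul_pow, smul_comm, norm_smul, norm_pow, RCLike.norm_ofReal,
          abs_of_nonneg hs1.1.le]
        exact mul_le_of_le_one_left (norm_nonneg _) (pow_le_one₀ hs1.1.le hs1.2)
      refine ((hasSum_adSeries_apply h1 ((s : K) • Y)).mapL ℓ).congr_fun fun n => ?_
      simp only [adC_smul_pow, smul_apply, map_smul, smul_eq_mul, RCLike.ofReal_pow]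
      ring)
  refine key.unique (((hasSum_adSeries_apply hs'.of_norm Y).mapL ℓ).congr_fun fun n => ?_)
  have h : ∫ s in (0 : ℝ)..1, ((s ^ (n + 1) : ℝ) : K) = 1 / ((n : K) + 2) := by
    rw [RCLike.intervalIntegral_ofReal, integral_pow]
    push_cast
    simp
    ring
  rw [intervalIntegral.integral_mul_const, h, PowerSeries.coeff_mk]
  simp only [map_smul, smul_eq_mul]
  ring

namespace QuadraticStructure
variable (K) in
/-- The first order part in `Y` of the gradient of `α` is `X / 4` plus this series in `ad X`,
applied to `Y`. -/
def gradSeries : K⟦X⟧ :=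
  PowerSeries.mk fun n => PowerSeries.coeff n (integrandSeries K) / ((n : K) + 2)

theorem hasGeomBound_gradSeries : HasGeomBound (gradSeries K) :=
  hasGeomBound_integrandSeries.div_add_two

variable (Q : QuadraticStructure K g)

/-- The radial homotopy to first order in `Y`: the expansion of the integrand is integrated over the
segment from `0` to `p`, on which the remainder is uniformly `O(Y²)`. -/
theorem isBigO_alpha (v : g) :
    (fun p : g × g => Q.alpha p (0, v) -
      ((1 / 4 : K) * Q.form p.1 v + Q.form (adSeries (gradSeries K) p.1 p.2) v))
    =O[𝓝 0] fun p => ‖p.2‖ ^ 2 := by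
  have : CompleteSpace g := FiniteDimensional.complete K g
  obtain ⟨C, hC⟩ := (Q.isBigO_integrand v).bound
  obtain ⟨ε, hε, hball⟩ := Metric.eventually_nhds_iff_ball.1 (hC.and
    ((Q.eventually_continuousAt_integrand v).and
      ((Q.eventually_continuousAt_integrandSeries v).and (Q.eventually_mul_omega v))))
  refine IsBigO.of_bound |C| ?_
  have hf := hasGeomBound_integrandSeries (K := K)
  filter_upwards [Metric.ball_mem_nhds (0 : g × g) hε,
    (tendsto_fst_nhds_zero (g := g)).eventually (eventually_summable_norm_adSeries hf),
    (tendsto_fst_nhds_zero (g := g)).eventually (eventually_summable_norm_adSeries hf.div_add_two)]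
    with p hp hs1 hs2
  have hsp : ∀ s ∈ Set.Icc (0 : ℝ) 1, ((s : ℝ) : K) • p ∈ Metric.ball (0 : g × g) ε := by
    intro s hs
    rw [mem_ball_zero_iff] at hp ⊢
    rw [norm_smul, RCLike.norm_ofReal, abs_of_nonneg hs.1]
    exact (mul_le_of_le_one_left (norm_nonneg _) hs.2).trans_lt hp
  have hcont : Continuous fun s : ℝ => ((s : ℝ) : K) • p := by
    have h : Continuous fun s : ℝ => (s : K) := RCLike.continuous_ofReal
    exact h.smul continuous_const
  have hu : Set.uIcc (0 : ℝ) 1 = Set.Icc 0 1 := Set.uIcc_of_le zero_le_one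
  set G : g × g → K := fun q =>
    (1 / 2 : K) * Q.form q.1 v + Q.form (adSeries (integrandSeries K) q.1 q.2) v with hG
  have i1 : IntervalIntegrable (fun s : ℝ => Q.integrand v (((s : ℝ) : K) • p))
      MeasureTheory.volume 0 1 := by
    refine ContinuousOn.intervalIntegrable fun s hs => ?_
    rw [hu] at hs
    exact (ContinuousAt.comp (f := fun s : ℝ => ((s : ℝ) : K) • p) (g := Q.integrand v)
      (hball _ (hsp s hs)).2.1 hcont.continuousAt).continuousWithinAt
  have i2 : IntervalIntegrable (fun s : ℝ => G (((s : ℝ) : K) • p))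
      MeasureTheory.volume 0 1 := by
    refine ContinuousOn.intervalIntegrable fun s hs => ?_
    rw [hu] at hs
    exact (ContinuousAt.comp (f := fun s : ℝ => ((s : ℝ) : K) • p) (g := G)
      (hball _ (hsp s hs)).2.2.1 hcont.continuousAt).continuousWithinAt
  have e1 : Q.alpha p (0, v) = ∫ s in (0 : ℝ)..1, Q.integrand v (((s : ℝ) : K) • p) := by
    rw [alpha]
    refine intervalIntegral.integral_congr fun s hs => ?_
    rw [hu] at hs
    exact (hball _ (hsp s hs)).2.2.2 _ _ rfl
  have hlin : IntervalIntegrable (fun s : ℝ => ((s : ℝ) : K) * ((1 / 2 : K) * Q.form p.1 v))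
      MeasureTheory.volume 0 1 :=
    (RCLike.continuous_ofReal.mul continuous_const).intervalIntegrable _ _
  have hGs : ∀ s : ℝ, G (((s : ℝ) : K) • p) = ((s : ℝ) : K) * ((1 / 2 : K) * Q.form p.1 v) +
      Q.formL.flip v
        (adSeries (integrandSeries K) (((s : ℝ) : K) • p.1) (((s : ℝ) : K) • p.2)) := by
    intro s
    simp only [hG, Prod.smul_fst, Prod.smul_snd, map_smul, LinearMap.smul_apply, smul_eq_mul,
      ContinuousLinearMap.flip_apply, formL_apply]
    ring
  have e2 : (1 / 4 : K) * Q.form p.1 v + Q.form (adSeries (gradSeries K) p.1 p.2) v =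
      ∫ s in (0 : ℝ)..1, G (((s : ℝ) : K) • p) := by
    have i3 : IntervalIntegrable (fun s : ℝ => Q.formL.flip v (adSeries (integrandSeries K)
        (((s : ℝ) : K) • p.1) (((s : ℝ) : K) • p.2))) MeasureTheory.volume 0 1 := by
      refine (i2.sub hlin).congr fun s _ => ?_
      simp only [hGs]
      ring
    simp_rw [hGs]
    rw [intervalIntegral.integral_add hlin i3, integral_adSeries hs1 hs2,
      intervalIntegral.integral_mul_const, RCLike.intervalIntegral_ofReal, integral_id]
    simp only [ContinuousLinearMap.flip_apply, formL_apply, gradSeries]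
    push_cast
    ring
  rw [e1, e2, ← intervalIntegral.integral_sub i1 i2]
  refine (intervalIntegral.norm_integral_le_of_norm_le_const (C := |C| * ‖p.2‖ ^ 2)
    fun s hs => ?_).trans (by simp)
  rw [Set.uIoc_of_le zero_le_one] at hs
  have h1 := (hball _ (hsp s ⟨hs.1.le, hs.2⟩)).1
  refine h1.trans ?_
  rw [norm_pow, norm_norm, Prod.smul_snd, norm_smul, RCLike.norm_ofReal, abs_of_nonneg hs.1.le]
  have h2 : s * ‖p.2‖ ≤ ‖p.2‖ := mul_le_of_le_one_left (norm_nonneg _) hs.2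
  have h3 : 0 ≤ s * ‖p.2‖ := mul_nonneg hs.1.le (norm_nonneg _)
  gcongr
  exact le_abs_self C

theorem sum_form_smul_dualBasis {ι : Type*} [Fintype ι] [DecidableEq ι] (b : Module.Basis ι K g)
    (x : g) : ∑ i, Q.form x (b i) • Q.form.dualBasis Q.nondegenerate b i = x := by
  conv_rhs => rw [← (Q.form.dualBasis Q.nondegenerate b).sum_repr x]
  simp_rw [LinearMap.BilinForm.dualBasis_repr_apply]

theorem isBigO_gradY : (fun p : g × g => Q.gradY p.1 p.2 -
      ((1 / 4 : K) • p.1 + adSeries (gradSeries K) p.1 p.2)) =O[𝓝 0] fun p => ‖p.2‖ ^ 2 := by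
  set b := Module.finBasis K g with hb
  have h1 : ∀ i, (fun p : g × g => (Q.alpha p (0, b i) - ((1 / 4 : K) * Q.form p.1 (b i) +
      Q.form (adSeries (gradSeries K) p.1 p.2) (b i))) •
      Q.form.dualBasis Q.nondegenerate b i) =O[𝓝 0] fun p => ‖p.2‖ ^ 2 := fun i =>
    ((ContinuousLinearMap.toSpanSingleton K
      (Q.form.dualBasis Q.nondegenerate b i)).isBigO_comp _ _).trans (Q.isBigO_alpha (b i))
  have h : (fun p : g × g => ∑ i, (Q.alpha p (0, b i) - ((1 / 4 : K) * Q.form p.1 (b i) +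
      Q.form (adSeries (gradSeries K) p.1 p.2) (b i))) •
      Q.form.dualBasis Q.nondegenerate b i) =O[𝓝 0] fun p => ‖p.2‖ ^ 2 := by
    exact IsBigO.fun_sum fun i _ => h1 i
  refine h.congr_left fun p => ?_
  conv_rhs =>
    rw [← Q.sum_form_smul_dualBasis b ((1 / 4 : K) • p.1 + adSeries (gradSeries K) p.1 p.2)]
  rw [gradY, ← hb, ← Finset.sum_sub_distrib]
  refine Finset.sum_congr rfl fun i _ => ?_
  rw [sub_smul]
  simp

theorem _root_.KashiwaraVergne.gammaV_eq :
    gammaV K = gradSeries K + PowerSeries.C (1 / 8) * PowerSeries.X := by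
  ext n
  have hn := natCast_add_two_ne_zero (K := K) n
  simp only [gammaV, gammaVRhs, gradSeries, integrandSeries, PowerSeries.coeff_mk, map_add,
    map_sub, mul_assoc, PowerSeries.coeff_C_mul, PowerSeries.coeff_X]
  rw [show PowerSeries.X * (neg (phi1 K) * (R K * d⁄dX K (phi1 K))) =
    neg (phi1 K) * (R K * (PowerSeries.X * d⁄dX K (phi1 K))) by ring]
  by_cases h : n = 1
  · subst h
    norm_num
    ring
  · simp [h]

/-- `B_V = X / 4 + γ_V(ad X) Y + O(Y²)`: applying `φ₁(ad Y) = 1 - ad Y / 2 + O(Y²)` to the gradient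
of `α` turns `X / 4` into `X / 4 + [X, Y] / 8`. -/
theorem isBigO_vergneB : (fun p : g × g => Q.vergneB p.1 p.2 -
      ((1 / 4 : K) • p.1 + adSeries (gammaV K) p.1 p.2)) =O[𝓝 0] fun p => ‖p.2‖ ^ 2 := by
  have hk := hasGeomBound_gradSeries (K := K)
  set W : g × g → g := fun p => (1 / 4 : K) • p.1 + adSeries (gradSeries K) p.1 p.2 with hW
  have hY : (fun p : g × g => ‖p.2‖ ^ 2) =O[𝓝 0] fun p => ‖p.2‖ := isBigO_snd_sq
  have hY1 : (fun q : g × g => ‖q.2‖) =O[𝓝 0] fun _ => (1 : ℝ) :=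
    (tendsto_snd_nhds_zero (g := g)).norm.isBigO_one ℝ
  have hkY := isBigO_adSeries_apply_snd (g := g) hk
  have hg : (fun p : g × g => Q.gradY p.1 p.2 - (1 / 4 : K) • p.1) =O[𝓝 0] fun p => ‖p.2‖ := by
    refine ((Q.isBigO_gradY.trans hY).add hkY).congr_left fun p => ?_
    abel
  have hg1 : (fun p : g × g => Q.gradY p.1 p.2) =O[𝓝 0] fun _ => (1 : ℝ) := by
    refine ((hg.trans hY1).add ((isBigO_fst (g := g)).const_smul_left (1 / 4 : K))).congr_left
      fun p => ?_
    simp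
  have h1 := isBigO_clm_apply (isBigO_adSeries_sub_linear (HasGeomBound.phi1 (K := K))
    (tendsto_snd_nhds_zero (g := g))) hg1
  have h2 : (fun p : g × g => ⁅p.2, Q.gradY p.1 p.2 - (1 / 4 : K) • p.1⁆) =O[𝓝 0]
      fun p => ‖p.2‖ ^ 2 := by
    refine (isBigO_of_le (g := fun p => ‖p.2‖ * ‖Q.gradY p.1 p.2 - (1 / 4 : K) • p.1‖) _
      fun p => ?_).trans ?_
    · rw [norm_mul, norm_norm, norm_norm]
      exact norm_lie_le _ _
    · exact ((isBigO_refl _ _).mul hg.norm_left).congr_right fun p => (pow_two _).symm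
  have h3 := ((h1.congr_right (g₂ := fun p => ‖p.2‖ ^ 2) fun p => mul_one _).add
    Q.isBigO_gradY).add (h2.const_smul_left (-(1 / 2 : K)))
  refine h3.congr' ?_ EventuallyEq.rfl
  have hC := HasGeomBound.C (K := K) (1 / 8)
  filter_upwards [tendsto_fst_nhds_zero.eventually (eventually_adSeries_add (g := g) hk
    (hC.mul .X)), tendsto_fst_nhds_zero.eventually (eventually_adSeries_mul (g := g) hC .X)]
    with p e1 e2
  have e3 : ⁅p.2, p.1⁆ = -⁅p.1, p.2⁆ := (lie_skew _ _).symm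
  rw [gammaV_eq, e1, e2, adSeries_C, adSeries_X, vergneB]
  simp only [coeff_phi1_zero, coeff_phi1_one, sub_apply, add_apply, smul_apply,
    Pi.smul_apply, one_apply_eq_self, adC_apply, lie_sub, lie_smul, e3, mul_apply_eq_comp]
  module

/-- For fixed `X`, an error `O(Y²)` determines the value and the derivative at `Y = 0`. -/
theorem hasFirstOrderPart_gammaV_of_norm : Q.HasFirstOrderPart (gammaV K) := by
  obtain ⟨C, hC⟩ := Q.isBigO_vergneB.bound
  have hC' : ∀ᶠ p in 𝓝 (0 : g) ×ˢ 𝓝 (0 : g), ‖Q.vergneB p.1 p.2 -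
      ((1 / 4 : K) • p.1 + adSeries (gammaV K) p.1 p.2)‖ ≤ C * ‖‖p.2‖ ^ 2‖ := by
    rw [← nhds_prod_eq]; exact hC
  filter_upwards [hC'.curry] with X hX
  have h0 : Q.vergneB X 0 = (1 / 4 : K) • X := by
    have := hX.self_of_nhds
    simpa [sub_eq_zero] using this
  refine ⟨h0, ?_⟩
  rw [hasFDerivAt_iff_isLittleO_nhds_zero]
  refine IsBigO.trans_isLittleO (g := fun Y : g => ‖Y‖ ^ 2) (IsBigO.of_bound C ?_) ?_
  · filter_upwards [hX] with Y hY
    rw [zero_add, h0, sub_sub]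
    exact hY
  · have := (isLittleO_norm_pow_id (E' := g) one_lt_two)
    exact this

end QuadraticStructure
end VergneSolution

/-! ### Norms on finite-dimensional Lie algebras -/
section Renorm
variable {K : Type} [RCLike K] {g : Type*} [LieRing g] [LieAlgebra K g]
  [TopologicalSpace g] [IsTopologicalAddGroup g] [ContinuousSMul K g] [T2Space g]
  [FiniteDimensional K g]

variable (K g) in
/-- A finite-dimensional Lie algebra has linear coordinates in which `‖[x, y]‖ ≤ ‖x‖ ‖y‖`. -/
theorem exists_equiv_norm_lie_le : ∃ e : g ≃L[K] (Fin (Module.finrank K g) → K),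
    ∀ x y, ‖e ⁅x, y⁆‖ ≤ ‖e x‖ * ‖e y‖ := by
  set V := Fin (Module.finrank K g) → K
  set e : g ≃L[K] V := (Module.finBasis K g).equivFun.toContinuousLinearEquiv
  let b : V →ₗ[K] V →ₗ[K] V :=
    ((LieModule.toEnd K g g : g →ₗ[K] g →ₗ[K] g).compl₁₂ e.symm.toLinearEquiv.toLinearMap
      e.symm.toLinearEquiv.toLinearMap).compr₂ e.toLinearEquiv.toLinearMap
  let B : V →L[K] V →L[K] V :=
    LinearMap.toContinuousLinearMap (LinearMap.toContinuousLinearMap.toLinearMap ∘ₗ b)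
  have hB : ∀ x y, B (e x) (e y) = e ⁅x, y⁆ := fun x y => by
    simp [B, b, LinearMap.compr₂, LinearMap.compl₁₂]
  set c : ℝ := ‖B‖ + 1
  have hc : 0 < c := by positivity
  have hcK : (c : K) ≠ 0 := RCLike.ofReal_ne_zero.2 hc.ne'
  refine ⟨e.trans (ContinuousLinearEquiv.smulLeft (Units.mk0 (c : K) hcK)), fun x y => ?_⟩
  have h1 : ∀ z, ‖(e.trans (ContinuousLinearEquiv.smulLeft (Units.mk0 (c : K) hcK))) z‖
      = c * ‖e z‖ := fun z => by
    change ‖(c : K) • e z‖ = _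
    rw [norm_smul, RCLike.norm_ofReal, abs_of_pos hc]
  rw [h1, h1, h1, ← hB]
  calc c * ‖B (e x) (e y)‖ ≤ c * (‖B‖ * ‖e x‖ * ‖e y‖) := by
        gcongr; exact B.le_opNorm₂ _ _
    _ ≤ c * (c * ‖e x‖ * ‖e y‖) := by gcongr; simp [c]
    _ = _ := by ring

/-- The norm of `Kⁿ` pulled back to a Lie algebra along linear coordinates, inducing the given
topology. -/
abbrev normedLieRingOfEquiv {n : ℕ} (e : g ≃L[K] (Fin n → K))
    (he : ∀ x y, ‖e ⁅x, y⁆‖ ≤ ‖e x‖ * ‖e y‖) : NormedLieRing g :=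
  let M : MetricSpace g := (MetricSpace.induced e e.injective inferInstance).replaceTopology
    e.toHomeomorph.isInducing.eq_induced
  { ‹LieRing g›, M with
    norm := fun x => ‖e x‖
    dist_eq := fun x y => by
      rw [map_add, map_neg]
      exact NormedAddCommGroup.dist_eq (e x) (e y)
    norm_lie_le' := he }

/-- The pulled back norm as a norm of Lie algebras over `K`. -/
abbrev normedLieAlgebraOfEquiv {n : ℕ} (e : g ≃L[K] (Fin n → K))
    (he : ∀ x y, ‖e ⁅x, y⁆‖ ≤ ‖e x‖ * ‖e y‖) :
    letI := normedLieRingOfEquiv e he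
    NormedLieAlgebra K g :=
  letI := normedLieRingOfEquiv e he
  { ‹LieAlgebra K g› with
    norm_smul_le := fun a x => by
      change ‖e (a • x)‖ ≤ ‖a‖ * ‖e x‖
      rw [map_smul, norm_smul] }

theorem QuadraticStructure.hasFirstOrderPart_gammaV (Q : QuadraticStructure K g) :
    Q.HasFirstOrderPart (gammaV K) := by
  obtain ⟨e, he⟩ := exists_equiv_norm_lie_le K g
  let _ := normedLieRingOfEquiv e he
  let _ := normedLieAlgebraOfEquiv e he
  exact Q.hasFirstOrderPart_gammaV_of_norm

/-- `f(ad X)` is an absolutely convergent series, for `X` near `0`. -/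
theorem eventually_summable_adSeries {f : K⟦X⟧} (hf : HasGeomBound f) :
    ∀ᶠ X in 𝓝 (0 : g), Summable fun n => PowerSeries.coeff n f •
      (LinearMap.toContinuousLinearMap (LieAlgebra.ad K g X : g →ₗ[K] g)) ^ n := by
  obtain ⟨e, he⟩ := exists_equiv_norm_lie_le K g
  let _ := normedLieRingOfEquiv e he
  let _ := normedLieAlgebraOfEquiv e he
  have : CompleteSpace g := FiniteDimensional.complete K g
  exact (eventually_summable_norm_adSeries (g := g) hf).mono fun X h => h.of_norm

end Renorm

/-! ### Convergent power series in one variable as functions -/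
section Eval
variable {K : Type} [RCLike K]
open PowerSeries Filter

/-- The sum of the power series `f` at `a`. -/
def ev (f : K⟦X⟧) (a : K) : K := ∑' n, coeff n f * a ^ n

theorem HasGeomBound.eventually_summable_norm {f : K⟦X⟧} (hf : HasGeomBound f) :
    ∀ᶠ a in 𝓝 (0 : K), Summable fun n => ‖coeff n f * a ^ n‖ := by
  obtain ⟨r, hr1, -, hr⟩ := hf.exists_one_le 0
  have hr0 : 0 < r := by linarith
  filter_upwards [Metric.ball_mem_nhds (0 : K) (inv_pos.2 hr0)] with a ha
  rw [mem_ball_zero_iff] at ha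
  have hlt : r * ‖a‖ < 1 := by
    calc r * ‖a‖ < r * r⁻¹ := by gcongr
      _ = 1 := mul_inv_cancel₀ hr0.ne'
  refine .of_nonneg_of_le (fun _ => norm_nonneg _) (fun n => ?_)
    ((summable_geometric_of_lt_one (by positivity) hlt).mul_left r)
  rw [norm_mul, norm_pow, mul_pow, ← mul_assoc, ← pow_succ']
  gcongr
  exact hr n

/-- A power series which converges at some point other than `0` has a positive radius of
convergence. -/
theorem HasGeomBound.of_summable {f : K⟦X⟧} {a : K} (ha : a ≠ 0)
    (h : Summable fun n => coeff n f * a ^ n) : HasGeomBound f := by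
  obtain ⟨C, hC⟩ := h.tendsto_atTop_zero.norm.bddAbove_range
  have ha' : 0 < ‖a‖ := norm_pos_iff.2 ha
  have hC' : ∀ n, ‖coeff n f‖ * ‖a‖ ^ n ≤ C := fun n => by
    rw [← norm_pow, ← norm_mul]
    exact hC ⟨n, rfl⟩
  refine ⟨max (max C 1) ‖a‖⁻¹ , fun n => ?_⟩
  have h1 : ‖coeff n f‖ ≤ C * ‖a‖⁻¹ ^ n := by
    rw [inv_pow, ← div_eq_mul_inv, le_div_iff₀ (by positivity)]
    exact hC' n
  calc ‖coeff n f‖ ≤ C * ‖a‖⁻¹ ^ n := h1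
    _ ≤ max (max C 1) ‖a‖⁻¹ * max (max C 1) ‖a‖⁻¹ ^ n := by
        gcongr
        · exact (le_max_left _ _).trans (le_max_left _ _)
        · exact le_max_right _ _
    _ = _ := (pow_succ' _ _).symm

theorem HasGeomBound.eventually_ev_mul {f h : K⟦X⟧} (hf : HasGeomBound f) (hh : HasGeomBound h) :
    ∀ᶠ a in 𝓝 (0 : K), ev (f * h) a = ev f a * ev h a := by
  filter_upwards [hf.eventually_summable_norm, hh.eventually_summable_norm] with a h1 h2
  rw [ev, ev, ev, tsum_mul_tsum_eq_tsum_sum_antidiagonal_of_summable_norm h1 h2]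
  refine tsum_congr fun n => ?_
  rw [coeff_mul, Finset.sum_mul]
  refine Finset.sum_congr rfl fun p hp => ?_
  rw [← Finset.HasAntidiagonal.mem_antidiagonal.1 hp, pow_add]
  ring

theorem HasGeomBound.eventually_ev_add {f h : K⟦X⟧} (hf : HasGeomBound f) (hh : HasGeomBound h) :
    ∀ᶠ a in 𝓝 (0 : K), ev (f + h) a = ev f a + ev h a := by
  filter_upwards [hf.eventually_summable_norm, hh.eventually_summable_norm] with a h1 h2
  rw [ev, ev, ev, ← h1.of_norm.tsum_add h2.of_norm]
  simp_rw [map_add, add_mul]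

theorem HasGeomBound.eventually_ev_sub {f h : K⟦X⟧} (hf : HasGeomBound f) (hh : HasGeomBound h) :
    ∀ᶠ a in 𝓝 (0 : K), ev (f - h) a = ev f a - ev h a := by
  filter_upwards [hf.eventually_summable_norm, hh.eventually_summable_norm] with a h1 h2
  rw [ev, ev, ev, ← h1.of_norm.tsum_sub h2.of_norm]
  simp_rw [map_sub, sub_mul]

@[simp] theorem ev_C (c a : K) : ev (C c) a = c := by
  rw [ev, tsum_eq_single 0 fun n hn => by rw [coeff_C, if_neg hn, zero_mul]]
  simp

@[simp] theorem ev_one (a : K) : ev (1 : K⟦X⟧) a = 1 := by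
  rw [← map_one (C (R := K)), ev_C]

@[simp] theorem ev_X (a : K) : ev (X : K⟦X⟧) a = a := by
  rw [ev, tsum_eq_single 1 fun n hn => by rw [coeff_X, if_neg hn, zero_mul]]
  simp

theorem ev_zero_right (f : K⟦X⟧) : ev f 0 = coeff 0 f := by
  rw [ev, tsum_eq_single 0 fun n hn => by rw [zero_pow hn, mul_zero]]
  simp

theorem ev_rescale (c : K) (f : K⟦X⟧) (a : K) : ev (rescale c f) a = ev f (c * a) :=
  tsum_congr fun n => by rw [coeff_rescale, mul_pow]; ring

theorem HasGeomBound.rescale {f : K⟦X⟧} (hf : HasGeomBound f) (c : K) :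
    HasGeomBound (PowerSeries.rescale c f) := by
  obtain ⟨r, hr1, -, hr⟩ := hf.exists_one_le 0
  refine ⟨r * max 1 ‖c‖, fun n => ?_⟩
  rw [coeff_rescale, norm_mul, norm_pow, mul_pow, mul_comm]
  have h1 : ‖c‖ ^ n ≤ max 1 ‖c‖ ^ (n + 1) := by
    calc ‖c‖ ^ n ≤ max 1 ‖c‖ ^ n := by gcongr; simp
      _ ≤ _ := pow_le_pow_right₀ (by simp) n.le_succ
  exact mul_le_mul (hr n) h1 (by positivity) (by positivity)

theorem HasGeomBound.hasFPowerSeriesAt_ev {f : K⟦X⟧} (hf : HasGeomBound f) :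
    HasFPowerSeriesAt (ev f) (FormalMultilinearSeries.ofScalars K fun n => coeff n f) 0 := by
  rw [hasFPowerSeriesAt_iff]
  filter_upwards [hf.eventually_summable_norm] with a h
  rw [zero_add]
  refine h.of_norm.hasSum.congr_fun fun n => ?_
  rw [FormalMultilinearSeries.coeff_ofScalars, smul_eq_mul, mul_comm]

theorem HasGeomBound.ext_of_frequently {f h : K⟦X⟧} (hf : HasGeomBound f) (hh : HasGeomBound h)
    (e : ∃ᶠ a in 𝓝[≠] (0 : K), ev f a = ev h a) : f = h := by
  have e1 := (hf.hasFPowerSeriesAt_ev.analyticAt.frequently_eq_iff_eventually_eq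
    hh.hasFPowerSeriesAt_ev.analyticAt).1 e
  have e2 := (hf.hasFPowerSeriesAt_ev.congr e1).eq_formalMultilinearSeries
    hh.hasFPowerSeriesAt_ev
  ext n
  have := congrArg (fun p => p.coeff n) e2
  simpa only [FormalMultilinearSeries.coeff_ofScalars] using this

theorem HasGeomBound.ext {f h : K⟦X⟧} (hf : HasGeomBound f) (hh : HasGeomBound h)
    (e : ∀ᶠ a in 𝓝[≠] (0 : K), ev f a = ev h a) : f = h :=
  hf.ext_of_frequently hh e.frequently

end Eval

/-! ### Eigenvectors, derivatives along lines -/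
section Lines
variable {K : Type} [RCLike K] {g : Type*} [LieRing g] [LieAlgebra K g]
  [TopologicalSpace g] [IsTopologicalAddGroup g] [ContinuousSMul K g] [T2Space g]
  [FiniteDimensional K g]
open Filter

theorem hasSum_adSeries_eigenvector {f : K⟦X⟧} {X w : g} {a : K} (hw : ⁅X, w⁆ = a • w)
    (h : Summable fun n => PowerSeries.coeff n f •
      (LinearMap.toContinuousLinearMap (LieAlgebra.ad K g X : g →ₗ[K] g)) ^ n) :
    HasSum (fun n => (PowerSeries.coeff n f * a ^ n) • w) (adSeries f X w) := by
  refine (h.hasSum.map (LinearMap.applyₗ w ∘ₗ ContinuousLinearMap.coeLM K (M := g) (N₃ := g))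
    (continuous_eval_const w)).congr_fun fun n => ?_
  have key : ∀ n : ℕ, ((LinearMap.toContinuousLinearMap
      (LieAlgebra.ad K g X : g →ₗ[K] g)) ^ n) w = a ^ n • w := by
    intro n
    induction n with
    | zero => simp
    | succ n ih =>
      rw [pow_succ', mul_apply_eq_comp, ih, map_smul, pow_succ, mul_smul]
      change a ^ n • ⁅X, w⁆ = _
      rw [hw]
  change _ = PowerSeries.coeff n f • ((LinearMap.toContinuousLinearMap
      (LieAlgebra.ad K g X : g →ₗ[K] g)) ^ n) w
  rw [key, smul_smul]

theorem exists_hasSum_of_hasSum_smul {ι : Type*} {c : ι → K} {w x : g} (hw : w ≠ 0)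
    (h : HasSum (fun n => c n • w) x) : ∃ s, HasSum c s ∧ x = s • w := by
  obtain ⟨l, hl⟩ : ∃ l : Module.Dual K g, l w ≠ 0 := by
    by_contra! hc
    exact hw ((Module.forall_dual_apply_eq_zero_iff K w).1 hc)
  have h1 := (h.map l l.continuous_of_finiteDimensional).mul_right (l w)⁻¹
  have h2 : HasSum c (l x * (l w)⁻¹) := by
    refine h1.congr_fun fun n => ?_
    simp [hl]
  exact ⟨_, h2, h.unique (h2.smul_const w)⟩

/-- `f(ad X)` acts on an eigenvector of `ad X` through the value of `f` at the eigenvalue. -/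
theorem adSeries_eigenvector {f : K⟦X⟧} {X w : g} {a : K} (hw : ⁅X, w⁆ = a • w)
    (h : Summable fun n => PowerSeries.coeff n f •
      (LinearMap.toContinuousLinearMap (LieAlgebra.ad K g X : g →ₗ[K] g)) ^ n) :
    adSeries f X w = ev f a • w := by
  by_cases h0 : w = 0
  · simp [h0]
  · obtain ⟨s, hs, e⟩ := exists_hasSum_of_hasSum_smul h0 (hasSum_adSeries_eigenvector hw h)
    rw [e, ev, hs.tsum_eq]

/-- A derivative is determined in a direction by the values of the function on a line. -/
theorem hasFDerivAt_apply_eq_of_line {f : g → g} {L : g →L[K] g} {X E base w : g}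
    (hf : HasFDerivAt f L X) (h : ∀ᶠ u in 𝓝 (0 : K), f (X + u • E) = base + u • w) :
    L E = w := by
  obtain ⟨e, he⟩ := exists_equiv_norm_lie_le K g
  let _ := normedLieRingOfEquiv e he
  let _ := normedLieAlgebraOfEquiv e he
  have h1 : HasDerivAt (fun u : K => f (X + u • E)) (L E) 0 := by
    have h2 : HasDerivAt (fun u : K => X + u • E) E 0 := by
      simpa using ((hasDerivAt_id (0 : K)).smul_const E).const_add X
    have hf' : HasFDerivAt f L (X + (0 : K) • E) := by simpa using hf
    exact hf'.comp_hasDerivAt (0 : K) h2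
  have h3 : HasDerivAt (fun u : K => base + u • w) w 0 := by
    simpa using ((hasDerivAt_id (0 : K)).smul_const w).const_add base
  exact h1.unique (h3.congr_of_eventuallyEq h)

theorem hasFDerivAt_unique {f : g → g} {L L' : g →L[K] g} {X : g}
    (h : HasFDerivAt f L X) (h' : HasFDerivAt f L' X) : L = L' := by
  obtain ⟨e, he⟩ := exists_equiv_norm_lie_le K g
  let _ := normedLieRingOfEquiv e he
  let _ := normedLieAlgebraOfEquiv e he
  exact _root_.HasFDerivAt.unique h h'

theorem AnalyticOnPair.differentiableAt {F : g → g → g} {U : Set (g × g)}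
    (hF : AnalyticOnPair K F U) {X Y : g} (h : (X, Y) ∈ U) :
    DifferentiableAt K (fun X' => F X' Y) X ∧ DifferentiableAt K (fun Y' => F X Y') Y := by
  obtain ⟨e, he⟩ := exists_equiv_norm_lie_le K g
  let _ := normedLieRingOfEquiv e he
  let _ := normedLieAlgebraOfEquiv e he
  set b : g ≃L[K] (Fin (Module.finrank K g) → K) :=
    (Module.finBasis K g).equivFun.toContinuousLinearEquiv with hb
  have h1 : DifferentiableAt K (fun p : (Fin (Module.finrank K g) → K) ×
      (Fin (Module.finrank K g) → K) => b (F (b.symm p.1) (b.symm p.2))) (b X, b Y) :=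
    (hF (b X, b Y) (by
      change (b.symm (b X), b.symm (b Y)) ∈ U
      simpa using h)).differentiableAt
  have h2 : DifferentiableAt K (fun q : g × g => F q.1 q.2) (X, Y) := by
    have h3 : DifferentiableAt K (fun q : g × g => (b q.1, b q.2)) (X, Y) := by fun_prop
    have h4 := b.symm.differentiableAt.comp (X, Y)
      (DifferentiableAt.comp (g := fun p : (Fin (Module.finrank K g) → K) ×
      (Fin (Module.finrank K g) → K) => b (F (b.symm p.1) (b.symm p.2))) (X, Y) h1 h3)
    simpa [Function.comp_def] using h4
  constructor
  · exact DifferentiableAt.comp (g := fun q : g × g => F q.1 q.2) (f := fun X' => (X', Y)) X h2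
      (by fun_prop)
  · exact DifferentiableAt.comp (g := fun q : g × g => F q.1 q.2) (f := fun Y' => (X, Y')) Y h2
      (by fun_prop)

end Lines

/-! ### Lie series on the span of `D` and `E` with `[D, E] = E` -/
section AffineWords
variable {K : Type} [RCLike K]
open Filter

/-- For `X = a D + u E` and `Y = b D + v E` with `[D, E] = E`, every word in `o(Y)` is a multiple
of `(a v - u b) E`; this is the remaining scalar factor. -/
def wordScalar (a b : K) : List ℕ → K
  | [] => 0
  | [j] => if j = 0 then 0 else a ^ (j - 1)
  | j :: i :: l => (if j = 0 then b else 0) * wordScalar a b (i :: l)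

section Word
variable {g : Type*} [LieRing g] [LieAlgebra K g] {D E : g} (hDE : ⁅D, E⁆ = E) (a b u v : K)
include hDE

theorem lie_affine_E : ⁅a • D + u • E, E⁆ = a • E := by
  simp [hDE]

theorem lie_affine : ⁅a • D + u • E, b • D + v • E⁆ = (a * v - u * b) • E := by
  have h : ⁅E, D⁆ = -E := by rw [← lie_skew, hDE]
  simp only [lie_add, add_lie, lie_smul, smul_lie, lie_self, hDE, h]
  module

theorem ad_pow_succ_affine (n : ℕ) :
    ((LieAlgebra.ad K g (a • D + u • E)) ^ (n + 1)) (b • D + v • E) =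
      (a ^ n * (a * v - u * b)) • E := by
  induction n with
  | zero => rw [zero_add, pow_one, LieAlgebra.ad_apply, lie_affine hDE, pow_zero, one_mul]
  | succ n ih =>
    rw [pow_succ', Module.End.mul_apply, ih, LieAlgebra.ad_apply, lie_smul, lie_affine_E hDE,
      smul_smul]
    ring_nf

theorem word_affine : ∀ l : List ℕ, Admissible l →
    word K (a • D + u • E) (b • D + v • E) l = ((a * v - u * b) * wordScalar a b l) • E
  | [], h => h.elim
  | [_], h => h.elim
  | [0, j + 1], _ => by
    rw [word, word, ad_pow_succ_affine hDE]
    simp only [pow_zero, Module.End.one_apply, lie_smul, lie_affine_E hDE, wordScalar, smul_smul]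
    simp
    ring_nf
  | [i + 1, j + 1], _ => by
    rw [word, word, ad_pow_succ_affine hDE, ad_pow_succ_affine hDE]
    simp [wordScalar]
  | 0 :: i :: j :: l, h => by
    rw [word, word_affine (i :: j :: l) h]
    simp only [pow_zero, Module.End.one_apply, lie_smul, lie_affine_E hDE, wordScalar, smul_smul]
    simp
    ring_nf
  | (k + 1) :: i :: j :: l, h => by
    rw [word, word_affine (i :: j :: l) h, ad_pow_succ_affine hDE, smul_lie, lie_smul, lie_self,
      smul_zero, smul_zero, wordScalar, if_neg k.succ_ne_zero, zero_mul, mul_zero, zero_smul]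

end Word

theorem wordScalar_zero_right (a : K) : ∀ l : List ℕ, Admissible l → wordScalar a 0 l = 0
  | [], h => h.elim
  | [_], h => h.elim
  | _ :: _ :: _, _ => by simp [wordScalar]

theorem wordScalar_smul (τ a b : K) : ∀ l : List ℕ, Admissible l →
    τ ^ 2 * wordScalar (τ * a) (τ * b) l = τ ^ (l.map (· + 1)).sum * wordScalar a b l
  | [], h => h.elim
  | [_], h => h.elim
  | [0, j + 1], _ => by simp [wordScalar]; ring
  | [i + 1, j + 1], _ => by simp [wordScalar]
  | 0 :: i :: j :: l, h => by
    have := wordScalar_smul τ a b (i :: j :: l) h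
    have e : ∀ a b : K, wordScalar a b (0 :: i :: j :: l) = b * wordScalar a b (i :: j :: l) :=
      fun a b => by rw [wordScalar, if_pos rfl]
    rw [e, e, List.map_cons, List.sum_cons, pow_add]
    linear_combination (τ * b) * this
  | (k + 1) :: i :: j :: l, h => by simp [wordScalar]

theorem differentiable_wordScalar (a : K) : ∀ l : List ℕ,
    Differentiable K fun b => wordScalar a b l
  | [] => by simp [wordScalar]
  | [j] => by simp [wordScalar]
  | j :: i :: l => by
    have := differentiable_wordScalar a (i :: l)
    simp only [wordScalar]
    split_ifs <;> fun_prop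

namespace LieSeries

/-- The contribution of `o(Y)` in degree `n + 2`, on the span of `D` and `E`. -/
def remScalar (S : LieSeries K) (a b : K) (n : ℕ) : K :=
  ∑ c : Composition (n + 2), S.rem (c.blocks.map fun b => b - 1) *
    wordScalar a b (c.blocks.map fun b => b - 1)

theorem remScalar_zero_right (S : LieSeries K) (a : K) (n : ℕ) : S.remScalar a 0 n = 0 := by
  refine Finset.sum_eq_zero fun c _ => ?_
  by_cases h : S.rem (c.blocks.map fun b => b - 1) = 0
  · rw [h, zero_mul]
  · rw [wordScalar_zero_right _ _ (S.rem_admissible _ h), mul_zero]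

theorem differentiable_remScalar (S : LieSeries K) (a : K) (n : ℕ) :
    Differentiable K fun b => S.remScalar a b n :=
  Differentiable.fun_sum fun _ _ => (differentiable_wordScalar a _).const_mul _

theorem _root_.KashiwaraVergne.sum_map_pred_map_succ {n : ℕ} (c : Composition n) :
    ((c.blocks.map fun b => b - 1).map (· + 1)).sum = n := by
  rw [List.map_map]
  conv_rhs => rw [← c.blocks_sum, ← List.map_id c.blocks]
  congr 1
  refine List.map_congr_left fun b hb => ?_
  have := c.blocks_pos hb
  simp only [Function.comp, id]
  omega

theorem remScalar_smul (S : LieSeries K) {τ : K} (hτ : τ ≠ 0) (a b : K) (n : ℕ) :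
    S.remScalar (τ * a) (τ * b) n = τ ^ n * S.remScalar a b n := by
  rw [remScalar, remScalar, Finset.mul_sum]
  refine Finset.sum_congr rfl fun c _ => ?_
  by_cases h : S.rem (c.blocks.map fun b => b - 1) = 0
  · simp [h]
  · have h1 := wordScalar_smul τ a b _ (S.rem_admissible _ h)
    rw [sum_map_pred_map_succ, pow_add] at h1
    have h2 : wordScalar (τ * a) (τ * b) (c.blocks.map fun b => b - 1) =
        τ ^ n * wordScalar a b (c.blocks.map fun b => b - 1) := by
      refine mul_left_cancel₀ (pow_ne_zero 2 hτ) ?_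
      linear_combination h1
    rw [h2]; ring

theorem rem_eq_zero_of_lt_two (S : LieSeries K) {n : ℕ} (hn : n < 2) (c : Composition n) :
    S.rem (c.blocks.map fun b => b - 1) = 0 := by
  by_contra h
  have h1 := S.rem_admissible _ h
  have h2 : (c.blocks.map fun b => b - 1).length ≤ n := by
    rw [List.length_map]
    exact c.length_le
  match h3 : (c.blocks.map fun b => b - 1), h1, h2 with
  | [], h1, _ => exact h1
  | [_], h1, _ => exact h1
  | _ :: _ :: _, _, h2 => simp at h2; omega

/-- The scalar `(a v - u b)⁻¹` times the coefficient of `E` in degree `n + 2`. -/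
def affineCoeff (S : LieSeries K) (a b : K) (n : ℕ) : K :=
  PowerSeries.coeff (n + 1) S.fst * a ^ n + S.remScalar a b n

theorem affineCoeff_smul (S : LieSeries K) {τ : K} (hτ : τ ≠ 0) (a b : K) (n : ℕ) :
    S.affineCoeff (τ * a) (τ * b) n = S.affineCoeff a b n * τ ^ n := by
  rw [affineCoeff, affineCoeff, remScalar_smul S hτ]; ring

theorem affineCoeff_zero_right (S : LieSeries K) (a : K) (n : ℕ) :
    S.affineCoeff a 0 n = PowerSeries.coeff (n + 1) S.fst * a ^ n := by
  rw [affineCoeff, remScalar_zero_right, add_zero]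

section Term
variable {g : Type*} [LieRing g] [LieAlgebra K g]

theorem term_zero (S : LieSeries K) (X Y : g) : S.term X Y 0 = 0 := by
  simp [term, S.rem_eq_zero_of_lt_two two_pos]

theorem term_one (S : LieSeries K) (X Y : g) :
    S.term X Y 1 = S.lin • X + PowerSeries.coeff 0 S.fst • Y := by
  simp [term, S.rem_eq_zero_of_lt_two one_lt_two]

theorem term_add_two (S : LieSeries K) {D E : g} (hDE : ⁅D, E⁆ = E) (a b u v : K) (n : ℕ) :
    S.term (a • D + u • E) (b • D + v • E) (n + 2) =
      ((a * v - u * b) * S.affineCoeff a b n) • E := by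
  have h : ∀ c : Composition (n + 2), S.rem (c.blocks.map fun b => b - 1) •
      word K (a • D + u • E) (b • D + v • E) (c.blocks.map fun b => b - 1) =
      ((a * v - u * b) * (S.rem (c.blocks.map fun b => b - 1) *
        wordScalar a b (c.blocks.map fun b => b - 1))) • E := fun c => by
    by_cases h : S.rem (c.blocks.map fun b => b - 1) = 0
    · simp [h]
    · rw [word_affine hDE _ _ _ _ _ (S.rem_admissible _ h), smul_smul]
      congr 1; ring
  rw [term, Finset.sum_congr rfl fun c _ => h c, ← Finset.sum_smul, ← Finset.mul_sum]
  simp only [if_false, Nat.add_succ_sub_one, show 1 ≤ n + 2 by omega, if_true,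
      show n + 2 ≠ 1 by omega]
  rw [ad_pow_succ_affine hDE, affineCoeff, remScalar]
  module

end Term

section Eval
variable {g : Type*} [LieRing g] [LieAlgebra K g]
  [TopologicalSpace g] [IsTopologicalAddGroup g] [ContinuousSMul K g] [T2Space g]
  [FiniteDimensional K g] {D E : g} (hE : E ≠ 0) (hDE : ⁅D, E⁆ = E)
include hE hDE

theorem summable_affineCoeff (S : LieSeries K) {a b u v : K}
    (h : Summable (S.term (a • D + u • E) (b • D + v • E))) (hδ : a * v - u * b ≠ 0) :
    Summable (S.affineCoeff a b) := by
  have h2 := ((summable_nat_add_iff 2).2 h).hasSum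
  simp_rw [term_add_two S hDE] at h2
  obtain ⟨s, hs, -⟩ := exists_hasSum_of_hasSum_smul hE h2
  exact (summable_mul_left_iff hδ).1 hs.summable

theorem eval_affine (S : LieSeries K) {a b u v : K}
    (h : Summable (S.term (a • D + u • E) (b • D + v • E))) :
    S.eval (a • D + u • E) (b • D + v • E) =
      S.lin • (a • D + u • E) + PowerSeries.coeff 0 S.fst • (b • D + v • E) +
        ((a * v - u * b) * ∑' n, S.affineCoeff a b n) • E := by
  rw [eval, ← h.sum_add_tsum_nat_add 2]
  simp only [Finset.sum_range_succ, Finset.sum_range_zero, term_zero, term_one, zero_add]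
  congr 1
  have h2 := ((summable_nat_add_iff 2).2 h).hasSum
  simp_rw [term_add_two S hDE] at h2 ⊢
  obtain ⟨s, hs, e⟩ := exists_hasSum_of_hasSum_smul hE h2
  rw [e, ← hs.tsum_eq, tsum_mul_left]

theorem summable_fst (S : LieSeries K) {a v : K} (hv : v ≠ 0) (ha : a ≠ 0)
    (h : Summable (S.term (a • D + (0 : K) • E) ((0 : K) • D + v • E))) :
    Summable fun n => PowerSeries.coeff n S.fst * a ^ n := by
  have h0 := (summable_affineCoeff hE hDE S h (by simpa using ⟨ha, hv⟩)).mul_right a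
  refine (summable_nat_add_iff 1).1 (h0.congr fun n => ?_)
  rw [affineCoeff_zero_right]
  ring

/-- The value of a Lie series at `X = a D`, `Y = v E`. -/
theorem eval_smul_smul (S : LieSeries K) {a v : K} (hv : v ≠ 0)
    (h : Summable (S.term (a • D + (0 : K) • E) ((0 : K) • D + v • E))) :
    S.eval (a • D + (0 : K) • E) ((0 : K) • D + v • E) =
      (S.lin * a) • D + (v * ev S.fst a) • E := by
  rw [eval_affine hE hDE S h]
  by_cases ha : a = 0
  · simp [ha, ev_zero_right, mul_comm v, mul_smul]
  · have h2 : ev S.fst a = PowerSeries.coeff 0 S.fst + a * ∑' n, S.affineCoeff a 0 n := by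
      rw [ev, (summable_fst hE hDE S hv ha h).tsum_eq_zero_add, pow_zero, mul_one, ← tsum_mul_left]
      congr 1
      refine tsum_congr fun n => ?_
      rw [affineCoeff_zero_right]
      ring
    rw [h2]
    module

theorem hasGeomBound_fst (S : LieSeries K) {a v : K} (hv : v ≠ 0) (ha : a ≠ 0)
    (h : Summable (S.term (a • D + (0 : K) • E) ((0 : K) • D + v • E))) :
    HasGeomBound S.fst :=
  HasGeomBound.of_summable ha (summable_fst hE hDE S hv ha h)

end Eval
end LieSeries
end AffineWords

/-! ### The Kashiwara-Vergne equations on the affine Lie algebra of the line -/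
section AffineEquations
variable {K : Type} [RCLike K]
open Filter

section General
variable {g : Type*} [LieRing g] [LieAlgebra K g]

theorem bchTerm_add_two_of_lie_eq_zero {P Q : g} (h : ⁅P, Q⁆ = 0) (n : ℕ) :
    bchTerm K P Q (n + 2) = 0 := by
  have h' : ⁅Q, P⁆ = 0 := by rw [← lie_skew, h, neg_zero]
  have key : ∀ (w : List Bool) (i j : Bool), brWord P Q (i :: j :: w) = 0 := by
    intro w
    induction w with
    | nil => intro i j; cases i <;> cases j <;> simp [brWord, h, h']
    | cons k w ih => intro i j; rw [brWord_cons _ _ _ (by simp), ih, lie_zero]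
  have := eq_on_logExpExp (rightNormedₗ (K := K) P Q) 0 (n + 2) fun w hw => by
    rw [rightNormedₗ_apply, rightNormed_wordProd]
    match w, hw with
    | i :: j :: w, _ => simpa using key w i j
  rw [bchTerm, ← rightNormedₗ_apply, this, LinearMap.zero_apply, smul_zero]

theorem bch_of_lie_eq_zero [TopologicalSpace g] {P Q : g} (h : ⁅P, Q⁆ = 0) :
    bch K P Q = P + Q := by
  rw [bch, tsum_eq_single 1, bchTerm_one]
  intro n hn
  match n with
  | 0 => exact bchTerm_zero P Q
  | 1 => exact absurd rfl hn
  | n + 2 => exact bchTerm_add_two_of_lie_eq_zero h n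

variable [TopologicalSpace g] [IsTopologicalAddGroup g] [ContinuousSMul K g] [T2Space g]
  [FiniteDimensional K g]

theorem adSeries_of_lie_lie_eq_zero {f : K⟦X⟧} {Y w : g} (hw : ⁅Y, ⁅Y, w⁆⁆ = 0)
    (h : Summable fun n => PowerSeries.coeff n f •
      (LinearMap.toContinuousLinearMap (LieAlgebra.ad K g Y : g →ₗ[K] g)) ^ n) :
    adSeries f Y w = PowerSeries.coeff 0 f • w + PowerSeries.coeff 1 f • ⁅Y, w⁆ := by
  have h1 := h.hasSum.map (LinearMap.applyₗ w ∘ₗ ContinuousLinearMap.coeLM K (M := g) (N₃ := g))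
    (continuous_eval_const w)
  have h2 : HasSum (fun n => PowerSeries.coeff n f •
      ((LinearMap.toContinuousLinearMap (LieAlgebra.ad K g Y : g →ₗ[K] g)) ^ n) w)
      (∑ n ∈ Finset.range 2, PowerSeries.coeff n f •
      ((LinearMap.toContinuousLinearMap (LieAlgebra.ad K g Y : g →ₗ[K] g)) ^ n) w) := by
    refine hasSum_sum_of_ne_finset_zero fun n hn => ?_
    obtain ⟨m, rfl⟩ : ∃ m, n = m + 2 := ⟨n - 2, by
      have := Finset.mem_range.not.1 hn
      omega⟩
    rw [pow_add, pow_two, mul_apply_eq_comp, mul_apply_eq_comp]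
    change PowerSeries.coeff (m + 2) f • ((LinearMap.toContinuousLinearMap
      (LieAlgebra.ad K g Y : g →ₗ[K] g)) ^ m) ⁅Y, ⁅Y, w⁆⁆ = 0
    rw [hw, map_zero, smul_zero]
  refine (h1.unique h2).trans ?_
  rw [Finset.sum_range_succ, Finset.sum_range_one]
  simp

omit [T2Space g] [FiniteDimensional K g] in
theorem eventually_affine {p : g × g → Prop} (h : ∀ᶠ x in 𝓝 ((0 : g), (0 : g)), p x) (D E : g) :
    ∀ᶠ q : (K × K) × (K × K) in 𝓝 0, p (q.1.1 • D + q.1.2 • E, q.2.1 • D + q.2.2 • E) := by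
  have hc : Continuous fun q : (K × K) × (K × K) =>
      (q.1.1 • D + q.1.2 • E, q.2.1 • D + q.2.2 • E) := by fun_prop
  have := hc.tendsto 0
  simp only [Prod.fst_zero, Prod.snd_zero, zero_smul, add_zero] at this
  exact this.eventually h

end General

namespace Aff

@[simp] theorem sub_fst (x y : Aff K) : (x - y).1 = x.1 - y.1 := rfl
@[simp] theorem sub_snd (x y : Aff K) : (x - y).2 = x.2 - y.2 := rfl

theorem E_ne_zero : E K ≠ 0 := fun h => by
  have := congrArg (fun x : Aff K => x.2) h
  simp at this

theorem brWord_smul (a v : K) : ∀ (w : List Bool) (i : Bool),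
    (brWord (v • E K) (a • D K) (i :: w)).1 =
        a ^ (w.length + 1) * (brWord (E K) (D K) (i :: w)).1 ∧
      (brWord (v • E K) (a • D K) (i :: w)).2 =
        v * a ^ w.length * (brWord (E K) (D K) (i :: w)).2
  | [], i => by cases i <;> simp [brWord]
  | j :: w, i => by
    obtain ⟨h1, h2⟩ := brWord_smul a v w j
    rw [brWord_cons (v • E K) (a • D K) i (List.cons_ne_nil j w),
      brWord_cons (E K) (D K) i (List.cons_ne_nil j w)]
    refine ⟨by rw [lie_fst, lie_fst, mul_zero], ?_⟩
    rw [lie_snd, lie_snd, h1, h2, List.length_cons]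
    cases i <;> simp <;> ring

theorem bchTerm_smul (a v : K) (n : ℕ) :
    bchTerm K (v • E K) (a • D K) (n + 2) =
      (v * (PowerSeries.coeff (n + 1) (phi1 K) * a ^ (n + 1))) • E K := by
  have h1 := eq_on_logExpExp (rightNormedₗ (K := K) (v • E K) (a • D K))
    (((v * a ^ (n + 1)) • kappa K).smulRight (E K)) (n + 2) fun w hw => by
      match w, hw with
      | i :: j :: w, hw =>
        obtain ⟨-, h2⟩ := brWord_smul a v (j :: w) i
        have hl : (j :: w).length = n + 1 := by simpa using hw
        rw [hl] at h2
        rw [rightNormedₗ_apply, rightNormed_wordProd, LinearMap.smulRight_apply,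
          LinearMap.smul_apply, kappa_wordProd]
        refine Aff.ext ?_ ?_
        · rw [brWord_cons _ _ _ (by simp)]
          simp
        · rw [h2]; simp
  rw [bchTerm, ← rightNormedₗ_apply, h1, LinearMap.smulRight_apply, LinearMap.smul_apply, smul_smul]
  congr 1
  rw [smul_eq_mul, mul_left_comm, inv_mul_kappa_logExpExp]
  ring

/-- The Campbell-Hausdorff series at `(v E, a D)`. -/
theorem eventually_bch : ∀ᶠ a in 𝓝 (0 : K), ∀ v : K,
    bch K (v • E K) (a • D K) = a • D K + (v * ev (phi1 K) a) • E K := by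
  filter_upwards [(HasGeomBound.phi1 (K := K)).eventually_summable_norm] with a ha v
  have h1 := ((hasSum_nat_add_iff' 1).2 ha.of_norm.hasSum).mul_left v
  have h2 := h1.smul_const (E K)
  have h3 : HasSum (fun n => bchTerm K (v • E K) (a • D K) (n + 2))
      ((v * (ev (phi1 K) a - 1)) • E K) := by
    simp_rw [bchTerm_smul]
    simpa [coeff_phi1_zero, ev, -PowerSeries.coeff_zero_eq_constantCoeff] using h2
  have h4 := (hasSum_nat_add_iff 2).1 h3
  rw [bch, h4.tsum_eq, Finset.sum_range_succ, Finset.sum_range_one, bchTerm_zero, bchTerm_one]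
  module

theorem trace_eq (L : Aff K →ₗ[K] Aff K) :
    LinearMap.trace K (Aff K) L = (L (D K)).1 + (L (E K)).2 := by
  let b : Module.Basis (Fin 2) K (Aff K) := Module.Basis.finTwoProd K
  have h0 : b 0 = D K := Module.Basis.finTwoProd_zero K
  have h1 : b 1 = E K := Module.Basis.finTwoProd_one K
  rw [LinearMap.trace_eq_matrix_trace K b, Matrix.trace_fin_two, LinearMap.toMatrix_apply,
    LinearMap.toMatrix_apply, h0, h1]
  rfl

/-- The trace of `f(ad (a D))`. -/
theorem eventually_trace_adSeries {f : K⟦X⟧} (hf : HasGeomBound f) : ∀ᶠ a in 𝓝 (0 : K),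
    (adSeries f (a • D K) (D K)).1 + (adSeries f (a • D K) (E K)).2 =
      PowerSeries.coeff 0 f + ev f a := by
  have h1 : Tendsto (fun a : K => a • D K) (𝓝 0) (𝓝 0) := by
    have : Continuous fun a : K => a • D K := by fun_prop
    simpa using this.tendsto 0
  filter_upwards [h1.eventually (eventually_summable_adSeries hf)] with a ha
  rw [adSeries_eigenvector (a := 0) (w := D K) (by simp) ha,
    adSeries_eigenvector (a := a) (w := E K) (by simp [lie_D_E]) ha, ev_zero_right]
  simp

end Aff

variable {A B : LieSeries K}

/-- The first Kashiwara-Vergne equation at `X = a D`, `Y = v E` reads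
`φ₁(a) - 1 = (1 - e^{-a}) A(a) - α a`. -/
theorem IsUniversalSolution.fst_left (h : IsUniversalSolution A B) :
    HasGeomBound A.fst ∧ A.fst = betaAlpha B.lin := by
  obtain ⟨hs, U, hU, h0, -, -, -, -, hkv⟩ := h (Aff K)
  have hX : ∀ᶠ x in 𝓝 ((0 : Aff K), (0 : Aff K)), Summable fun n =>
      PowerSeries.coeff n (neg (PowerSeries.exp K)) •
      (LinearMap.toContinuousLinearMap (LieAlgebra.ad K (Aff K) x.1 : Aff K →ₗ[K] Aff K)) ^ n :=
    (continuous_fst.tendsto ((0 : Aff K), (0 : Aff K))).eventually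
      (eventually_summable_adSeries (g := Aff K) (HasGeomBound.exp (K := K)).neg')
  have hY : ∀ᶠ x in 𝓝 ((0 : Aff K), (0 : Aff K)), Summable fun n =>
      PowerSeries.coeff n (PowerSeries.exp K) •
      (LinearMap.toContinuousLinearMap (LieAlgebra.ad K (Aff K) x.2 : Aff K →ₗ[K] Aff K)) ^ n :=
    (continuous_snd.tendsto ((0 : Aff K), (0 : Aff K))).eventually
      (eventually_summable_adSeries (g := Aff K) (HasGeomBound.exp (K := K)))
  have hU' : ∀ᶠ x in 𝓝 ((0 : Aff K), (0 : Aff K)), x ∈ U := hU.mem_nhds h0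
  have h1 := eventually_affine (K := K) (hs.and (hU'.and (hX.and hY))) (Aff.D K) (Aff.E K)
  have hc : Continuous fun q : K × K => (((q.2, 0), (0, q.1)) : (K × K) × (K × K)) := by fun_prop
  have h2 := (hc.tendsto (0, 0)).eventually h1
  rw [nhds_prod_eq] at h2
  obtain ⟨v, hv, hv0⟩ := ((h2.curry.filter_mono nhdsWithin_le_nhds).and
    (self_mem_nhdsWithin : ∀ᶠ v in 𝓝[≠] (0 : K), v ∈ ({0}ᶜ : Set K))).exists
  have hv0 : v ≠ 0 := hv0
  obtain ⟨a, ha, ha0⟩ := ((hv.filter_mono nhdsWithin_le_nhds).and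
    (self_mem_nhdsWithin : ∀ᶠ v in 𝓝[≠] (0 : K), v ∈ ({0}ᶜ : Set K))).exists
  have hA := LieSeries.hasGeomBound_fst Aff.E_ne_zero Aff.lie_D_E A hv0 ha0 ha.1.1
  refine ⟨hA, ?_⟩
  have he := (HasGeomBound.exp (K := K)).neg'
  have key : phi1 K - 1 =
      A.fst - neg (PowerSeries.exp K) * A.fst - PowerSeries.C B.lin * PowerSeries.X := by
    have b1 := he.mul hA
    have b2 := (HasGeomBound.C B.lin).mul HasGeomBound.X
    refine (HasGeomBound.phi1.sub .one).ext ((hA.sub b1).sub b2) ?_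
    refine Eventually.filter_mono nhdsWithin_le_nhds ?_
    filter_upwards [hv, Aff.eventually_bch (K := K), HasGeomBound.phi1.eventually_ev_sub .one,
      (hA.sub b1).eventually_ev_sub b2, hA.eventually_ev_sub b1, he.eventually_ev_mul hA,
      (HasGeomBound.C B.lin).eventually_ev_mul HasGeomBound.X]
      with a ⟨⟨s1, s2⟩, hU, s3, s4⟩ e1 e2 e3 e4 e5 e6
    rw [e2, e3, e4, e5, e6, ev_one, ev_C, ev_X]
    have hk := (hkv _ _ hU).1
    dsimp only at hk s3 s4
    rw [LieSeries.eval_smul_smul Aff.E_ne_zero Aff.lie_D_E A hv0 s1,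
      LieSeries.eval_smul_smul Aff.E_ne_zero Aff.lie_D_E B hv0 s2] at hk
    simp only [zero_smul, add_zero, zero_add] at hk s3 s4
    rw [e1, map_add, map_add, map_smul, map_smul, map_smul, map_smul,
      adSeries_eigenvector (a := 0) (w := Aff.D K) (by simp) s3,
      adSeries_eigenvector (a := a) (w := Aff.E K) (by simp [Aff.lie_D_E]) s3,
      adSeries_eigenvector (a := 0) (w := Aff.E K) (by simp) s4,
      adSeries_of_lie_lie_eq_zero (w := Aff.D K) (by ext <;> simp) s4] at hk
    have hk2 := congrArg (fun x : Aff K => x.2) hk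
    simp [ev_zero_right, PowerSeries.coeff_exp] at hk2
    refine mul_left_cancel₀ hv0 ?_
    linear_combination hk2
  have e1 := congrArg neg (phi1_mul_exp_sub_one K)
  simp only [neg_mul', neg_sub', neg_one', neg_X'] at e1
  refine mul_left_cancel₀ (PowerSeries.X_ne_zero (R := K)) ?_
  rw [X_mul_betaAlpha]
  linear_combination A.fst * e1 - neg (phi1 K) * key

end AffineEquations

/-! ### The trace equation on the affine Lie algebra of the line -/
section TraceEquation
variable {K : Type} [RCLike K] {A B : LieSeries K}
open Filter

theorem coeff_psi_zero : PowerSeries.coeff 0 (psi K) = 0 := by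
  rw [psi, PowerSeries.coeff_C_mul, map_sub, coeff_phi1_zero, PowerSeries.coeff_zero_one, sub_self,
    mul_zero]

theorem LieSeries.tsum_affineCoeff (S : LieSeries K) {τ : K} (hτ : τ ≠ 0) (b : K) :
    ∑' n, S.affineCoeff τ (τ * b) n = ev (PowerSeries.mk (S.affineCoeff 1 b)) τ := by
  refine tsum_congr fun n => ?_
  have := S.affineCoeff_smul hτ 1 b n
  rw [mul_one] at this
  rw [this, PowerSeries.coeff_mk]

theorem LieSeries.hasGeomBound_affineCoeff (S : LieSeries K) {τ : K} (hτ : τ ≠ 0) {b : K}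
    (h : Summable (S.affineCoeff τ (τ * b))) :
    HasGeomBound (PowerSeries.mk (S.affineCoeff 1 b)) := by
  refine HasGeomBound.of_summable hτ (h.congr fun n => ?_)
  have := S.affineCoeff_smul hτ 1 b n
  rw [mul_one] at this
  rw [this, PowerSeries.coeff_mk]

/-- The second Kashiwara-Vergne equation at `X = t D`, `Y = t b D`, as an identity of power series
in `t`.  Only the derivatives in the direction `E` contribute to the traces. -/
theorem IsUniversalSolution.trace_identity (h : IsUniversalSolution A B) {b : K} (hb : b ≠ 0) :
    PowerSeries.C (A.lin + b * PowerSeries.coeff 0 B.fst) * PowerSeries.X +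
      PowerSeries.C b * (PowerSeries.X * (PowerSeries.X *
        (PowerSeries.mk (B.affineCoeff 1 b) - PowerSeries.mk (A.affineCoeff 1 b)))) =
    psi K + PowerSeries.rescale b (psi K) - PowerSeries.rescale (1 + b) (psi K) := by
  obtain ⟨hs, U, hU, h0, hA, hB, -, -, hkv⟩ := h (Aff K)
  have hU' : ∀ᶠ x in 𝓝 ((0 : Aff K), (0 : Aff K)), x ∈ U := hU.mem_nhds h0
  have h1 := (eventually_affine (K := K) (hs.and hU') (Aff.D K) (Aff.E K)).eventually_nhds
  have hc : Continuous fun τ : K => (((τ, 0), (τ * b, 0)) : (K × K) × (K × K)) := by fun_prop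
  have hc0 : (((0, 0), (0 * b, 0)) : (K × K) × (K × K)) = 0 := by simp
  have h2 : ∀ᶠ τ in 𝓝[≠] (0 : K), _ :=
    ((hc.tendsto' 0 0 hc0).eventually h1).filter_mono nhdsWithin_le_nhds
  have hne : ∀ᶠ τ in 𝓝[≠] (0 : K), τ ≠ 0 := self_mem_nhdsWithin
  have hcu : ∀ τ : K, Continuous fun u : K => (((τ, u), (τ * b, 0)) : (K × K) × (K × K)) :=
    fun τ => by fun_prop
  have hcv : ∀ τ : K, Continuous fun u : K => (((τ, 0), (τ * b, u)) : (K × K) × (K × K)) :=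
    fun τ => by fun_prop
  -- convergence of the Lie series at one point with `[X, Y] ≠ 0` bounds their coefficients
  obtain ⟨bA, bB⟩ : HasGeomBound (PowerSeries.mk (A.affineCoeff 1 b)) ∧
      HasGeomBound (PowerSeries.mk (B.affineCoeff 1 b)) := by
    obtain ⟨τ, hτ, hτ0⟩ := (h2.and hne).exists
    obtain ⟨u, hu, hu0⟩ := ((((hcu τ).tendsto 0).eventually hτ).filter_mono
      nhdsWithin_le_nhds |>.and (self_mem_nhdsWithin : ∀ᶠ u in 𝓝[≠] (0 : K), u ≠ 0)).exists
    have hδ : τ * 0 - u * (τ * b) ≠ 0 := by simpa using ⟨hu0, hτ0, hb⟩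
    exact ⟨A.hasGeomBound_affineCoeff hτ0
        (LieSeries.summable_affineCoeff Aff.E_ne_zero Aff.lie_D_E A hu.1.1 hδ),
      B.hasGeomBound_affineCoeff hτ0
        (LieSeries.summable_affineCoeff Aff.E_ne_zero Aff.lie_D_E B hu.1.2 hδ)⟩
  have bX := HasGeomBound.X (K := K)
  have b1 := bB.sub bA
  have b2 := bX.mul b1
  have b3 := bX.mul b2
  have b4 := (HasGeomBound.C b).mul b3
  have b5 := (HasGeomBound.C (A.lin + b * PowerSeries.coeff 0 B.fst)).mul bX
  have bψ := HasGeomBound.psi (K := K)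
  have b6 := bψ.add (bψ.rescale b)
  refine (b5.add b4).ext (b6.sub (bψ.rescale (1 + b))) ?_
  have t1 := Aff.eventually_trace_adSeries bψ
  have tb : ∀ c : K, ∀ᶠ τ in 𝓝 (0 : K), (adSeries (psi K) ((τ * c) • Aff.D K) (Aff.D K)).1 +
      (adSeries (psi K) ((τ * c) • Aff.D K) (Aff.E K)).2 =
      PowerSeries.coeff 0 (psi K) + ev (psi K) (τ * c) := fun c => by
    have hc : Continuous fun τ : K => τ * c := by fun_prop
    exact (hc.tendsto' 0 0 (zero_mul c)).eventually t1
  have w : ∀ {p : K → Prop}, (∀ᶠ τ in 𝓝 0, p τ) → ∀ᶠ τ in 𝓝[≠] 0, p τ :=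
    fun h => h.filter_mono nhdsWithin_le_nhds
  filter_upwards [h2, hne, w t1, w (tb b), w (tb (1 + b)), w (b5.eventually_ev_add b4),
    w ((HasGeomBound.C (A.lin + b * PowerSeries.coeff 0 B.fst)).eventually_ev_mul bX),
    w ((HasGeomBound.C b).eventually_ev_mul b3), w (bX.eventually_ev_mul b2),
    w (bX.eventually_ev_mul b1), w (bB.eventually_ev_sub bA),
    w (b6.eventually_ev_sub (bψ.rescale (1 + b))), w (bψ.eventually_ev_add (bψ.rescale b))]
    with τ hτ hτ0 p1 p2 p3 e1 e2 e3 e4 e5 e6 e7 e8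
  rw [e1, e2, e3, e4, e5, e6, e7, e8, ev_C, ev_C, ev_X, ev_rescale, ev_rescale, mul_comm b τ,
    mul_comm (1 + b) τ]
  obtain ⟨-, hmem⟩ := hτ.self_of_nhds
  have hk := (hkv _ _ hmem).2
  have dA : fderiv K (fun X' : Aff K => A.eval X' ((τ * b) • Aff.D K + (0 : K) • Aff.E K))
      (τ • Aff.D K + (0 : K) • Aff.E K) (Aff.E K) =
      (A.lin - τ * b * ev (PowerSeries.mk (A.affineCoeff 1 b)) τ) • Aff.E K := by
    refine hasFDerivAt_apply_eq_of_line
      (base := A.lin • (τ • Aff.D K) + PowerSeries.coeff 0 A.fst • ((τ * b) • Aff.D K))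
      (AnalyticOnPair.differentiableAt hA hmem).1.hasFDerivAt ?_
    filter_upwards [((hcu τ).tendsto 0).eventually hτ] with u hu
    rw [add_assoc, ← add_smul, zero_add,
      LieSeries.eval_affine Aff.E_ne_zero Aff.lie_D_E A hu.1.1, A.tsum_affineCoeff hτ0]
    module
  have dB : fderiv K (fun Y' : Aff K => B.eval (τ • Aff.D K + (0 : K) • Aff.E K) Y')
      ((τ * b) • Aff.D K + (0 : K) • Aff.E K) (Aff.E K) =
      (PowerSeries.coeff 0 B.fst + τ * ev (PowerSeries.mk (B.affineCoeff 1 b)) τ) • Aff.E K := by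
    refine hasFDerivAt_apply_eq_of_line
      (base := B.lin • (τ • Aff.D K) + PowerSeries.coeff 0 B.fst • ((τ * b) • Aff.D K))
      (AnalyticOnPair.differentiableAt hB hmem).2.hasFDerivAt ?_
    filter_upwards [((hcv τ).tendsto 0).eventually hτ] with u hu
    rw [add_assoc, ← add_smul, zero_add,
      LieSeries.eval_affine Aff.E_ne_zero Aff.lie_D_E B hu.1.2, B.tsum_affineCoeff hτ0]
    module
  have hcomm : ⁅τ • Aff.D K + (0 : K) • Aff.E K, (τ * b) • Aff.D K + (0 : K) • Aff.E K⁆ = 0 := by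
    ext <;> simp
  have hsum : τ • Aff.D K + (0 : K) • Aff.E K + ((τ * b) • Aff.D K + (0 : K) • Aff.E K) =
      (τ * (1 + b)) • Aff.D K := by
    module
  rw [bch_of_lie_eq_zero hcomm, hsum, Aff.trace_eq, Aff.trace_eq] at hk
  simp only [LinearMap.add_apply, LinearMap.comp_apply, ContinuousLinearMap.coe_coe, dA, dB] at hk
  simp only [zero_smul, add_zero, LieAlgebra.ad_apply, add_apply,
    sub_apply, Aff.add_fst, Aff.add_snd, Aff.sub_fst, Aff.sub_snd, Aff.lie_fst,
    Aff.lie_snd, Aff.smul_fst, Aff.smul_snd, Aff.D_fst, Aff.D_snd, Aff.E_fst, Aff.E_snd] at hk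
  rw [coeff_psi_zero] at p1 p2 p3
  linear_combination hk + p1 + p2 - p3

theorem coeff_rescale_psi (c : K) (n : ℕ) :
    PowerSeries.coeff n (PowerSeries.rescale c (psi K)) = c ^ n * PowerSeries.coeff n (psi K) :=
  PowerSeries.coeff_rescale _ _ _

theorem IsUniversalSolution.coeff_zero_fst_right (h : IsUniversalSolution A B) :
    PowerSeries.coeff 0 B.fst = 0 := by
  have key : ∀ b : K, b ≠ 0 → A.lin + b * PowerSeries.coeff 0 B.fst = 0 := fun b hb => by
    have := congrArg (PowerSeries.coeff 1) (h.trace_identity hb)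
    rw [map_add, PowerSeries.coeff_C_mul, PowerSeries.coeff_one_X, PowerSeries.coeff_C_mul,
      PowerSeries.coeff_succ_X_mul, PowerSeries.coeff_zero_X_mul, map_sub, map_add,
      coeff_rescale_psi, coeff_rescale_psi] at this
    linear_combination this
  have h1 := key 1 one_ne_zero
  have h2 := key (-1) (neg_ne_zero.2 one_ne_zero)
  have h3 : (2 : K) ≠ 0 := two_ne_zero
  refine mul_left_cancel₀ h3 ?_
  linear_combination h1 - h2

/-- The trace equation expresses `B` through `A`, by comparing the terms linear in `b`. -/
theorem IsUniversalSolution.coeff_succ_fst_right (h : IsUniversalSolution A B) (n : ℕ) :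
    PowerSeries.coeff (n + 1) B.fst = PowerSeries.coeff (n + 1) A.fst -
      (n + 2) * PowerSeries.coeff (n + 2) (psi K) := by
  set H : K → K := fun b => B.affineCoeff 1 b n - A.affineCoeff 1 b n with hH
  have key : ∀ b : K, b * H b =
      (1 + b ^ (n + 2) - (1 + b) ^ (n + 2)) * PowerSeries.coeff (n + 2) (psi K) := fun b => by
    by_cases hb : b = 0
    · simp [hb]
    · have := congrArg (PowerSeries.coeff (n + 2)) (h.trace_identity hb)
      rw [map_add, PowerSeries.coeff_C_mul, PowerSeries.coeff_X, if_neg (by omega),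
        PowerSeries.coeff_C_mul, PowerSeries.coeff_succ_X_mul, PowerSeries.coeff_succ_X_mul,
        map_sub, PowerSeries.coeff_mk, PowerSeries.coeff_mk, map_sub, map_add,
        coeff_rescale_psi, coeff_rescale_psi] at this
      linear_combination this
  have hd : DifferentiableAt K H 0 := by
    have hA := A.differentiable_remScalar 1 n
    have hB := B.differentiable_remScalar 1 n
    simp only [hH, LieSeries.affineCoeff]
    fun_prop
  have d1 : HasDerivAt (fun b => b * H b) (H 0) 0 := by
    have d0 := (hasDerivAt_id (0 : K)).mul hd.hasDerivAt
    simp only [id, one_mul, zero_mul, add_zero] at d0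
    exact d0
  have d2 : HasDerivAt (fun b : K => (1 + b ^ (n + 2) - (1 + b) ^ (n + 2)) *
      PowerSeries.coeff (n + 2) (psi K))
      (-((n : K) + 2) * PowerSeries.coeff (n + 2) (psi K)) 0 := by
    have d3 := (((hasDerivAt_id (0 : K)).pow (n + 2)).const_add 1).sub
      (((hasDerivAt_id (0 : K)).const_add 1).pow (n + 2))
    have d4 := d3.mul_const (PowerSeries.coeff (n + 2) (psi K))
    simpa using d4
  -- both sides of `key` are differentiated at `b = 0`, where only `A.fst` and `B.fst` remain
  have e := d1.unique (d2.congr_of_eventuallyEq (Eventually.of_forall key))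
  simp only [hH, LieSeries.affineCoeff_zero_right, one_pow, mul_one] at e
  linear_combination e

/-- A universal solution, symmetric or not, has `γ = γ_α`. -/
theorem IsUniversalSolution.fst_right (h : IsUniversalSolution A B) :
    B.fst = gammaAlpha B.lin := by
  ext n
  cases n with
  | zero =>
    rw [h.coeff_zero_fst_right, gammaAlpha]
    simp
  | succ n =>
    rw [h.coeff_succ_fst_right, h.fst_left.2, gammaAlpha]
    simp only [map_add, map_sub, PowerSeries.coeff_C, PowerSeries.coeff_derivative]
    simp
    ring

/-- A symmetric solution has `α = 1/4`: on `X = 0` the symmetry gives `β(0) = -α`, whereas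
`β_α(0) = α - 1/2`. -/
theorem IsUniversalSymmetricSolution.lin_right (h : IsUniversalSymmetricSolution A B) :
    B.lin = 1 / 4 := by
  obtain ⟨hs, -⟩ := h.1 (Aff K)
  have h1 := eventually_affine (K := K) hs (Aff.D K) (Aff.E K)
  have h2 := eventually_affine (K := K) (h.2 (Aff K)) (Aff.D K) (Aff.E K)
  have hc1 : Continuous fun v : K => (((0, 0), (0, v)) : (K × K) × (K × K)) := by fun_prop
  have hc2 : Continuous fun v : K => (((0, -v), (0, 0)) : (K × K) × (K × K)) := by fun_prop
  have hne : ∀ᶠ τ in 𝓝[≠] (0 : K), τ ≠ 0 := self_mem_nhdsWithin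
  obtain ⟨v, ⟨s1, s2, s3⟩, hv⟩ := (((((hc1.tendsto 0).eventually h1).and
    (((hc2.tendsto' 0 0 (by simp)).eventually h1).and
    ((hc1.tendsto 0).eventually h2))).filter_mono nhdsWithin_le_nhds).and hne).exists
  have e := s3.1
  have e1 : -((0 : K) • Aff.D K + v • Aff.E K) = (0 : K) • Aff.D K + (-v) • Aff.E K := by module
  have e2 : -((0 : K) • Aff.D K + (0 : K) • Aff.E K) = (0 : K) • Aff.D K + (0 : K) • Aff.E K := by
    module
  dsimp only at e s1 s2
  rw [e1, e2, LieSeries.eval_affine Aff.E_ne_zero Aff.lie_D_E A s1.1,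
    LieSeries.eval_affine Aff.E_ne_zero Aff.lie_D_E B s2.2] at e
  have e3 := congrArg (fun x : Aff K => x.2) e
  simp only [Aff.add_snd, Aff.smul_snd, Aff.D_snd, Aff.E_snd] at e3
  have e4 : PowerSeries.coeff 0 A.fst = -B.lin := by
    refine mul_left_cancel₀ hv ?_
    linear_combination e3
  have e5 : PowerSeries.coeff 0 (betaAlpha B.lin) = B.lin - 1 / 2 := by
    rw [betaAlpha, PowerSeries.coeff_mul]
    simp [divT, coeff_neg', coeff_phi1_one, coeff_phi1_zero, PowerSeries.coeff_one,
      -PowerSeries.coeff_zero_eq_constantCoeff]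
    ring
  rw [h.1.fst_left.2, e5] at e4
  linear_combination (1 / 2 : K) * e4

end TraceEquation

/-! ### The split oscillator algebra -/
section Oscillator
variable (K : Type) [RCLike K]
open Filter

/-- The split oscillator algebra, with basis `D, E, F, C` and brackets `[D, E] = E`,
`[D, F] = -F`, `[E, F] = C`, the element `C` being central.  It is a quadratic Lie algebra which
contains the affine Lie algebra of the line, as the span of `D` and `E`. -/
def Osc : Type := Fin 4 → K

namespace Osc

instance : AddCommGroup (Osc K) := inferInstanceAs (AddCommGroup (Fin 4 → K))
instance : Module K (Osc K) := inferInstanceAs (Module K (Fin 4 → K))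
instance : TopologicalSpace (Osc K) := inferInstanceAs (TopologicalSpace (Fin 4 → K))
instance : IsTopologicalAddGroup (Osc K) := inferInstanceAs (IsTopologicalAddGroup (Fin 4 → K))
instance : ContinuousSMul K (Osc K) := inferInstanceAs (ContinuousSMul K (Fin 4 → K))
instance : T2Space (Osc K) := inferInstanceAs (T2Space (Fin 4 → K))
instance : FiniteDimensional K (Osc K) := inferInstanceAs (FiniteDimensional K (Fin 4 → K))

variable {K}

/-- The element `d D + e E + f F + c C`. -/
def mk (d e f c : K) : Osc K := ![d, e, f, c]

/-- The coordinate of index `i`. -/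
def coord (i : Fin 4) (x : Osc K) : K := x i

omit [RCLike K] in
theorem ext {x y : Osc K} (h0 : coord 0 x = coord 0 y) (h1 : coord 1 x = coord 1 y)
    (h2 : coord 2 x = coord 2 y) (h3 : coord 3 x = coord 3 y) : x = y := by
  funext i
  fin_cases i
  exacts [h0, h1, h2, h3]

@[simp] theorem coord_add (i : Fin 4) (x y : Osc K) : coord i (x + y) = coord i x + coord i y := rfl
@[simp] theorem coord_smul (i : Fin 4) (c : K) (x : Osc K) : coord i (c • x) = c * coord i x := rfl
@[simp] theorem coord_zero (i : Fin 4) : coord i (0 : Osc K) = 0 := rfl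
omit [RCLike K] in
@[simp] theorem coord_mk_zero (d e f c : K) : coord 0 (mk d e f c) = d := rfl
omit [RCLike K] in
@[simp] theorem coord_mk_one (d e f c : K) : coord 1 (mk d e f c) = e := rfl
omit [RCLike K] in
@[simp] theorem coord_mk_two (d e f c : K) : coord 2 (mk d e f c) = f := rfl
omit [RCLike K] in
@[simp] theorem coord_mk_three (d e f c : K) : coord 3 (mk d e f c) = c := rfl

instance : Bracket (Osc K) (Osc K) := ⟨fun x y => mk 0
  (coord 0 x * coord 1 y - coord 1 x * coord 0 y)
  (coord 2 x * coord 0 y - coord 0 x * coord 2 y)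
  (coord 1 x * coord 2 y - coord 2 x * coord 1 y)⟩

theorem lie_def (x y : Osc K) : ⁅x, y⁆ = mk 0
  (coord 0 x * coord 1 y - coord 1 x * coord 0 y)
  (coord 2 x * coord 0 y - coord 0 x * coord 2 y)
  (coord 1 x * coord 2 y - coord 2 x * coord 1 y) := rfl

instance : LieRing (Osc K) where
  add_lie x y z := by apply ext <;> simp [lie_def] <;> ring
  lie_add x y z := by apply ext <;> simp [lie_def] <;> ring
  lie_self x := by apply ext <;> simp [lie_def] <;> ring
  leibniz_lie x y z := by apply ext <;> simp [lie_def] <;> ring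

instance : LieAlgebra K (Osc K) where
  lie_smul c x y := by apply ext <;> simp [lie_def] <;> ring

/-- The bilinear form with `⟨D, C⟩ = ⟨E, F⟩ = 1`, the other products of basis elements being `0`. -/
def form : LinearMap.BilinForm K (Osc K) := LinearMap.mk₂ K
  (fun x y => coord 0 x * coord 3 y + coord 3 x * coord 0 y + coord 1 x * coord 2 y +
    coord 2 x * coord 1 y)
  (fun x y z => by simp; ring) (fun c x y => by simp; ring)
  (fun x y z => by simp; ring) (fun c x y => by simp; ring)

theorem form_apply (x y : Osc K) : form x y = coord 0 x * coord 3 y + coord 3 x * coord 0 y +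
    coord 1 x * coord 2 y + coord 2 x * coord 1 y := rfl

theorem form_isSymm : (form (K := K)).IsSymm := ⟨fun x y => by
  simp only [form_apply]; ring⟩

theorem form_nondegenerate : (form (K := K)).Nondegenerate := by
  refine (LinearMap.IsRefl.nondegenerate_iff_separatingLeft
    (B := form (K := K)) fun x y h => ?_).2 fun x hx => ?_
  · rw [← h]
    simp only [form_apply]; ring
  apply ext
  · simpa [form_apply] using hx (mk 0 0 0 1)
  · simpa [form_apply] using hx (mk 0 0 1 0)
  · simpa [form_apply] using hx (mk 0 1 0 0)
  · simpa [form_apply] using hx (mk 1 0 0 0)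

variable (K) in
/-- The split oscillator algebra as a quadratic Lie algebra. -/
def quadratic : QuadraticStructure K (Osc K) where
  form := form
  symm := form_isSymm
  nondegenerate := form_nondegenerate
  invariant x y z := by simp [form_apply, lie_def]; ring

variable (K) in
/-- The generator `D`. -/
def D : Osc K := mk 1 0 0 0
variable (K) in
/-- The generator `E`. -/
def E : Osc K := mk 0 1 0 0

theorem lie_D_E : ⁅D K, E K⁆ = E K := by apply ext <;> simp [lie_def, D, E]

theorem E_ne_zero : E K ≠ 0 := fun h => by
  have := congrArg (coord 1) h
  simp [E] at this

theorem D_ne_zero : D K ≠ 0 := fun h => by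
  have := congrArg (coord 0) h
  simp [D] at this

theorem tendsto_smul_D : Tendsto (fun a : K => a • D K) (𝓝 0) (𝓝 0) := by
  have : Continuous fun a : K => a • D K := by fun_prop
  exact this.tendsto' 0 0 (zero_smul _ _)

theorem eventually_adSeries {f : K⟦X⟧} (hf : HasGeomBound f) :
    ∀ᶠ a in 𝓝 (0 : K), adSeries f (a • D K) (E K) = ev f a • E K := by
  filter_upwards [tendsto_smul_D.eventually (eventually_summable_adSeries hf)] with a ha
  exact adSeries_eigenvector (by rw [smul_lie, lie_D_E]) ha

end Osc

variable {K}

/-- The first order part of Vergne's solution is determined by its values on the oscillator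
algebra. -/
theorem eq_gammaV_of_hasFirstOrderPart {γ : K⟦X⟧}
    (h : (Osc.quadratic K).HasFirstOrderPart γ) : γ = gammaV K := by
  have hV := (Osc.quadratic K).hasFirstOrderPart_gammaV
  have hb := HasGeomBound.gammaV (K := K)
  have h0 : ∀ᶠ a in 𝓝[≠] (0 : K), ev (gammaV K) a ≠ 0 := by
    by_contra hc
    have hf : ∃ᶠ a in 𝓝[≠] (0 : K), ev (gammaV K) a = ev (PowerSeries.C (0 : K)) a := by
      refine fun h0 => hc (h0.mono fun a ha => ?_)
      simpa only [ev_C] using ha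
    have := congrArg (PowerSeries.coeff 1) (hb.ext_of_frequently (.C 0) hf)
    rw [coeff_gammaV_one] at this
    simp at this
  have hne : ∀ᶠ a in 𝓝[≠] (0 : K), a ≠ 0 := self_mem_nhdsWithin
  have key : ∀ᶠ a in 𝓝[≠] (0 : K), (Summable fun n => PowerSeries.coeff n γ * a ^ n) ∧
      ev γ a = ev (gammaV K) a := by
    filter_upwards [h0, (Osc.tendsto_smul_D.eventually h).filter_mono nhdsWithin_le_nhds,
      (Osc.tendsto_smul_D.eventually hV).filter_mono nhdsWithin_le_nhds,
      (Osc.eventually_adSeries hb).filter_mono nhdsWithin_le_nhds] with a ha h1 h2 h3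
    have e := hasFDerivAt_unique h1.2 h2.2
    rw [← e] at h3
    have hs : Summable fun n => PowerSeries.coeff n γ •
        (LinearMap.toContinuousLinearMap
          (LieAlgebra.ad K (Osc K) (a • Osc.D K) : Osc K →ₗ[K] Osc K)) ^ n := by
      -- a divergent series would have the sum `0`
      by_contra hc
      rw [adSeries, tsum_eq_zero_of_not_summable hc] at h3
      exact smul_ne_zero ha Osc.E_ne_zero h3.symm
    have hl : ⁅a • Osc.D K, Osc.E K⁆ = a • Osc.E K := by rw [smul_lie, Osc.lie_D_E]
    obtain ⟨s, hs1, -⟩ := exists_hasSum_of_hasSum_smul Osc.E_ne_zero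
      (hasSum_adSeries_eigenvector hl hs)
    refine ⟨hs1.summable, ?_⟩
    rw [adSeries_eigenvector hl hs] at h3
    exact smul_left_injective K Osc.E_ne_zero h3
  obtain ⟨a, ha, ha0⟩ := (key.and hne).exists
  exact (HasGeomBound.of_summable ha0 ha.1).ext hb (key.mono fun a h => h.2)

/-- If Vergne's solution on the oscillator algebra were the sum of a universal solution, then `γ_V`
would be the series `γ_{1/4}`. -/
theorem IsUniversalSolution.not_eventually_eq_vergneB {A B : LieSeries K}
    (h : IsUniversalSolution A B) : ¬ ∀ᶠ p : Osc K × Osc K in 𝓝 (0, 0),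
      B.eval p.1 p.2 = (Osc.quadratic K).vergneB p.1 p.2 := by
  intro hB
  have hs := (h (Osc K)).1
  have hV := (Osc.quadratic K).hasFirstOrderPart_gammaV
  have hb := HasGeomBound.gammaV (K := K)
  have hne : ∀ᶠ a in 𝓝[≠] (0 : K), a ≠ 0 := self_mem_nhdsWithin
  have h1 := eventually_affine (K := K) (hs.and hB) (Osc.D K) (Osc.E K)
  have hc : Continuous fun q : K × K => (((q.1, 0), (0, q.2)) : (K × K) × (K × K)) := by fun_prop
  have h2 := (hc.tendsto (0, 0)).eventually h1
  rw [nhds_prod_eq] at h2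
  have h3 := h2.curry
  have h4 : ∀ᶠ a in 𝓝[≠] (0 : K), B.lin = 1 / 4 ∧ HasGeomBound B.fst ∧
      ev B.fst a = ev (gammaV K) a := by
    filter_upwards [h3.filter_mono nhdsWithin_le_nhds, hne,
      (Osc.tendsto_smul_D.eventually hV).filter_mono nhdsWithin_le_nhds,
      (Osc.eventually_adSeries hb).filter_mono nhdsWithin_le_nhds] with a ha ha0 ⟨e0, e1⟩ e2
    obtain ⟨v, hv, hv0⟩ := ((ha.filter_mono nhdsWithin_le_nhds).and hne).exists
    have hlin : B.lin = 1 / 4 := by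
      have e3 := ha.self_of_nhds.2
      rw [LieSeries.eval_affine Osc.E_ne_zero Osc.lie_D_E B ha.self_of_nhds.1.2] at e3
      simp only [zero_smul, add_zero, smul_zero, mul_zero, sub_self, zero_mul] at e3
      rw [e0] at e3
      exact smul_left_injective K (smul_ne_zero ha0 Osc.D_ne_zero) e3
    refine ⟨hlin, LieSeries.hasGeomBound_fst Osc.E_ne_zero Osc.lie_D_E B hv0 ha0 hv.1.2, ?_⟩
    have e3 := hasFDerivAt_apply_eq_of_line (E := Osc.E K) (base := (B.lin * a) • Osc.D K)
      (w := ev B.fst a • Osc.E K) e1 (by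
        filter_upwards [ha] with v hv
        by_cases hv0 : v = 0
        · rw [hv0, zero_smul, zero_add, e0, hlin]
          module
        · have e4 := hv.2
          rw [LieSeries.eval_smul_smul Osc.E_ne_zero Osc.lie_D_E B hv0 hv.1.2] at e4
          simp only [zero_smul, add_zero, zero_add] at e4 ⊢
          rw [← e4, mul_smul v])
    rw [e2] at e3
    exact (smul_left_injective K Osc.E_ne_zero e3).symm
  obtain ⟨a, hlin, hgb, -⟩ := h4.exists
  have e := hgb.ext hb (h4.mono fun a h => h.2.2)
  rw [h.fst_right, hlin] at e
  exact gammaV_ne_gammaAlpha e.symm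

end Oscillator

end

end KashiwaraVergne

theorem mainTheorem4 {K : Type} [RCLike K] :
    -- the first-order coefficient of Vergne's solution
    (∃ γV : K⟦X⟧,
      (∀ (g : Type*) [LieRing g] [LieAlgebra K g] [TopologicalSpace g]
        [IsTopologicalAddGroup g] [ContinuousSMul K g] [T2Space g] [FiniteDimensional K g]
        (Q : KashiwaraVergne.QuadraticStructure K g), Q.HasFirstOrderPart γV) ∧
      (∀ γ : K⟦X⟧,
        (∀ (g : Type) [LieRing g] [LieAlgebra K g] [TopologicalSpace g]
          [IsTopologicalAddGroup g] [ContinuousSMul K g] [T2Space g] [FiniteDimensional K g]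
          (Q : KashiwaraVergne.QuadraticStructure K g), Q.HasFirstOrderPart γ) → γ = γV) ∧
      KashiwaraVergne.eulerPlusTwo γV =
        PowerSeries.C (1 / 8 : K) * PowerSeries.X -
          PowerSeries.C (1 / 2 : K) * PowerSeries.X *
            KashiwaraVergne.neg (KashiwaraVergne.phi1 K) * KashiwaraVergne.R K *
            PowerSeries.derivative K (KashiwaraVergne.phi1 K) ∧
      PowerSeries.X ^ 5 ∣ KashiwaraVergne.eulerPlusTwo γV -
        (PowerSeries.C (1 / 8 : K) * PowerSeries.X + PowerSeries.C (1 / 12 : K) * PowerSeries.X ^ 2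
          + PowerSeries.C (1 / 72 : K) * PowerSeries.X ^ 3
          - PowerSeries.C (1 / 360 : K) * PowerSeries.X ^ 4) ∧
      (∀ n : ℕ, Odd n → PowerSeries.coeff n γV =
        PowerSeries.coeff n (KashiwaraVergne.gammaAlpha (1 / 4 : K)))) ∧
    -- the first-order coefficient of a universal symmetric solution
    (∀ A B : KashiwaraVergne.LieSeries K, KashiwaraVergne.IsUniversalSymmetricSolution A B →
      B.lin = 1 / 4 ∧ B.fst = KashiwaraVergne.gammaAlpha (1 / 4 : K)) ∧
    PowerSeries.X ^ 5 ∣ KashiwaraVergne.eulerPlusTwo (KashiwaraVergne.gammaAlpha (1 / 4 : K)) -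
      (PowerSeries.C (1 / 8 : K) * PowerSeries.X + PowerSeries.C (1 / 12 : K) * PowerSeries.X ^ 2
        + PowerSeries.C (1 / 72 : K) * PowerSeries.X ^ 3
        - PowerSeries.C (1 / 480 : K) * PowerSeries.X ^ 4) ∧
    -- Vergne's solution is not universal
    ¬ ∃ A B : KashiwaraVergne.LieSeries K, KashiwaraVergne.IsUniversalSolution A B ∧
      ∀ (g : Type) [LieRing g] [LieAlgebra K g] [TopologicalSpace g]
        [IsTopologicalAddGroup g] [ContinuousSMul K g] [T2Space g] [FiniteDimensional K g]
        (Q : KashiwaraVergne.QuadraticStructure K g),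
        ∀ᶠ p : g × g in 𝓝 (0, 0), B.eval p.1 p.2 = Q.vergneB p.1 p.2 := by
  refine ⟨⟨KashiwaraVergne.gammaV K, fun g _ _ _ _ _ _ _ Q => Q.hasFirstOrderPart_gammaV,
    fun γ h => KashiwaraVergne.eq_gammaV_of_hasFirstOrderPart
      (h (KashiwaraVergne.Osc K) (KashiwaraVergne.Osc.quadratic K)),
    KashiwaraVergne.eulerPlusTwo_gammaV, ?_, fun n => KashiwaraVergne.coeff_gammaV_of_odd⟩,
    fun A B h => ⟨h.lin_right, ?_⟩, KashiwaraVergne.X_pow_five_dvd_gammaAlpha, ?_⟩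
  · rw [KashiwaraVergne.eulerPlusTwo_gammaV]
    exact KashiwaraVergne.X_pow_five_dvd_gammaVRhs
  · rw [h.1.fst_right, h.lin_right]
  · rintro ⟨A, B, h, hB⟩
    exact h.not_eventually_eq_vergneB (hB (KashiwaraVergne.Osc K) (KashiwaraVergne.Osc.quadratic K))
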